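/- Let $G$ be a connected simple graph with $n\ge 2$ vertices and $Q$ a non-empty set of query vertices. The support of an edge in a graph $H$ is the number of triangles of $H$ containing it, and $H$ is a $k$-truss if every edge of $H$ has support at least $k-2$ in $H$. The trussness $\tau(H)$ of a graph $H$ with at least one edge is the largest $k$ for which $H$ is a $k$-truss, and the trussness $\tau(e)$ of an edge $e$ of $G$ is the largest trussness of a subgraph of $G$ containing $e$. Let $k$ be the largest trussness of a connected subgraph of $G$ (with at least one edge) containing $Q$, and let $G_0$ be the maximal connected $k$-truss of $G$ containing $Q$. Write $n'$, $m'$, $d'_{\max}$ for the number of vertices, the number of edges and the maximum degree of $G_0$, and $\rho'$ for its arboricity, i.e. the minimum number of spanning forests that cover its edges. For a subgraph $H$ put $\mathrm{dist}_H(u,Q)=\max_{q\in Q}\mathrm{dist}_H(u,q)$ and $\mathrm{dist}_H(H,Q)=\max_{u\in H}\mathrm{dist}_H(u,Q)$. Algorithm BulkDelete finds $G_0$, sets $d=+\infty$ and $l=0$, and repeats the following as long as $G_l$ contains $Q$ and connects it: set $d\leftarrow\min\{d,\mathrm{dist}_{G_l}(G_l,Q)\}$; delete from $G_l$ all vertices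 $u$ with $\mathrm{dist}_{G_l}(u,Q)\ge d-1$; restore the $k$-truss property (delete edges of support less than $k-2$ as long as there are any, then isolated vertices and vertices disconnected from $Q$); call the result $G_{l+1}$ and increase $l$ by one. It returns a graph $R$ with the smallest $\mathrm{dist}_R(R,Q)$ among the graphs $G_l$ for which the loop was entered. The algorithm stops after a number $t'$ of iterations with $t'=O(n'/k)$. Given read-only access, at unit cost per look-up, to $Q$ and to the truss index of $G$ (for every vertex, its adjacency list sorted by descending edge trussness, with its length, its vertex trussness — the largest trussness of an incident edge — and a mark at the first entry of each trussness value; and a table of the trussness of all edges), it can be implemented on a unit-cost random access machine with words of $O(\log n)$ bits so as to take $$O\big((|Q|\,t'+\rho')\,m'\big)$$ time and to use $O(m')$ words of working memory (the number of distinct memory cells accessed). All constants are absolute. Moreover $\rho'\le d'_{\max}$, and $\rho'\le\sqrt{m'}$ unless $G_0$ is a triangle, so that $\rho'\le\min\{d'_{\max},\sqrt{m'}\}$ with this one exception. -/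

import Mathlib

noncomputable section

namespace TrussSearch

/-! ### Trusses, distances, arboricity

A subgraph is a `SimpleGraph.Subgraph`, with its own vertex set. -/

section Graphs

variable {V : Type*} {G : SimpleGraph V}

/-- `sup_H(uv)`: the number of triangles of `H` on the edge `uv`. -/
def support (H : G.Subgraph) (u v : V) : ℕ := (H.neighborSet u ∩ H.neighborSet v).ncard

/-- Every edge of `H` has support at least `k - 2` in `H`. -/
def IsTruss (H : G.Subgraph) (k : ℕ) : Prop := ∀ u v, H.Adj u v → k ≤ support H u v + 2

/-- `τ(H)`: two plus the minimum support of an edge (used for subgraphs with an edge only). -/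
def trussness (H : G.Subgraph) : ℕ := 2 + sInf {s | ∃ u v, H.Adj u v ∧ s = support H u v}

/-- `τ(uv)`: the maximum trussness of a subgraph having `uv` as an edge; `0` for a non-edge. -/
def edgeTrussness (G : SimpleGraph V) (u v : V) : ℕ :=
  sSup {t | ∃ H : G.Subgraph, H.Adj u v ∧ t = trussness H}

/-- The largest trussness of a connected subgraph containing `Q`. -/
def maxTrussness (G : SimpleGraph V) (Q : Set V) : ℕ :=
  sSup {t | ∃ H : G.Subgraph, H.Connected ∧ Q ⊆ H.verts ∧ H.edgeSet.Nonempty ∧ t = trussness H}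

/-- `G₀`: the maximal connected `k`-truss containing `Q`, for the largest possible `k`
(the union of all of them, which is again one of them when `Q` is non-empty). -/
def startGraph (G : SimpleGraph V) (Q : Set V) : G.Subgraph :=
  sSup {H | H.Connected ∧ Q ⊆ H.verts ∧ H.edgeSet.Nonempty ∧ IsTruss H (maxTrussness G Q)}

/-- `connect_H(Q)`: `H` contains `Q`, and any two vertices of `Q` are joined by a path in `H`. -/
def Connects (H : G.Subgraph) (Q : Set V) : Prop :=
  Q ⊆ H.verts ∧ ∀ p ∈ Q, ∀ q ∈ Q, H.spanningCoe.Reachable p q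

/-- `dist_H(u, Q) = max_{q ∈ Q} dist_H(u, q)`, which may be infinite. -/
def queryDist (H : G.Subgraph) (Q : Set V) (u : V) : ℕ∞ := ⨆ q ∈ Q, H.spanningCoe.edist u q

/-- `dist_H(H, Q) = max_{u ∈ H} dist_H(u, Q)`. -/
def graphDist (H : G.Subgraph) (Q : Set V) : ℕ∞ := ⨆ u ∈ H.verts, queryDist H Q u

/-- The number of vertices. -/
def numVerts (H : G.Subgraph) : ℕ := H.verts.ncard

/-- The number of edges. -/
def numEdges (H : G.Subgraph) : ℕ := H.edgeSet.ncard

/-- The maximum degree (of a finite graph). -/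
def maxDegree (H : G.Subgraph) : ℕ := ⨆ v, (H.neighborSet v).ncard

/-- The minimum number of spanning forests that cover all edges. -/
def arboricity (H : G.Subgraph) : ℕ :=
  sInf {a | ∃ F : Fin a → SimpleGraph V,
    (∀ i, F i ≤ H.spanningCoe ∧ (F i).IsAcyclic) ∧ H.spanningCoe ≤ ⨆ i, F i}

/-! ### The rounds of BulkDelete -/

/-- The largest subgraph of `H` in which every edge has support at least `k - 2` and no vertex is
isolated: what is left when edges of too small support are deleted as long as there are any,
and isolated vertices are removed. -/
def trussPart (k : ℕ) (H : G.Subgraph) : G.Subgraph :=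
  sSup {K | K ≤ H ∧ IsTruss K k ∧ ∀ v ∈ K.verts, ∃ w, K.Adj v w}

/-- Truss maintenance: restore the `k`-truss property and drop the vertices disconnected
from `Q`. -/
def maintain (k : ℕ) (Q : Set V) (H : G.Subgraph) : G.Subgraph :=
  (trussPart k H).induce
    {v | v ∈ (trussPart k H).verts ∧ ∃ q ∈ Q, (trussPart k H).spanningCoe.Reachable q v}

/-- The variables `G_l` and `d` of the algorithm. -/
structure State (G : SimpleGraph V) where
  graph : G.Subgraph
  d : ℕ∞

/-- One round: `d` becomes `dist_{G_l}(G_l, Q)` if this is smaller, all vertices `u` of `G_l` with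
`dist_{G_l}(u, Q) ≥ d - 1` are deleted, and the `k`-truss property is restored. -/
def nextState (k : ℕ) (Q : Set V) (s : State G) : State G :=
  let d := min s.d (graphDist s.graph Q)
  let L : Set V := {u | u ∈ s.graph.verts ∧ d ≤ queryDist s.graph Q u + 1}
  ⟨maintain k Q (s.graph.deleteVerts L), d⟩

/-- The state before round `l`. (The algorithm stops at the first `l` with
`connect_{G_l}(Q)` false.) -/
def stateAt (G : SimpleGraph V) (Q : Set V) : ℕ → State G
  | 0 => ⟨startGraph G Q, ⊤⟩
  | l + 1 => nextState (maxTrussness G Q) Q (stateAt G Q l)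

/-- The graph `G_l`. -/
def graphAt (G : SimpleGraph V) (Q : Set V) (l : ℕ) : G.Subgraph := (stateAt G Q l).graph

end Graphs

/-! ### The input: the truss index and the query -/

/-- Adjacency lists, each sorted by descending edge trussness. The other parts of the index (marks,
vertex trussness, table of edge trussness) are determined by them, see `TrussIndex.ask`. -/
structure TrussIndex {n : ℕ} (G : SimpleGraph (Fin n)) where
  nbrs : Fin n → List (Fin n)
  nodup : ∀ v, (nbrs v).Nodup
  mem_iff : ∀ v u, u ∈ nbrs v ↔ G.Adj v u
  sorted : ∀ v, (nbrs v).Pairwise fun a b => edgeTrussness G v b ≤ edgeTrussness G v a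

/-- The elementary look-ups in the read-only input. -/
inductive Query
  | numVertices | numQueryNodes | queryNode | degree | neighbour | mark | vertexTruss | edgeTruss

/-- The answers: the number of vertices; `|Q|`; the `x`-th query node; the length of the adjacency
list of `x`; the `y`-th entry of that list; the position of the first `u` in it with `τ(x, u) = y`;
the trussness `max_u τ(x, u)` of `x`; the table of edge trussness (`0` for a non-edge). The answer
to a meaningless look-up is `0`. -/
def TrussIndex.ask {n : ℕ} {G : SimpleGraph (Fin n)} (I : TrussIndex G) (Q : List (Fin n)) :
    Query → ℕ → ℕ → ℕ
  | .numVertices, _, _ => n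
  | .numQueryNodes, _, _ => Q.length
  | .queryNode, x, _ => if h : x < Q.length then (Q[x] : Fin n) else 0
  | .degree, x, _ => if h : x < n then (I.nbrs ⟨x, h⟩).length else 0
  | .neighbour, x, y =>
      if h : x < n then
        if h' : y < (I.nbrs ⟨x, h⟩).length then ((I.nbrs ⟨x, h⟩)[y] : Fin n) else 0
      else 0
  | .mark, x, y =>
      if h : x < n then (I.nbrs ⟨x, h⟩).findIdx (fun u => edgeTrussness G ⟨x, h⟩ u == y) else 0
  | .vertexTruss, x, _ =>
      if h : x < n then Finset.univ.sup (fun u => edgeTrussness G ⟨x, h⟩ u) else 0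
  | .edgeTruss, x, y =>
      if h : x < n ∧ y < n then edgeTrussness G ⟨x, h.1⟩ ⟨y, h.2⟩ else 0

/-! ### A random access machine with unit costs and bounded words

Structured programs over registers and finitely many zero-initialised arrays of words. -/

/-- Word operations. -/
inductive Op
  | add | sub | mul | lt | eq

/-- Their meaning; `sub` is truncated, and the truth values are `1` and `0`. -/
def Op.eval : Op → ℕ → ℕ → ℕ
  | .add, x, y => x + y
  | .sub, x, y => x - y
  | .mul, x, y => x * y
  | .lt, x, y => if x < y then 1 else 0
  | .eq, x, y => if x = y then 1 else 0

/-- Expressions over registers. -/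
inductive Expr
  | lit (c : ℕ)
  | reg (r : ℕ)
  | bin (o : Op) (a b : Expr)

/-- The value of an expression. -/
def Expr.eval (s : ℕ → ℕ) : Expr → ℕ
  | .lit c => c
  | .reg r => s r
  | .bin o a b => o.eval (a.eval s) (b.eval s)

/-- The number of nodes of an expression, which is the time for evaluating it. -/
def Expr.cost : Expr → ℕ
  | .lit _ => 1
  | .reg _ => 1
  | .bin _ a b => a.cost + b.cost + 1

/-- The largest value that occurs in the evaluation. -/
def Expr.peak (s : ℕ → ℕ) : Expr → ℕ
  | .lit c => c
  | .reg r => s r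
  | .bin o a b => max (max (a.peak s) (b.peak s)) (o.eval (a.eval s) (b.eval s))

/-- Programs. `load r A a` is `r := A[a]`, `store A a b` is `A[a] := b`, and `ask r q a b` looks up
the input. -/
inductive Prog
  | assign (r : ℕ) (a : Expr)
  | load (r A : ℕ) (a : Expr)
  | store (A : ℕ) (a b : Expr)
  | ask (r : ℕ) (q : Query) (a b : Expr)
  | seq (p q : Prog)
  | ite (a : Expr) (p q : Prog)
  | loop (a : Expr) (p : Prog)

/-- A configuration: registers, arrays, and the set of array cells accessed so far. -/
structure Config where
  reg : ℕ → ℕ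
  mem : ℕ → ℕ → ℕ
  used : Finset (ℕ × ℕ)

/-- The initial configuration: everything is zero, no cell has been accessed. -/
def Config.start : Config := ⟨fun _ => 0, fun _ _ => 0, ∅⟩

/-- Assignment to a register. -/
def Config.setReg (c : Config) (r x : ℕ) : Config := { c with reg := Function.update c.reg r x }

/-- Assignment to a cell. -/
def Config.setMem (c : Config) (A i x : ℕ) : Config :=
  { c with mem := Function.update c.mem A (Function.update (c.mem A) i x) }

/-- Recording the access to a cell. -/
def Config.touch (c : Config) (A i : ℕ) : Config := { c with used := insert (A, i) c.used }

/-- `Exec inp B p c T c'`: started in `c`, the program `p` halts in `c'` after exactly `T` steps,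
and no value beyond the word bound `B` is produced on the way. -/
inductive Exec (inp : Query → ℕ → ℕ → ℕ) (B : ℕ) : Prog → Config → ℕ → Config → Prop
  | assign {r a c} (h : a.peak c.reg ≤ B) :
      Exec inp B (.assign r a) c (a.cost + 1) (c.setReg r (a.eval c.reg))
  | load {r A a c} (h : a.peak c.reg ≤ B) :
      Exec inp B (.load r A a) c (a.cost + 1)
        ((c.touch A (a.eval c.reg)).setReg r (c.mem A (a.eval c.reg)))
  | store {A a b c} (ha : a.peak c.reg ≤ B) (hb : b.peak c.reg ≤ B) :
      Exec inp B (.store A a b) c (a.cost + b.cost + 1)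
        ((c.touch A (a.eval c.reg)).setMem A (a.eval c.reg) (b.eval c.reg))
  | ask {r q a b c} (ha : a.peak c.reg ≤ B) (hb : b.peak c.reg ≤ B)
      (h : inp q (a.eval c.reg) (b.eval c.reg) ≤ B) :
      Exec inp B (.ask r q a b) c (a.cost + b.cost + 1)
        (c.setReg r (inp q (a.eval c.reg) (b.eval c.reg)))
  | seq {p q c c' c'' T T'} (hp : Exec inp B p c T c') (hq : Exec inp B q c' T' c'') :
      Exec inp B (.seq p q) c (T + T') c''
  | ite_true {a p q c c' T} (h : a.peak c.reg ≤ B) (ha : a.eval c.reg ≠ 0)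
      (hp : Exec inp B p c T c') : Exec inp B (.ite a p q) c (a.cost + 1 + T) c'
  | ite_false {a p q c c' T} (h : a.peak c.reg ≤ B) (ha : a.eval c.reg = 0)
      (hq : Exec inp B q c T c') : Exec inp B (.ite a p q) c (a.cost + 1 + T) c'
  | loop_true {a p c c' c'' T T'} (h : a.peak c.reg ≤ B) (ha : a.eval c.reg ≠ 0)
      (hp : Exec inp B p c T c') (hl : Exec inp B (.loop a p) c' T' c'') :
      Exec inp B (.loop a p) c (a.cost + 1 + T + T') c''
  | loop_false {a p c} (h : a.peak c.reg ≤ B) (ha : a.eval c.reg = 0) :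
      Exec inp B (.loop a p) c (a.cost + 1) c

/-! ### Implementations of BulkDelete -/

/-- A program whose main part is a loop: find `G₀`; while `test` do `body`; select the result. -/
structure LoopProgram where
  init : Prog
  test : Expr
  body : Prog
  final : Prog

/-- The whole program. -/
def LoopProgram.code (P : LoopProgram) : Prog := .seq P.init (.seq (.loop P.test P.body) P.final)

section Implementation

variable {n : ℕ} {G : SimpleGraph (Fin n)}

/-- The set of the query nodes in a list. -/
def nodes (Q : List (Fin n)) : Set (Fin n) := {q | q ∈ Q}

/-- The configuration `c` stores the graphs `G_0, …, G_l`, by attaching to each vertex `v` (cell `v`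
of array `0`) and to each edge `uv` (cell `u * n + v` of array `1`) the number of these graphs that
contain it (the graphs are decreasing), and the query distances of `G_0, …, G_{l-1}` (array `2`).
Register `0` holds `k` and register `1` holds `l`. -/
structure Represents (G : SimpleGraph (Fin n)) (Q : List (Fin n)) (l : ℕ) (c : Config) : Prop where
  level : c.reg 0 = maxTrussness G (nodes Q)
  round : c.reg 1 = l
  verts : ∀ v : Fin n, c.mem 0 v = {i | i ≤ l ∧ v ∈ (graphAt G (nodes Q) i).verts}.ncard
  edges : ∀ u v : Fin n,
    c.mem 1 (u * n + v) = {i | i ≤ l ∧ (graphAt G (nodes Q) i).Adj u v}.ncard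
  dists : ∀ i < l, (c.mem 2 i : ℕ∞) = graphDist (graphAt G (nodes Q) i) (nodes Q)

/-- On the given input, `P` carries out BulkDelete with `t` rounds, within words bounded by `B`, in
time `T`, and accesses `S` cells: `init` finds `G_0`; the main loop is run through exactly `t` times,
and its `l`-th run turns `G_l` into `G_{l+1}`; at the end register `2` holds an index `r < t` such
that `R = G_r` has the least query distance among `G_0, …, G_{t-1}`. -/
def LoopProgram.Implements (P : LoopProgram) (I : TrussIndex G) (Q : List (Fin n))
    (t B T S : ℕ) : Prop :=
  ∃ (cfg : ℕ → Config) (out : Config),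
    Exec (I.ask Q) B P.code Config.start T out ∧
    out.used.card = S ∧
    (∃ T₀, Exec (I.ask Q) B P.init Config.start T₀ (cfg 0)) ∧
    (∀ l < t, P.test.eval (cfg l).reg ≠ 0 ∧
      ∃ T₁, Exec (I.ask Q) B P.body (cfg l) T₁ (cfg (l + 1))) ∧
    P.test.eval (cfg t).reg = 0 ∧
    (∃ T₂, Exec (I.ask Q) B P.final (cfg t) T₂ out) ∧
    (∀ l ≤ t, Represents G Q l (cfg l)) ∧
    Represents G Q t out ∧
    out.reg 2 < t ∧
    ∀ l < t, graphDist (graphAt G (nodes Q) (out.reg 2)) (nodes Q) ≤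
      graphDist (graphAt G (nodes Q) l) (nodes Q)

end Implementation

end TrussSearch

end

open TrussSearch

/-! Identification of `G₀`. An edge of trussness at least `κ ≥ 1` lies in a `κ`-truss, and all edges
of that truss again have trussness at least `κ`. So the component of a query node `q₀` in the graph
of these edges is a connected `κ`-truss, and it contains every connected `κ`-truss through `q₀`. For
`κ = k` it is `G₀` (`startGraph_eq`). In a sorted adjacency list the relevant edges form an initial
segment, so breadth-first search in `G₀` reads nothing but `G₀` and one further entry per list.

Time. Let `X` be the vertex set of `G₀`. A search at a level `κ ≥ k` stays inside `X` and costs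
`O(m')`. The level is found by descending from the vertex trussness `K` of `q₀`, and `K ≤ 2ρ' + 1`
(`vertexTruss_le`): the edges of trussness at least `K` at `X` form a graph of minimum degree at
least `K - 1` on the vertices they touch, whereas `ρ'` forests put at most `ρ's` edges on `s`
vertices. The triangles at an edge are found by scanning the shorter of two lists, and by Chiba and
Nishizeki (`CoveredByForests.sum_min_le`) the minimum degrees of the ends of the edges add up to
`O(ρ'm')`. An edge is deleted at most once in the whole run, so the same sum pays for all truss
maintenance; `edgeWork` is the potential which makes this telescope over the rounds. What remains in
a round are `|Q|` searches and some linear passes.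

Correctness. The program does not delete vertices or components. It keeps a graph `A` of edges of
status `0`, and `G_l` consists of the components of `A` that contain a query node and an edge
(`Models`). Walks from a vertex of `G_l` are the same in both graphs, hence so are distances. Queued
edges are removed one at a time; the stored support counts stay exact for the edges not yet removed,
and an edge is queued only if it lies far out or if no `k`-truss inside the admissible edges can
contain it. When the queue is empty, the largest such truss is left (`peel_spec`,
`Models.adj_nextState`).

Rounds. If `u` is a farthest vertex, its neighbours are at most one step closer and are deleted with
it. Together with one neighbour and their at least `k - 2` common neighbours these are `k` vertices
(`Models.ncard_nextState`), so `t k ≤ n'`.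

Words and cells. Stored values grow by at most one per step and expressions have cost at most `12`,
so that all values are bounded by a fixed power of `n + T` (`Exec.bounded`). Arrays are addressed by
vertices and edges of `G₀` and by positions in lists of these only, which gives `O(m')` cells.

Arboricity. A vertex of degree at most `c` can be added to `c` forests by one pendant edge in each,
whence `ρ' ≤ d'_max`. For `c = ⌊√m'⌋ ≥ 2`, stripping such vertices leaves minimum degree `c + 1` and
therefore at most `2c + 1` vertices. On `2c` vertices even the complete graph splits into `c` double
stars; one further vertex fits in because some edge among the others is missing. For `c = 1` there
are at most three edges, and only the triangle has a cycle.

Data layout. Registers: `0` level, `1` round, `2` best index, `3` `n`, `4` `|Q|`, `5` loop flag, `6`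
the distance `d`, `7` `|X|`, `8` and `9` ends of the deletion queue, `10` source of a search, `11`
and `12` ends of its queue; the others are scratch. Arrays: `0`, `1`, `2` the output, `3` search
queue, `4` labels (distance plus one), `5` number of queries reaching a vertex, `6` its largest
label, `7` list of `X`, `8` degrees in `G₀`, `9` edge status (`0` alive, `1` queued, `2` removed),
`10` support plus two, `11` and `12` ends of the queued edges. -/

namespace TrussSearch

infixl:65 " +ᵣ " => Expr.bin Op.add
infixl:65 " -ᵣ " => Expr.bin Op.sub
infixl:70 " *ᵣ " => Expr.bin Op.mul
infix:67 " <ᵣ " => Expr.bin Op.lt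
infix:67 " =ᵣ " => Expr.bin Op.eq
infixr:40 " ;ᵣ " => Prog.seq

/-! ### Program logic -/

/-- The registers a program may write. -/
def Prog.regs : Prog → List ℕ
  | .assign r _ => [r]
  | .load r _ _ => [r]
  | .store _ _ _ => []
  | .ask r _ _ _ => [r]
  | .seq p q => p.regs ++ q.regs
  | .ite _ p q => p.regs ++ q.regs
  | .loop _ p => p.regs

/-- The arrays a program may write. -/
def Prog.arrays : Prog → List ℕ
  | .assign _ _ => []
  | .load _ _ _ => []
  | .store A _ _ => [A]
  | .ask _ _ _ _ => []
  | .seq p q => p.arrays ++ q.arrays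
  | .ite _ p q => p.arrays ++ q.arrays
  | .loop _ p => p.arrays

/-- `c'` differs from `c` only in registers and arrays which `p` may write. -/
structure Frame (p : Prog) (c c' : Config) : Prop where
  reg' : ∀ r, r ∉ p.regs → c'.reg r = c.reg r
  mem' : ∀ A, A ∉ p.arrays → c'.mem A = c.mem A

/-- The registers and arrays written by a concrete program are computed lists, so frame conditions
are settled by evaluation in the default argument. -/
theorem Frame.reg {p c c'} (h : Frame p c c') (r : ℕ) (hr : r ∉ p.regs := by decide) :
    c'.reg r = c.reg r := h.reg' r hr

theorem Frame.mem {p c c'} (h : Frame p c c') (A : ℕ) (hA : A ∉ p.arrays := by decide) :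
    c'.mem A = c.mem A := h.mem' A hA

theorem Frame.refl (p c) : Frame p c c := ⟨fun _ _ => rfl, fun _ _ => rfl⟩

theorem Frame.trans {p c c' c''} (h : Frame p c c') (h' : Frame p c' c'') : Frame p c c'' :=
  ⟨fun r hr => (h'.reg' r hr).trans (h.reg' r hr), fun r hr => (h'.mem' r hr).trans (h.mem' r hr)⟩

theorem Frame.mono {p q c c'} (h : Frame p c c') (h1 : p.regs ⊆ q.regs) (h2 : p.arrays ⊆ q.arrays) :
    Frame q c c' :=
  ⟨fun r hr => h.reg' r fun h => hr (h1 h), fun r hr => h.mem' r fun h => hr (h2 h)⟩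

@[simp] theorem Config.setReg_reg (c : Config) (r x : ℕ) :
    (c.setReg r x).reg = Function.update c.reg r x := rfl
@[simp] theorem Config.setReg_mem (c : Config) (r x : ℕ) : (c.setReg r x).mem = c.mem := rfl
@[simp] theorem Config.setReg_used (c : Config) (r x : ℕ) : (c.setReg r x).used = c.used := rfl
@[simp] theorem Config.setMem_reg (c : Config) (A i x : ℕ) : (c.setMem A i x).reg = c.reg := rfl
@[simp] theorem Config.setMem_mem (c : Config) (A i x : ℕ) :
    (c.setMem A i x).mem = Function.update c.mem A (Function.update (c.mem A) i x) := rfl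
@[simp] theorem Config.setMem_used (c : Config) (A i x : ℕ) : (c.setMem A i x).used = c.used := rfl
@[simp] theorem Config.touch_reg (c : Config) (A i : ℕ) : (c.touch A i).reg = c.reg := rfl
@[simp] theorem Config.touch_mem (c : Config) (A i : ℕ) : (c.touch A i).mem = c.mem := rfl
@[simp] theorem Config.touch_used (c : Config) (A i : ℕ) :
    (c.touch A i).used = insert (A, i) c.used := rfl

variable {inp : Query → ℕ → ℕ → ℕ} {U : Set (ℕ × ℕ)}

theorem Exec.frame {B p c T c'} (h : Exec inp B p c T c') : Frame p c c' := by
  induction h with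
  | assign h =>
      refine ⟨fun r hr => ?_, fun _ _ => rfl⟩
      simp only [Prog.regs, List.mem_singleton] at hr
      simp [hr]
  | load h =>
      refine ⟨fun r hr => ?_, fun _ _ => rfl⟩
      simp only [Prog.regs, List.mem_singleton] at hr
      simp [hr]
  | store ha hb =>
      refine ⟨fun _ _ => rfl, fun A hA => ?_⟩
      simp only [Prog.arrays, List.mem_singleton] at hA
      simp [hA]
  | ask ha hb h =>
      refine ⟨fun r hr => ?_, fun _ _ => rfl⟩
      simp only [Prog.regs, List.mem_singleton] at hr
      simp [hr]
  | seq hp hq ihp ihq =>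
      exact (ihp.mono (List.subset_append_left _ _) (List.subset_append_left _ _)).trans
        (ihq.mono (List.subset_append_right _ _) (List.subset_append_right _ _))
  | ite_true h ha hp ih =>
      exact ih.mono (List.subset_append_left _ _) (List.subset_append_left _ _)
  | ite_false h ha hp ih =>
      exact ih.mono (List.subset_append_right _ _) (List.subset_append_right _ _)
  | loop_true h ha hp hl ihp ihl =>
      exact Frame.trans (p := .loop _ _) ⟨ihp.reg', ihp.mem'⟩ ihl
  | loop_false h ha => exact Frame.refl _ _

theorem Exec.mono {B B' p c T c'} (h : Exec inp B p c T c') (hB : B ≤ B') :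
    Exec inp B' p c T c' := by
  induction h with
  | assign h => exact .assign (h.trans hB)
  | load h => exact .load (h.trans hB)
  | store ha hb => exact .store (ha.trans hB) (hb.trans hB)
  | ask ha hb h => exact .ask (ha.trans hB) (hb.trans hB) (h.trans hB)
  | seq hp hq ihp ihq => exact .seq ihp ihq
  | ite_true h ha hp ih => exact .ite_true (h.trans hB) ha ih
  | ite_false h ha hp ih => exact .ite_false (h.trans hB) ha ih
  | loop_true h ha hp hl ihp ihl => exact .loop_true (h.trans hB) ha ihp ihl
  | loop_false h ha => exact .loop_false (h.trans hB) ha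

/-- Started in `c`, the program `p` halts after some number `T` of steps in a configuration `c'`
with `Post c' T`, and accesses cells in `U` only. The word length is not restricted. -/
def Run (inp : Query → ℕ → ℕ → ℕ) (U : Set (ℕ × ℕ)) (p : Prog) (c : Config)
    (Post : Config → ℕ → Prop) : Prop :=
  ∃ B T c', Exec inp B p c T c' ∧ (c'.used : Set (ℕ × ℕ)) ⊆ c.used ∪ U ∧ Post c' T

theorem Run.conseq {p c} {Post Post' : Config → ℕ → Prop} (h : Run inp U p c Post)
    (h' : ∀ c' T, Frame p c c' → Post c' T → Post' c' T) : Run inp U p c Post' := by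
  obtain ⟨B, T, c', he, hu, hp⟩ := h
  exact ⟨B, T, c', he, hu, h' c' T he.frame hp⟩

theorem Run.seq {p q c} {Post : Config → ℕ → Prop}
    (h : Run inp U p c fun c' T => Run inp U q c' fun c'' T' => Post c'' (T + T')) :
    Run inp U (.seq p q) c Post := by
  obtain ⟨B, T, c', he, hu, B', T', c'', he', hu', hp⟩ := h
  refine ⟨max B B', T + T', c'', .seq (he.mono (le_max_left _ _)) (he'.mono (le_max_right _ _)),
    fun x hx => ?_, hp⟩
  rcases hu' hx with h | h
  · exact hu h
  · exact Or.inr h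

theorem Run.assign {r a c} {Post : Config → ℕ → Prop}
    (h : Post (c.setReg r (a.eval c.reg)) (a.cost + 1)) : Run inp U (.assign r a) c Post :=
  ⟨_, _, _, .assign le_rfl, by simp, h⟩

theorem Run.load {r A a c} {Post : Config → ℕ → Prop} (hU : (A, a.eval c.reg) ∈ U)
    (h : Post ((c.touch A (a.eval c.reg)).setReg r (c.mem A (a.eval c.reg))) (a.cost + 1)) :
    Run inp U (.load r A a) c Post := by
  refine ⟨_, _, _, .load le_rfl, ?_, h⟩
  intro x hx
  simp only [Config.setReg_used, Config.touch_used, Finset.coe_insert, Set.mem_insert_iff] at hx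
  rcases hx with rfl | h
  · exact Or.inr hU
  · exact Or.inl h

theorem Run.store {A a b c} {Post : Config → ℕ → Prop} (hU : (A, a.eval c.reg) ∈ U)
    (h : Post ((c.touch A (a.eval c.reg)).setMem A (a.eval c.reg) (b.eval c.reg))
      (a.cost + b.cost + 1)) :
    Run inp U (.store A a b) c Post := by
  refine ⟨_, _, _, .store (le_max_left _ (b.peak c.reg)) (le_max_right _ _), ?_, h⟩
  intro x hx
  simp only [Config.setMem_used, Config.touch_used, Finset.coe_insert, Set.mem_insert_iff] at hx
  rcases hx with rfl | h
  · exact Or.inr hU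
  · exact Or.inl h

theorem Run.ask {r q a b c} {Post : Config → ℕ → Prop}
    (h : Post (c.setReg r (inp q (a.eval c.reg) (b.eval c.reg))) (a.cost + b.cost + 1)) :
    Run inp U (.ask r q a b) c Post :=
  ⟨max (max (a.peak c.reg) (b.peak c.reg)) (inp q (a.eval c.reg) (b.eval c.reg)), _, _,
    .ask (by simp) (by simp) (by simp), by simp, h⟩

theorem Run.ite {a p q c} {Post : Config → ℕ → Prop}
    (h1 : a.eval c.reg ≠ 0 → Run inp U p c fun c' T => Post c' (a.cost + 1 + T))
    (h2 : a.eval c.reg = 0 → Run inp U q c fun c' T => Post c' (a.cost + 1 + T)) :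
    Run inp U (.ite a p q) c Post := by
  by_cases h : a.eval c.reg = 0
  · obtain ⟨B, T, c', he, hu, hp⟩ := h2 h
    exact ⟨max B (a.peak c.reg), _, c', .ite_false (le_max_right _ _) h
      (he.mono (le_max_left _ _)), hu, hp⟩
  · obtain ⟨B, T, c', he, hu, hp⟩ := h1 h
    exact ⟨max B (a.peak c.reg), _, c', .ite_true (le_max_right _ _) h
      (he.mono (le_max_left _ _)), hu, hp⟩

/-- Total correctness by strong induction on the variant `μ`. The invariant also sees the elapsed
time, so that amortised bounds can be stated as invariants. -/
theorem Run.loop {a p c} {Post : Config → ℕ → Prop} (Inv : Config → ℕ → Prop) (μ : Config → ℕ)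
    (h0 : Inv c 0)
    (hstep : ∀ c' T, Frame p c c' → Inv c' T → a.eval c'.reg ≠ 0 →
      Run inp U p c' fun c'' T' => Inv c'' (T + (a.cost + 1 + T')) ∧ μ c'' < μ c')
    (hend : ∀ c' T, Frame p c c' → Inv c' T → a.eval c'.reg = 0 → Post c' (T + (a.cost + 1))) :
    Run inp U (.loop a p) c Post := by
  suffices H : ∀ m c' T, μ c' = m → Frame p c c' → Inv c' T →
      Run inp U (.loop a p) c' fun c'' T' => Post c'' (T + T') by
    simpa using H _ c 0 rfl (Frame.refl _ _) h0
  intro m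
  induction m using Nat.strong_induction_on with
  | _ m ih =>
    rintro c' T rfl hf hi
    by_cases h : a.eval c'.reg = 0
    · exact ⟨_, _, c', .loop_false le_rfl h, by simp, hend c' T hf hi h⟩
    · obtain ⟨B, T1, c1, he, hu, hi1, hμ⟩ := hstep c' T hf hi h
      obtain ⟨B', T2, c2, he', hu', hp⟩ := ih _ hμ c1 _ rfl (hf.trans he.frame) hi1
      refine ⟨max (max B B') (a.peak c'.reg), _, c2, .loop_true (le_max_right _ _) h
        (he.mono ?_) (he'.mono ?_), fun x hx => ?_, ?_⟩
      · exact (le_max_left _ _).trans (le_max_left _ _)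
      · exact (le_max_right _ _).trans (le_max_left _ _)
      · rcases hu' hx with h | h
        · exact hu h
        · exact Or.inr h
      · convert hp using 1; ring

/-- `for i < N do p`. -/
def forLoop (i N : ℕ) (p : Prog) : Prog :=
  .assign i (.lit 0) ;ᵣ .loop (.reg i <ᵣ .reg N) (p ;ᵣ .assign i (.reg i +ᵣ .lit 1))

/-- Each pass pays `4` for the test and `4` for the increment; the initialisation and the last test
cost `2 + 4`. The invariant is asserted after the counter has been advanced. -/
theorem Run.for {i N p c m} {Post : Config → ℕ → Prop} (P : ℕ → Config → Prop) (t : ℕ → ℕ)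
    (hm : c.reg N = m) (hN : N ∉ (Prog.assign i (.lit 0) ;ᵣ p).regs) (hi : i ∉ p.regs)
    (h0 : P 0 (c.setReg i 0))
    (hstep : ∀ x < m, ∀ c', Frame (forLoop i N p) c c' → c'.reg i = x → P x c' →
      Run inp U p c' fun c'' T => P (x + 1) (c''.setReg i (x + 1)) ∧ T ≤ t x)
    (hend : ∀ c' T, Frame (forLoop i N p) c c' → P m c' →
      T ≤ ∑ x ∈ Finset.range m, (t x + 8) + 6 → Post c' T) :
    Run inp U (forLoop i N p) c Post := by
  have hNi : N ≠ i := by rintro rfl; simp [Prog.regs] at hN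
  have hNp : N ∉ p.regs := fun h => hN (by simp [Prog.regs, h])
  have hfr : ∀ c', Frame (p ;ᵣ .assign i (.reg i +ᵣ .lit 1)) (c.setReg i 0) c' →
      Frame (forLoop i N p) c c' := by
    intro c' h
    refine ⟨fun r hr => ?_, fun A hA => ?_⟩
    · have h2 : r ∉ p.regs ∧ r ≠ i := by
        simp only [forLoop, Prog.regs, List.mem_append, List.mem_singleton, not_or] at hr
        exact ⟨hr.2.1, hr.1⟩
      rw [h.reg' r (by simp [Prog.regs, h2])]
      simp [h2.2]
    · have h2 : A ∉ p.arrays := by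
        simp only [forLoop, Prog.arrays, List.mem_append, not_or] at hA
        exact hA.2.1
      rw [h.mem' A (by simp [Prog.arrays, h2])]
      simp
  refine Run.seq (Run.assign ?_)
  refine Run.loop (fun c' T => ∃ x ≤ m, c'.reg i = x ∧ P x c' ∧
    T ≤ ∑ x ∈ Finset.range x, (t x + 8)) (fun c' => m - c'.reg i) ?_ ?_ ?_
  · exact ⟨0, Nat.zero_le _, by simp [Expr.eval], h0, by simp⟩
  · rintro c' T hf ⟨x, hx, hxi, hP, hT⟩ hne
    have hN' : c'.reg N = m := by rw [(hfr c' hf).reg' N (by simp [forLoop, Prog.regs, hNi, hNp]), hm]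
    have hxm : x < m := by
      by_contra h
      simp [Expr.eval, Op.eval, hN', hxi, h] at hne
    refine Run.seq ((hstep x hxm c' (hfr c' hf) hxi hP).conseq fun c'' T' hf' hp => ?_)
    have hi' : c''.reg i = x := by rw [hf'.reg' i hi, hxi]
    refine Run.assign ⟨⟨x + 1, hxm, ?_, ?_, ?_⟩, ?_⟩
    · simp [Expr.eval, Op.eval, hi']
    · simpa [Expr.eval, Op.eval, hi'] using hp.1
    · have := hp.2
      rw [Finset.sum_range_succ]
      simp only [Expr.cost]; omega
    · simp only [Config.setReg_reg, Function.update_self, Expr.eval, Op.eval, hi', hxi]; omega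
  · rintro c' T hf ⟨x, hx, hxi, hP, hT⟩ hne
    have hN' : c'.reg N = m := by rw [(hfr c' hf).reg' N (by simp [forLoop, Prog.regs, hNi, hNp]), hm]
    have hxm : x = m := by
      by_contra h
      have : x < m := by omega
      simp [Expr.eval, Op.eval, hN', hxi, this] at hne
    subst hxm
    refine hend c' _ (hfr c' hf) hP ?_
    simp only [Expr.cost]; omega

/-! ### Word length -/

/-- Every value of the expression is `0` or `1`. -/
def Expr.isBit : Expr → Bool
  | .lit c => c ≤ 1
  | .reg _ => false
  | .bin .add _ _ => false
  | .bin .sub a _ => a.isBit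
  | .bin .mul a b => a.isBit && b.isBit
  | .bin .lt _ _ => true
  | .bin .eq _ _ => true

/-- The value is at most the maximum of `2` and the registers. -/
def Expr.isFlat : Expr → Bool
  | .lit c => c ≤ 2
  | .reg _ => true
  | .bin .add _ _ => false
  | .bin .sub a _ => a.isFlat
  | .bin .mul a b => a.isFlat && b.isBit
  | .bin .lt _ _ => true
  | .bin .eq _ _ => true

/-- The value exceeds the maximum of `2` and the registers by at most one. -/
def Expr.isTame : Expr → Bool
  | .bin .add a b => a.isFlat && b.isBit
  | a => a.isFlat

/-- All literals are at most `2`. -/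
def Expr.smallLits : Expr → Bool
  | .lit c => c ≤ 2
  | .reg _ => true
  | .bin _ a b => a.smallLits && b.smallLits

/-- All expressions have cost at most `K`, and the values stored grow by one per step at most. -/
def Prog.isTame (K : ℕ) : Prog → Bool
  | .assign _ a => a.isTame && a.smallLits && decide (a.cost ≤ K)
  | .load _ _ a => a.smallLits && decide (a.cost ≤ K)
  | .store _ a b => b.isTame && a.smallLits && decide (a.cost ≤ K) && b.smallLits &&
      decide (b.cost ≤ K)
  | .ask _ _ a b => a.smallLits && decide (a.cost ≤ K) && b.smallLits && decide (b.cost ≤ K)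
  | .seq p q => p.isTame K && q.isTame K
  | .ite a p q => a.smallLits && decide (a.cost ≤ K) && p.isTame K && q.isTame K
  | .loop a p => a.smallLits && decide (a.cost ≤ K) && p.isTame K

theorem Expr.eval_le_peak (s : ℕ → ℕ) (a : Expr) : a.eval s ≤ a.peak s := by
  cases a <;> simp [Expr.eval, Expr.peak]

/-- An operation turns values bounded by `x, y ≥ 1` into a value at most `2xy ≤ (M + 2)xy`. So the
exponents of the two subterms add up, plus one for the node, which is the recursion of the cost. -/
theorem Expr.peak_le {s : ℕ → ℕ} {M : ℕ} (hs : ∀ r, s r ≤ M) :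
    ∀ a : Expr, a.smallLits → a.peak s ≤ (M + 2) ^ a.cost
  | .lit c, h => by
      simp only [Expr.smallLits, decide_eq_true_eq] at h
      simp only [Expr.peak, Expr.cost, pow_one]; omega
  | .reg r, _ => by
      have := hs r
      simp only [Expr.peak, Expr.cost, pow_one]; omega
  | .bin o a b, h => by
      simp only [Expr.smallLits, Bool.and_eq_true] at h
      have ha := Expr.peak_le hs a h.1
      have hb := Expr.peak_le hs b h.2
      have ha' := (Expr.eval_le_peak s a).trans ha
      have hb' := (Expr.eval_le_peak s b).trans hb
      have h1 : 1 ≤ (M + 2) ^ a.cost := Nat.one_le_pow _ _ (by omega)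
      have h2 : 1 ≤ (M + 2) ^ b.cost := Nat.one_le_pow _ _ (by omega)
      simp only [Expr.peak, Expr.cost]
      have hx : (M + 2) ^ (a.cost + b.cost + 1) =
        (M + 2) ^ a.cost * (M + 2) ^ b.cost * (M + 2) := by ring
      rw [hx]
      generalize (M + 2) ^ a.cost = x at *
      generalize (M + 2) ^ b.cost = y at *
      have hxy : x * y * 2 ≤ x * y * (M + 2) := Nat.mul_le_mul_left _ (by omega)
      have hx1 : x ≤ x * y := Nat.le_mul_of_pos_right _ (by omega)
      have hy1 : y ≤ x * y := Nat.le_mul_of_pos_left _ (by omega)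
      have hev : o.eval (a.eval s) (b.eval s) ≤ x * y * 2 := by
        cases o <;> simp only [Op.eval]
        · omega
        · omega
        · exact (Nat.mul_le_mul ha' hb').trans (by omega)
        · split <;> omega
        · split <;> omega
      omega

theorem Expr.isBit_le {s : ℕ → ℕ} : ∀ a : Expr, a.isBit → a.eval s ≤ 1
  | .lit c, h => by simpa [Expr.isBit, Expr.eval] using h
  | .bin .sub a b, h => by
      have := Expr.isBit_le (s := s) a h
      simp only [Expr.eval, Op.eval]; omega
  | .bin .mul a b, h => by
      simp only [Expr.isBit, Bool.and_eq_true] at h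
      have h1 := Expr.isBit_le (s := s) a h.1
      have h2 := Expr.isBit_le (s := s) b h.2
      simp only [Expr.eval, Op.eval]
      exact Nat.mul_le_mul h1 h2
  | .bin .lt a b, h => by simp only [Expr.eval, Op.eval]; split <;> omega
  | .bin .eq a b, h => by simp only [Expr.eval, Op.eval]; split <;> omega

theorem Expr.isFlat_le {s : ℕ → ℕ} {M : ℕ} (hs : ∀ r, s r ≤ M) (hM : 2 ≤ M) :
    ∀ a : Expr, a.isFlat → a.eval s ≤ M
  | .lit c, h => by
      simp only [Expr.isFlat, decide_eq_true_eq] at h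
      simp only [Expr.eval]; omega
  | .reg r, _ => hs r
  | .bin .sub a b, h => by
      have := Expr.isFlat_le hs hM a h
      simp only [Expr.eval, Op.eval]; omega
  | .bin .mul a b, h => by
      simp only [Expr.isFlat, Bool.and_eq_true] at h
      have h1 := Expr.isFlat_le hs hM a h.1
      have h2 := Expr.isBit_le (s := s) b h.2
      simp only [Expr.eval, Op.eval]
      exact (Nat.mul_le_mul h1 h2).trans (by omega)
  | .bin .lt a b, h => by simp only [Expr.eval, Op.eval]; split <;> omega
  | .bin .eq a b, h => by simp only [Expr.eval, Op.eval]; split <;> omega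

theorem Expr.isTame_le {s : ℕ → ℕ} {M : ℕ} (hs : ∀ r, s r ≤ M) (hM : 2 ≤ M) (a : Expr)
    (h : a.isTame) : a.eval s ≤ M + 1 := by
  have key : ∀ a : Expr, a.isFlat → a.eval s ≤ M + 1 := fun a h =>
    (Expr.isFlat_le hs hM a h).trans (by omega)
  match a, h with
  | .bin .add a b, h =>
      simp only [Expr.isTame, Bool.and_eq_true] at h
      have h1 := Expr.isFlat_le hs hM a h.1
      have h2 := Expr.isBit_le (s := s) b h.2
      simp only [Expr.eval, Op.eval]; omega
  | .lit c, h => exact key _ h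
  | .reg c, h => exact key _ h
  | .bin .sub a b, h => exact key _ h
  | .bin .mul a b, h => exact key _ h
  | .bin .lt a b, h => exact key _ h
  | .bin .eq a b, h => exact key _ h

/-- All registers and cells hold values at most `M`. -/
def Config.Bounded (c : Config) (M : ℕ) : Prop :=
  (∀ r, c.reg r ≤ M) ∧ ∀ A i, c.mem A i ≤ M

theorem Config.Bounded.mono {c M M'} (h : Config.Bounded c M) (hM : M ≤ M') : c.Bounded M' :=
  ⟨fun r => (h.1 r).trans hM, fun A i => (h.2 A i).trans hM⟩

theorem Config.Bounded.setReg {c M} (h : Config.Bounded c M) {r x : ℕ} (hx : x ≤ M) :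
    (c.setReg r x).Bounded M := by
  refine ⟨fun s => ?_, h.2⟩
  simp only [Config.setReg_reg, Function.update_apply]
  split
  · exact hx
  · exact h.1 s

theorem Config.Bounded.setMem {c M} (h : Config.Bounded c M) {A i x : ℕ} (hx : x ≤ M) :
    (c.setMem A i x).Bounded M := by
  refine ⟨h.1, fun s j => ?_⟩
  simp only [Config.setMem_mem, Function.update_apply]
  split
  · simp only [Function.update_apply]
    split
    · exact hx
    · exact h.2 A j
  · exact h.2 s j

theorem pow_bound {x y a K B : ℕ} (hxy : x ≤ y) (ha : a ≤ K) (hB : (y + 2) ^ K ≤ B) :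
    (x + 2) ^ a ≤ B :=
  ((Nat.pow_le_pow_left (by omega) a).trans (Nat.pow_le_pow_right (by omega) ha)).trans hB

/-- For tame programs the word length takes care of itself. -/
theorem Exec.bounded {B K N p c T c'} (h : Exec inp B p c T c') (hp : p.isTame K)
    (hK : 1 ≤ K) (hN : ∀ q x y, inp q x y ≤ N) (hN2 : 2 ≤ N) :
    ∀ M, N ≤ M → c.Bounded M → c'.Bounded (M + T) ∧
      ∀ B', (M + T + 2) ^ K ≤ B' → Exec inp B' p c T c' := by
  induction h with
  | @assign r a c h =>
      intro M hM hc
      simp only [Prog.isTame, Bool.and_eq_true, decide_eq_true_eq] at hp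
      refine ⟨(hc.mono (by omega)).setReg ((Expr.isTame_le hc.1 (by omega) a hp.1.1).trans
        (by omega)), fun B' hB => .assign ?_⟩
      exact (Expr.peak_le hc.1 a hp.1.2).trans (pow_bound (by omega) hp.2 hB)
  | @load r A a c h =>
      intro M hM hc
      simp only [Prog.isTame, Bool.and_eq_true, decide_eq_true_eq] at hp
      have hc' : (c.touch A (a.eval c.reg)).Bounded (M + (a.cost + 1)) :=
        Config.Bounded.mono hc (by omega)
      refine ⟨hc'.setReg ((hc.2 A _).trans (by omega)), fun B' hB => .load ?_⟩
      exact (Expr.peak_le hc.1 a hp.1).trans (pow_bound (by omega) hp.2 hB)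
  | @store A a b c ha hb =>
      intro M hM hc
      simp only [Prog.isTame, Bool.and_eq_true, decide_eq_true_eq] at hp
      have hc' : (c.touch A (a.eval c.reg)).Bounded (M + (a.cost + b.cost + 1)) :=
        Config.Bounded.mono hc (by omega)
      refine ⟨hc'.setMem ((Expr.isTame_le hc.1 (by omega) b hp.1.1.1.1).trans (by omega)),
        fun B' hB => .store ?_ ?_⟩
      · exact (Expr.peak_le hc.1 a hp.1.1.1.2).trans (pow_bound (by omega) hp.1.1.2 hB)
      · exact (Expr.peak_le hc.1 b hp.1.2).trans (pow_bound (by omega) hp.2 hB)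
  | @ask r q a b c ha hb h =>
      intro M hM hc
      simp only [Prog.isTame, Bool.and_eq_true, decide_eq_true_eq] at hp
      refine ⟨(hc.mono (by omega)).setReg ((hN _ _ _).trans (by omega)),
        fun B' hB => .ask ?_ ?_ ?_⟩
      · exact (Expr.peak_le hc.1 a hp.1.1.1).trans (pow_bound (by omega) hp.1.1.2 hB)
      · exact (Expr.peak_le hc.1 b hp.1.2).trans (pow_bound (by omega) hp.2 hB)
      -- The answer of the look-up must fit into a word too; this is where `1 ≤ K` is needed.
      · have := pow_bound (x := M) (by omega) hK hB
        rw [pow_one] at this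
        have := hN q (a.eval c.reg) (b.eval c.reg)
        omega
  | seq hp' hq ihp ihq =>
      intro M hM hc
      simp only [Prog.isTame, Bool.and_eq_true] at hp
      obtain ⟨h1, h2⟩ := ihp hp.1 M hM hc
      obtain ⟨h3, h4⟩ := ihq hp.2 _ (hM.trans (Nat.le_add_right _ _)) h1
      exact ⟨by simpa only [Nat.add_assoc] using h3, fun B' hB => .seq
        (h2 B' (pow_bound (by omega) le_rfl hB)) (h4 B' (pow_bound (by omega) le_rfl hB))⟩
  | @ite_true a p q c c' T h ha hp' ih =>
      intro M hM hc
      simp only [Prog.isTame, Bool.and_eq_true, decide_eq_true_eq] at hp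
      obtain ⟨h1, h2⟩ := ih hp.1.2 M hM hc
      exact ⟨h1.mono (by omega), fun B' hB => .ite_true
        ((Expr.peak_le hc.1 a hp.1.1.1).trans (pow_bound (by omega) hp.1.1.2 hB)) ha
        (h2 B' (pow_bound (by omega) le_rfl hB))⟩
  | @ite_false a p q c c' T h ha hp' ih =>
      intro M hM hc
      simp only [Prog.isTame, Bool.and_eq_true, decide_eq_true_eq] at hp
      obtain ⟨h1, h2⟩ := ih hp.2 M hM hc
      exact ⟨h1.mono (by omega), fun B' hB => .ite_false
        ((Expr.peak_le hc.1 a hp.1.1.1).trans (pow_bound (by omega) hp.1.1.2 hB)) ha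
        (h2 B' (pow_bound (by omega) le_rfl hB))⟩
  | @loop_true a p c c' c'' T T' h ha hp' hl ihp ihl =>
      intro M hM hc
      have hpl := hp
      simp only [Prog.isTame, Bool.and_eq_true, decide_eq_true_eq] at hp
      obtain ⟨h1, h2⟩ := ihp hp.2 M hM hc
      obtain ⟨h3, h4⟩ := ihl hpl _ (hM.trans (Nat.le_add_right _ _)) h1
      exact ⟨h3.mono (by omega), fun B' hB => .loop_true
        ((Expr.peak_le hc.1 a hp.1.1).trans (pow_bound (by omega) hp.1.2 hB)) ha
        (h2 B' (pow_bound (by omega) le_rfl hB)) (h4 B' (pow_bound (by omega) le_rfl hB))⟩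
  | @loop_false a p c h ha =>
      intro M hM hc
      simp only [Prog.isTame, Bool.and_eq_true, decide_eq_true_eq] at hp
      exact ⟨hc.mono (by omega), fun B' hB => .loop_false
        ((Expr.peak_le hc.1 a hp.1.1).trans (pow_bound (by omega) hp.1.2 hB)) ha⟩

end TrussSearch

namespace TrussSearch

/-! ### The program -/

/-- The address of an edge in an array: tail in register `a`, head in register `b`. -/
def edgeAddr (a b : ℕ) : Expr := .reg a *ᵣ .reg 3 +ᵣ .reg b

/-- No operation. -/
def skip : Prog := .assign 23 (.lit 0)

/-- Register `16` gets the number of entries of trussness at least `reg 0` in the list of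
`reg 13`. -/
def countProg : Prog :=
  .assign 16 (.lit 0) ;ᵣ .assign 17 (.lit 1) ;ᵣ .ask 18 .degree (.reg 13) (.lit 0) ;ᵣ
  .loop (.reg 17)
    (.ask 23 .neighbour (.reg 13) (.reg 16) ;ᵣ .ask 19 .edgeTruss (.reg 13) (.reg 23) ;ᵣ
      .assign 17 ((.reg 16 <ᵣ .reg 18) *ᵣ (.lit 1 -ᵣ (.reg 19 <ᵣ .reg 0))) ;ᵣ
      -- Since register `17` holds a bit, `1 - (1 - r)` has the value `r`; in this form the summand
      -- is syntactically a bit, as `Prog.isTame` demands.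
      .assign 16 (.reg 16 +ᵣ (.lit 1 -ᵣ (.lit 1 -ᵣ .reg 17))))

/-- Scanning the neighbours of `reg 13` in a breadth-first search. -/
def bfsScan : Prog :=
  forLoop 14 16
    (.ask 15 .neighbour (.reg 13) (.reg 14) ;ᵣ .load 20 9 (edgeAddr 13 15) ;ᵣ
      .load 19 4 (.reg 15) ;ᵣ
      .ite ((.reg 20 =ᵣ .lit 0) *ᵣ (.reg 19 =ᵣ .lit 0))
        (.store 4 (.reg 15) (.reg 24 +ᵣ .lit 1) ;ᵣ .store 3 (.reg 12) (.reg 15) ;ᵣ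
          .assign 12 (.reg 12 +ᵣ .lit 1))
        skip)

/-- Breadth-first search from `reg 10` along the edges of status `0` and trussness at least
`reg 0`. -/
def bfs : Prog :=
  .store 4 (.reg 10) (.lit 1) ;ᵣ .store 3 (.lit 0) (.reg 10) ;ᵣ
  .assign 11 (.lit 0) ;ᵣ .assign 12 (.lit 1) ;ᵣ
  .loop (.reg 11 <ᵣ .reg 12)
    (.load 13 3 (.reg 11) ;ᵣ .assign 11 (.reg 11 +ᵣ .lit 1) ;ᵣ countProg ;ᵣ
      .load 24 4 (.reg 13) ;ᵣ bfsScan)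

/-- Collecting the result of a search, and resetting its marks. -/
def absorb : Prog :=
  forLoop 14 12
    (.load 13 3 (.reg 14) ;ᵣ .load 15 5 (.reg 13) ;ᵣ
      -- Only searches that leave their source are counted: an isolated query node does not belong
      -- to the current graph.
      .store 5 (.reg 13) (.reg 15 +ᵣ (.lit 1 <ᵣ .reg 12)) ;ᵣ
      .load 15 6 (.reg 13) ;ᵣ .load 16 4 (.reg 13) ;ᵣ
      .ite (.reg 15 <ᵣ .reg 16) (.store 6 (.reg 13) (.reg 16)) skip ;ᵣ
      .store 4 (.reg 13) (.lit 0))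

/-- Searching for the level `k`. -/
def levelLoop : Prog :=
  .loop (.reg 5 =ᵣ .lit 0)
    (bfs ;ᵣ absorb ;ᵣ .assign 5 (.lit 1) ;ᵣ
      forLoop 21 4
        (.ask 13 .queryNode (.reg 21) (.lit 0) ;ᵣ .load 15 5 (.reg 13) ;ᵣ
          .assign 5 (.reg 5 *ᵣ (.lit 0 <ᵣ .reg 15))) ;ᵣ
      .ite (.reg 5) skip (.assign 0 (.reg 0 -ᵣ .lit 1)))

/-- Listing the vertices of `G₀` and their degrees. -/
def listVerts : Prog :=
  .assign 7 (.reg 12) ;ᵣ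
  forLoop 21 7
    (.load 13 3 (.reg 21) ;ᵣ .store 7 (.reg 21) (.reg 13) ;ᵣ countProg ;ᵣ
      .store 8 (.reg 13) (.reg 16))

/-- Counting the triangles on the edge from `reg 13` to `reg 15`. -/
def countTriangles : Prog :=
  .load 26 8 (.reg 15) ;ᵣ
  .ite (.reg 26 <ᵣ .reg 25)
    (.assign 27 (.reg 15) ;ᵣ .assign 28 (.reg 13) ;ᵣ .assign 29 (.reg 26))
    (.assign 27 (.reg 13) ;ᵣ .assign 28 (.reg 15) ;ᵣ .assign 29 (.reg 25)) ;ᵣ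
  -- Starting at `2` makes the count comparable with `k` without subtraction.
  .assign 20 (.lit 2) ;ᵣ
  forLoop 30 29
    (.ask 22 .neighbour (.reg 27) (.reg 30) ;ᵣ .ask 19 .edgeTruss (.reg 28) (.reg 22) ;ᵣ
      .assign 20 (.reg 20 +ᵣ (.lit 1 -ᵣ (.reg 19 <ᵣ .reg 0)))) ;ᵣ
  .store 10 (edgeAddr 13 15) (.reg 20)

/-- The supports of all edges of `G₀`. -/
def supports : Prog :=
  forLoop 21 7
    (.load 13 7 (.reg 21) ;ᵣ .load 25 8 (.reg 13) ;ᵣ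
      forLoop 14 25 (.ask 15 .neighbour (.reg 13) (.reg 14) ;ᵣ countTriangles))

/-- The query distances of all vertices. -/
def distances : Prog :=
  forLoop 21 7
    (.load 13 7 (.reg 21) ;ᵣ .store 5 (.reg 13) (.lit 0) ;ᵣ .store 6 (.reg 13) (.lit 0)) ;ᵣ
  forLoop 21 4 (.ask 10 .queryNode (.reg 21) (.lit 0) ;ᵣ bfs ;ᵣ absorb)

/-- Are the query nodes connected? -/
def connectTest : Prog :=
  .assign 5 (.lit 1) ;ᵣ
  forLoop 21 4
    (.ask 13 .queryNode (.reg 21) (.lit 0) ;ᵣ .load 15 5 (.reg 13) ;ᵣ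
      .assign 5 (.reg 5 *ᵣ (.reg 15 =ᵣ .reg 4)))

/-- Recording the current graph. -/
def record : Prog :=
  forLoop 21 7
    (.load 13 7 (.reg 21) ;ᵣ .load 15 5 (.reg 13) ;ᵣ .load 16 0 (.reg 13) ;ᵣ
      .store 0 (.reg 13) (.reg 16 +ᵣ (.lit 0 <ᵣ .reg 15)) ;ᵣ
      .load 25 8 (.reg 13) ;ᵣ
      forLoop 14 25
        (.ask 22 .neighbour (.reg 13) (.reg 14) ;ᵣ .load 20 9 (edgeAddr 13 22) ;ᵣ
          .load 16 1 (edgeAddr 13 22) ;ᵣ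
          .store 1 (edgeAddr 13 22)
            (.reg 16 +ᵣ (.reg 20 =ᵣ .lit 0) *ᵣ (.lit 0 <ᵣ .reg 15))))

/-- The analysis of the current graph. -/
def analyse : Prog := distances ;ᵣ connectTest ;ᵣ record

/-- The initial part. -/
def initProg : Prog :=
  .ask 3 .numVertices (.lit 0) (.lit 0) ;ᵣ .ask 4 .numQueryNodes (.lit 0) (.lit 0) ;ᵣ
  .ask 10 .queryNode (.lit 0) (.lit 0) ;ᵣ .ask 0 .vertexTruss (.reg 10) (.lit 0) ;ᵣ
  -- The value `n` stands for `d = +∞`, because finite distances are smaller than `n`.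
  levelLoop ;ᵣ listVerts ;ᵣ supports ;ᵣ .assign 6 (.reg 3) ;ᵣ analyse

/-- The largest query distance, and the best one so far. -/
def measure : Prog :=
  .assign 30 (.lit 0) ;ᵣ
  forLoop 21 7
    (.load 13 7 (.reg 21) ;ᵣ .load 15 5 (.reg 13) ;ᵣ .load 16 6 (.reg 13) ;ᵣ
      .ite ((.lit 0 <ᵣ .reg 15) *ᵣ (.reg 30 <ᵣ .reg 16)) (.assign 30 (.reg 16)) skip) ;ᵣ
  -- Array `6` holds distances plus one.
  .assign 30 (.reg 30 -ᵣ .lit 1) ;ᵣ .store 2 (.reg 1) (.reg 30) ;ᵣ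
  .ite (.reg 30 <ᵣ .reg 6) (.assign 6 (.reg 30) ;ᵣ .assign 2 (.reg 1)) skip

/-- Queueing the edge from `reg a` to `reg b` for deletion. -/
def push (a b : ℕ) : Prog :=
  .store 9 (edgeAddr a b) (.lit 1) ;ᵣ .store 9 (edgeAddr b a) (.lit 1) ;ᵣ
  .store 11 (.reg 9) (.reg a) ;ᵣ .store 12 (.reg 9) (.reg b) ;ᵣ .assign 9 (.reg 9 +ᵣ .lit 1)

/-- Queueing all edges at distant vertices. -/
def removeFar : Prog :=
  forLoop 21 7
    (.load 13 7 (.reg 21) ;ᵣ .load 15 5 (.reg 13) ;ᵣ .load 16 6 (.reg 13) ;ᵣ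
      -- As register `16` is the query distance plus one, the negated comparison with `d` says that
      -- the distance is at least `d - 1`.
      .ite ((.lit 0 <ᵣ .reg 15) *ᵣ (.lit 1 -ᵣ (.reg 16 <ᵣ .reg 6)))
        (.load 25 8 (.reg 13) ;ᵣ
          forLoop 14 25
            (.ask 22 .neighbour (.reg 13) (.reg 14) ;ᵣ .load 20 9 (edgeAddr 13 22) ;ᵣ
              .ite (.reg 20 =ᵣ .lit 0) (push 13 22) skip))
        skip)

/-- Removing a triangle from the count at the edge from `reg a` to `reg b` with status
`reg s`. -/
def decrease (a b s : ℕ) : Prog :=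
  .load 16 10 (edgeAddr a b) ;ᵣ .assign 16 (.reg 16 -ᵣ .lit 1) ;ᵣ
  .store 10 (edgeAddr a b) (.reg 16) ;ᵣ .store 10 (edgeAddr b a) (.reg 16) ;ᵣ
  .ite ((.reg s =ᵣ .lit 0) *ᵣ (.reg 16 <ᵣ .reg 0)) (push a b) skip

/-- Removing the edge from `reg 13` to `reg 15`, where `reg 13` has degree `reg 25` in `G₀`, from
all triangles. -/
def scanTriangles : Prog :=
  forLoop 14 25
    (.ask 22 .neighbour (.reg 13) (.reg 14) ;ᵣ .ask 19 .edgeTruss (.reg 15) (.reg 22) ;ᵣ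
      .ite (.reg 19 <ᵣ .reg 0) skip
        (.load 20 9 (edgeAddr 13 22) ;ᵣ .load 31 9 (edgeAddr 15 22) ;ᵣ
          -- Queued edges still carry triangles; a triangle is discounted when the first of its
          -- edges is taken from the queue.
          .ite ((.reg 20 <ᵣ .lit 2) *ᵣ (.reg 31 <ᵣ .lit 2))
            (decrease 13 22 20 ;ᵣ decrease 15 22 31) skip))

/-- Processing the queue of edges. -/
def peel : Prog :=
  .loop (.reg 8 <ᵣ .reg 9)
    (.load 13 11 (.reg 8) ;ᵣ .load 15 12 (.reg 8) ;ᵣ .assign 8 (.reg 8 +ᵣ .lit 1) ;ᵣ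
      .store 9 (edgeAddr 13 15) (.lit 2) ;ᵣ .store 9 (edgeAddr 15 13) (.lit 2) ;ᵣ
      .load 25 8 (.reg 13) ;ᵣ .load 26 8 (.reg 15) ;ᵣ
      .ite (.reg 26 <ᵣ .reg 25)
        (.assign 22 (.reg 13) ;ᵣ .assign 13 (.reg 15) ;ᵣ .assign 15 (.reg 22) ;ᵣ
          .assign 25 (.reg 26)) skip ;ᵣ
      scanTriangles)

/-- One round. -/
def roundProg : Prog :=
  measure ;ᵣ removeFar ;ᵣ peel ;ᵣ analyse ;ᵣ .assign 1 (.reg 1 +ᵣ .lit 1)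

/-- BulkDelete. -/
def bulkDelete : LoopProgram := ⟨initProg, .reg 5, roundProg, .assign 2 (.reg 2)⟩

end TrussSearch

namespace TrussSearch

attribute [simp] Expr.eval Op.eval Expr.cost edgeAddr

/-! ### Specifications of the parts of the program -/

variable {n : ℕ} {G : SimpleGraph (Fin n)}

section Input

variable (I : TrussIndex G) (Q : List (Fin n))

@[simp] theorem TrussIndex.ask_numVertices (x y : ℕ) : I.ask Q .numVertices x y = n := rfl

@[simp] theorem TrussIndex.ask_numQueryNodes (x y : ℕ) :
    I.ask Q .numQueryNodes x y = Q.length := rfl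

theorem TrussIndex.ask_queryNode {x : ℕ} (h : x < Q.length) (y : ℕ) :
    I.ask Q .queryNode x y = (Q[x] : Fin n) := by simp [TrussIndex.ask, h]

@[simp] theorem TrussIndex.ask_degree (v : Fin n) (y : ℕ) :
    I.ask Q .degree v y = (I.nbrs v).length := by simp [TrussIndex.ask]

theorem TrussIndex.ask_neighbour (v : Fin n) {j : ℕ} (h : j < (I.nbrs v).length) :
    I.ask Q .neighbour v j = ((I.nbrs v)[j] : Fin n) := by simp [TrussIndex.ask, h]

@[simp] theorem TrussIndex.ask_vertexTruss (v : Fin n) (y : ℕ) :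
    I.ask Q .vertexTruss v y = Finset.univ.sup (fun u => edgeTrussness G v u) := by
  simp [TrussIndex.ask]

@[simp] theorem TrussIndex.ask_edgeTruss (u v : Fin n) :
    I.ask Q .edgeTruss u v = edgeTrussness G u v := by simp [TrussIndex.ask]

/-- The initial part of the adjacency list of `v` with edges of trussness at least `κ`. -/
noncomputable def TrussIndex.nb (κ : ℕ) (v : Fin n) : List (Fin n) :=
  (I.nbrs v).takeWhile fun u => κ ≤ edgeTrussness G v u

/-- In a descending list everything before an entry of value at least `κ` also has value at least
`κ`, so the initial segment misses no such entry. -/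
theorem mem_takeWhile_of_sorted {α : Type*} {f : α → ℕ} {κ : ℕ} {x : α} :
    ∀ {l : List α}, l.Pairwise (fun a b => f b ≤ f a) → x ∈ l → κ ≤ f x →
      x ∈ l.takeWhile (fun a => κ ≤ f a)
  | [], _, h, _ => by simp at h
  | a :: l, hs, h, hx => by
      rw [List.pairwise_cons] at hs
      have ha : κ ≤ f a := by
        rcases List.mem_cons.1 h with rfl | h
        · exact hx
        · exact hx.trans (hs.1 x h)
      rw [List.takeWhile_cons_of_pos (by simpa using ha), List.mem_cons]
      rcases List.mem_cons.1 h with rfl | h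
      · exact Or.inl rfl
      · exact Or.inr (mem_takeWhile_of_sorted hs.2 h hx)

theorem TrussIndex.nb_prefix (κ : ℕ) (v : Fin n) : I.nb κ v <+: I.nbrs v :=
  List.takeWhile_prefix _

theorem TrussIndex.nb_nodup (κ : ℕ) (v : Fin n) : (I.nb κ v).Nodup :=
  (I.nodup v).sublist (I.nb_prefix κ v).sublist

theorem edgeTrussness_of_not_adj {u v : Fin n} (h : ¬ G.Adj u v) : edgeTrussness G u v = 0 := by
  have : {t | ∃ H : G.Subgraph, H.Adj u v ∧ t = trussness H} = ∅ := by
    ext t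
    simp only [Set.mem_ofPred_eq, Set.mem_empty_iff_false, iff_false]
    rintro ⟨H, hH, -⟩
    exact h hH.adj_sub
  rw [edgeTrussness, this, csSup_empty]; rfl

theorem adj_of_le_edgeTrussness {κ : ℕ} (hκ : 1 ≤ κ) {u v : Fin n}
    (h : κ ≤ edgeTrussness G u v) : G.Adj u v := by
  by_contra h'
  rw [edgeTrussness_of_not_adj h'] at h
  omega

/-- Non-edges have trussness `0`, a supremum over the empty set; positivity of `κ` keeps them out.
-/
theorem TrussIndex.mem_nb {κ : ℕ} (hκ : 1 ≤ κ) {v u : Fin n} :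
    u ∈ I.nb κ v ↔ κ ≤ edgeTrussness G v u := by
  constructor
  · intro h
    simpa using List.mem_takeWhile_imp h
  · intro h
    exact mem_takeWhile_of_sorted (f := fun u => edgeTrussness G v u) (I.sorted v)
      ((I.mem_iff v u).2 (adj_of_le_edgeTrussness hκ h)) h

theorem TrussIndex.nb_length_le (κ : ℕ) (v : Fin n) :
    (I.nb κ v).length ≤ (I.nbrs v).length := (I.nb_prefix κ v).length_le

theorem TrussIndex.ask_nb {κ : ℕ} (v : Fin n) {j : ℕ} (h : j < (I.nb κ v).length) :
    I.ask Q .neighbour v j = ((I.nb κ v)[j] : Fin n) := by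
  rw [I.ask_neighbour Q v (h.trans_le (I.nb_length_le κ v)), (I.nb_prefix κ v).getElem h]

theorem getElem_takeWhile_length {α : Type*} {p : α → Bool} :
    ∀ {l : List α} (h : (l.takeWhile p).length < l.length), p l[(l.takeWhile p).length] = false
  | [], h => by simp at h
  | a :: l, h => by
      by_cases ha : p a
      · simp only [List.takeWhile_cons_of_pos ha, List.length_cons] at h ⊢
        exact getElem_takeWhile_length (by simpa using h)
      · simp only [List.takeWhile_cons_of_neg ha, List.length_nil]
        simpa using ha

theorem TrussIndex.lt_of_nb_length_lt {κ : ℕ} {v : Fin n}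
    (h : (I.nb κ v).length < (I.nbrs v).length) :
    edgeTrussness G v (I.nbrs v)[(I.nb κ v).length] < κ := by
  have := getElem_takeWhile_length (p := fun u => decide (κ ≤ edgeTrussness G v u)) h
  exact Nat.lt_of_not_le (of_decide_eq_false this)

end Input

variable {I : TrussIndex G} {Q : List (Fin n)} {U : Set (ℕ × ℕ)}

/-- Register `17` tells whether to go on, and `30` times this bit is the credit for the last pass. A
look-up past the end of the list does no harm, since the comparison with the length clears the bit.
-/
theorem countProg_spec {c : Config} {v : Fin n} {κ : ℕ} (h0 : c.reg 0 = κ)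
    (hv : c.reg 13 = v) :
    Run (I.ask Q) U countProg c fun c' T =>
      c'.reg 16 = (I.nb κ v).length ∧ T ≤ 30 * (I.nb κ v).length + 60 := by
  unfold countProg
  refine Run.seq (Run.assign (Run.seq (Run.assign (Run.seq (Run.ask ?_)))))
  have hle := I.nb_length_le κ v
  refine Run.loop (fun c' T => c'.reg 16 ≤ (I.nb κ v).length ∧
      c'.reg 18 = (I.nbrs v).length ∧ c'.reg 17 ≤ 1 ∧
      (c'.reg 17 = 0 → c'.reg 16 = (I.nb κ v).length) ∧ 
      T + 30 * c'.reg 17 ≤ 30 * c'.reg 16 + 30)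
    (fun c' => (I.nb κ v).length - c'.reg 16 + c'.reg 17) ?_ ?_ ?_
  · simp [hv]
  · rintro c' T hf ⟨h16, h18, h17, hend, hT⟩ hne
    have hv' : c'.reg 13 = v := by rw [hf.reg 13]; simpa using hv
    have hk : c'.reg 0 = κ := by rw [hf.reg 0]; simpa using h0
    have h17 : c'.reg 17 = 1 := by simp at hne; omega
    refine Run.seq (Run.ask (Run.seq (Run.ask (Run.seq (Run.assign (Run.assign ?_))))))
    rcases Nat.lt_or_ge (c'.reg 16) (I.nb κ v).length with hlt | hge
    · have e1 := I.ask_nb Q v hlt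
      have e2 := (I.nb κ v).getElem_mem hlt
      have e3 : κ ≤ edgeTrussness G v (I.nb κ v)[c'.reg 16] := by
        simpa using List.mem_takeWhile_imp e2
      have e4 : c'.reg 16 < (I.nbrs v).length := by omega
      simp [hv', hk, e1, h18, e4, Nat.not_lt.2 e3, h17]
      omega
    · have e0 : c'.reg 16 = (I.nb κ v).length := by omega
      rcases Nat.lt_or_ge (c'.reg 16) (I.nbrs v).length with hlt | hge'
      · have e1 := I.ask_neighbour Q v hlt
        have e3 := I.lt_of_nb_length_lt (κ := κ) (v := v) (by omega)
        simp only [← e0] at e3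
        simp [hv', hk, e1, h18, e3, h17]
        omega
      · simp [hv', hk, h18, h17, Nat.not_lt.2 hge']
        omega
  · rintro c' T hf ⟨h16, h18, h17, hend, hT⟩ hne
    simp at hne ⊢
    exact ⟨hend hne, by omega⟩

end TrussSearch

namespace TrussSearch

/-! ### Breadth-first search -/

/-- The state of a breadth-first search from `s`: the queue `L`, of which `h` entries have been
processed, and the labels `f`, which are distances plus one. -/
structure BfsInv {V : Type*} (A : SimpleGraph V) (s : V) (L : List V) (f : V → ℕ) (h : ℕ) :
    Prop where
  nodup : L.Nodup
  src : s ∈ L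
  start : f s = 1
  zero : ∀ v, f v = 0 ↔ v ∉ L
  walk : ∀ v ∈ L, ∃ p : A.Walk s v, p.length + 1 = f v
  done : ∀ i (hi : i < L.length), i < h → ∀ y, A.Adj L[i] y → y ∈ L ∧ f y ≤ f L[i] + 1
  mono : L.Pairwise fun a b => f a ≤ f b
  near : ∀ hh : h < L.length, ∀ v ∈ L, f v ≤ f L[h] + 1

namespace BfsInv

variable {V : Type*} {A : SimpleGraph V} {s : V} {L : List V} {f : V → ℕ} {h : ℕ}

theorem init [DecidableEq V] (A : SimpleGraph V) (s : V) : BfsInv A s [s] (fun v => if v = s then 1 else 0) 0 where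
  nodup := by simp
  src := by simp
  start := by simp
  zero v := by simp
  walk v hv := by
    obtain rfl : v = s := by simpa using hv
    exact ⟨.nil, by simp⟩
  done i hi h0 := by omega
  mono := by simp
  near hh v hv := by simp at hv; simp [hv]

/-- No label exceeds that of the head by more than one (`near`), so appending a vertex with label `f
L[h] + 1` keeps the queue sorted by labels. -/
theorem push [DecidableEq V] (H : BfsInv A s L f h) (hh : h < L.length) {u : V} (hu : u ∉ L)
    (ha : A.Adj L[h] u) : BfsInv A s (L ++ [u]) (Function.update f u (f L[h] + 1)) h := by
  have hne : ∀ v ∈ L, v ≠ u := fun v hv h => hu (h ▸ hv)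
  have hf : ∀ v ∈ L, Function.update f u (f L[h] + 1) v = f v := fun v hv => by simp [hne v hv]
  refine ⟨?_, by simp [H.src], by rw [hf _ H.src, H.start], fun v => ?_, fun v hv => ?_,
    fun i hi hih y hy => ?_, ?_, fun hh' v hv => ?_⟩
  · rw [List.nodup_append]
    exact ⟨H.nodup, by simp, fun a ha b hb => by simp at hb; exact hb ▸ hne a ha⟩
  · by_cases hv : v = u
    · simp [hv]
    · simp [hv, H.zero]
  · rw [List.mem_append, List.mem_singleton] at hv
    rcases hv with hv | rfl
    · rw [hf v hv]; exact H.walk v hv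
    · obtain ⟨p, hp⟩ := H.walk _ (L.getElem_mem hh)
      exact ⟨p.concat ha, by simp [hp]⟩
  · have hiL : i < L.length := by omega
    rw [List.getElem_append_left hiL] at hy ⊢
    obtain ⟨h1, h2⟩ := H.done i hiL hih y hy
    rw [hf _ h1, hf _ (L.getElem_mem hiL)]
    exact ⟨by simp [h1], h2⟩
  · rw [List.pairwise_append]
    refine ⟨H.mono.imp_of_mem fun {a b} ha hb hab => by rw [hf a ha, hf b hb]; exact hab, by simp,
      fun a ha b hb => ?_⟩
    simp only [List.mem_singleton] at hb
    rw [hb, hf a ha, Function.update_self]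
    exact H.near hh a ha
  · rw [List.getElem_append_left hh, hf _ (L.getElem_mem hh)]
    rw [List.mem_append, List.mem_singleton] at hv
    rcases hv with hv | rfl
    · rw [hf v hv]; exact H.near hh v hv
    · simp

theorem next (H : BfsInv A s L f h) (hh : h < L.length) (hd : ∀ y, A.Adj L[h] y → y ∈ L) :
    BfsInv A s L f (h + 1) := by
  refine { H with done := fun i hi hih y hy => ?_, near := fun hh' v hv => ?_ }
  · rcases Nat.lt_succ_iff_lt_or_eq.1 hih with h' | rfl
    · exact H.done i hi h' y hy
    · exact ⟨hd y hy, H.near hh y (hd y hy)⟩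
  · have h1 := H.near hh v hv
    have h2 := List.pairwise_iff_getElem.1 H.mono h (h + 1) hh hh' (by omega)
    omega

/-- Once all entries have been processed, labels increase by at most one along each edge. So they
are lower bounds for lengths of walks from the source, and the field `walk` supplies the converse.
-/
theorem walk_le (H : BfsInv A s L f h) (hh : L.length ≤ h) :
    ∀ {u v : V} (p : A.Walk u v), u ∈ L → v ∈ L ∧ f v ≤ f u + p.length
  | _, _, .nil, hu => ⟨hu, by simp⟩
  | u, v, .cons (v := w) ha p, hu => by
      obtain ⟨i, hi, rfl⟩ := List.getElem_of_mem hu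
      obtain ⟨h1, h2⟩ := H.done i hi (by omega) _ ha
      obtain ⟨h3, h4⟩ := H.walk_le hh p h1
      refine ⟨h3, ?_⟩
      simp only [SimpleGraph.Walk.length_cons]; omega

theorem mem_iff (H : BfsInv A s L f h) (hh : L.length ≤ h) (v : V) :
    v ∈ L ↔ A.Reachable s v :=
  ⟨fun hv => ⟨(H.walk v hv).choose⟩, fun ⟨p⟩ => (H.walk_le hh p H.src).1⟩

theorem label [DecidableEq V] (H : BfsInv A s L f h) (hh : L.length ≤ h) (v : V) :
    f v = if v ∈ L then A.dist s v + 1 else 0 := by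
  split
  case isTrue hv =>
    obtain ⟨p, hp⟩ := H.walk v hv
    obtain ⟨q, hq⟩ := SimpleGraph.Reachable.exists_walk_length_eq_dist ⟨p⟩
    have h1 := SimpleGraph.dist_le p
    have h2 := (H.walk_le hh q H.src).2
    rw [H.start] at h2
    omega
  case isFalse hv => exact (H.zero v).2 hv

end BfsInv

variable {n : ℕ} {G : SimpleGraph (Fin n)} {I : TrussIndex G} {Q : List (Fin n)} {U : Set (ℕ × ℕ)}

/-- Array `a` begins with the list `L`. -/
def ListAt (c : Config) (a : ℕ) (L : List (Fin n)) : Prop :=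
  ∀ i (h : i < L.length), c.mem a i = (L[i] : Fin n)

theorem ListAt.of_eq {c c' : Config} {a : ℕ} {L : List (Fin n)} (h : ListAt c a L)
    (he : c'.mem a = c.mem a) : ListAt c' a L := fun i hi => by rw [he]; exact h i hi

theorem ListAt.append {c : Config} {a : ℕ} {L : List (Fin n)} (h : ListAt c a L) {u : Fin n}
    {c' : Config} (hc : c'.mem a = Function.update (c.mem a) L.length u) :
    ListAt c' a (L ++ [u]) := by
  intro i hi
  rw [hc, Function.update_apply]
  simp only [List.length_append, List.length_singleton] at hi
  split
  case isTrue h => subst h; simp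
  case isFalse h' =>
    have : i < L.length := by omega
    rw [List.getElem_append_left this]; exact h i this

/-- What a search at level `κ` needs: `X` is closed under edges of trussness at least `κ`, and the
edges of `A` are the edges at `X` of trussness at least `κ` and status `0`. -/
structure BfsPre (I : TrussIndex G) (U : Set (ℕ × ℕ)) (κ : ℕ) (A : SimpleGraph (Fin n))
    (X : Finset (Fin n)) (c : Config) : Prop where
  pos : 1 ≤ κ
  closed : ∀ u ∈ X, ∀ v, κ ≤ edgeTrussness G u v → v ∈ X
  adj : ∀ u ∈ X, ∀ v, A.Adj u v ↔ κ ≤ edgeTrussness G u v ∧ c.mem 9 (u * n + v) = 0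
  level : c.reg 0 = κ
  size : c.reg 3 = n
  cell4 : ∀ v ∈ X, (4, (v : ℕ)) ∈ U
  cell3 : ∀ i < X.card, (3, i) ∈ U
  cell9 : ∀ u ∈ X, ∀ v, κ ≤ edgeTrussness G u v → (9, (u * n + v : ℕ)) ∈ U

/-- The head stays fixed while the queue grows; the prefix relation preserves the entry at position
`h`. All `A`-neighbours of the head occur in the scanned segment, so afterwards they are in the
queue, as `BfsInv.next` requires. -/
theorem bfsScan_spec {κ : ℕ} {A : SimpleGraph (Fin n)} {X : Finset (Fin n)} {s : Fin n}
    {L : List (Fin n)} {h : ℕ} (hh : h < L.length) {c : Config} (H : BfsPre I U κ A X c)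
    (h13 : c.reg 13 = L[h]) (h16 : c.reg 16 = (I.nb κ L[h]).length) (h24 : c.reg 24 = c.mem 4 L[h])
    (h12 : c.reg 12 = L.length) (hL : ListAt c 3 L) (hX : ∀ v ∈ L, v ∈ X)
    (hb : BfsInv A s L (fun v => c.mem 4 v) h) :
    Run (I.ask Q) U bfsScan c fun c' T => ∃ L' : List (Fin n), L <+: L' ∧ c'.reg 12 = L'.length ∧
      ListAt c' 3 L' ∧ (∀ v ∈ L', v ∈ X) ∧ BfsInv A s L' (fun v => c'.mem 4 v) (h + 1) ∧
      T ≤ 60 * (I.nb κ L[h]).length + 10 := by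
  have hm := L.getElem_mem hh
  refine Run.for (fun x c' => ∃ L' : List (Fin n), L <+: L' ∧ c'.reg 12 = L'.length ∧
      ListAt c' 3 L' ∧ (∀ v ∈ L', v ∈ X) ∧ BfsInv A s L' (fun v => c'.mem 4 v) h ∧
      c'.mem 4 L[h] = c.mem 4 L[h] ∧ ∀ i (hi : i < (I.nb κ L[h]).length), i < x → A.Adj L[h] (I.nb κ L[h])[i] →
        (I.nb κ L[h])[i] ∈ L') (fun _ => 52) h16 (by decide) (by decide) ?_ ?_ ?_
  · exact ⟨L, List.prefix_rfl, h12, hL, hX, hb, rfl, by simp⟩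
  · rintro x hx c' hf h14 ⟨L', hpre, h12', hL', hX', hb', hlab, hd⟩
    have hh' : h < L'.length := hh.trans_le hpre.length_le
    have hLh : L'[h] = L[h] := (hpre.getElem hh).symm
    set u := (I.nb κ L[h])[x] with hu
    have hτ : κ ≤ edgeTrussness G L[h] u := (I.mem_nb H.pos).1 (List.getElem_mem hx)
    have huX : u ∈ X := H.closed _ (hX _ hm) _ hτ
    have e13 : c'.reg 13 = L[h] := by rw [hf.reg 13, h13]
    have e3 : c'.reg 3 = n := by rw [hf.reg 3, H.size]
    have e24 : c'.reg 24 = c'.mem 4 L[h] := by rw [hf.reg 24, h24, hlab]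
    have e9 : c'.mem 9 = c.mem 9 := hf.mem 9
    have eask := I.ask_nb Q L[h] hx
    refine Run.seq (Run.ask (Run.seq (Run.load ?_ (Run.seq (Run.load ?_ (Run.ite ?_ ?_))))))
    · simpa [h14, e13, e3, eask] using H.cell9 _ (hX _ hm) u hτ
    · simpa [h14, e13, e3, eask] using H.cell4 u huX
    · intro hne
      have hst : c'.mem 4 u = 0 ∧ c.mem 9 (L[h] * n + u) = 0 := by
        simpa [h14, e13, e3, eask, e9, ← hu] using hne
      have huL : u ∉ L' := (hb'.zero u).1 hst.1
      have hadj : A.Adj L[h] u := (H.adj _ (hX _ hm) u).2 ⟨hτ, hst.2⟩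
      have hX2 : ∀ v ∈ L' ++ [u], v ∈ X := by
        intro v hv
        simp only [List.mem_append, List.mem_singleton] at hv
        rcases hv with hv | rfl
        · exact hX' v hv
        · exact huX
      have hb2 := hb'.push hh' huL (by rw [hLh]; exact hadj)
      -- The queue lies in `X` without repetitions, hence its next free position is a cell provided
      -- for.
      have hlen : L'.length < X.card := by
        have h1 := List.toFinset_card_of_nodup hb2.nodup
        have h2 := Finset.card_le_card (s := (L' ++ [u]).toFinset) (t := X) fun v hv =>
          hX2 v (List.mem_toFinset.1 hv)
        rw [h1] at h2
        simpa using h2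
      have hne' : L[h] ≠ u := fun h => huL (h ▸ hpre.subset hm)
      have hne'' : ((L[h] : Fin n) : ℕ) ≠ u := fun h => hne' (Fin.ext h)
      refine Run.seq (Run.store ?_ (Run.seq (Run.store ?_ (Run.assign ?_))))
      · simpa [h14, e13, e3, eask] using H.cell4 u huX
      · simpa [h12'] using H.cell3 _ hlen
      · refine ⟨⟨L' ++ [u], hpre.trans (List.prefix_append _ _), by simp [h12'], ?_, hX2, ?_, ?_,
          fun i hi hix ha => ?_⟩, by simp⟩
        · exact hL'.append (by simp [h12', h14, e13, eask, hu])
        · convert hb2 using 1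
          funext v
          simp [h14, e13, eask, ← hu, e24, Function.update_apply, Fin.ext_iff, hLh]
        · simp [h14, e13, eask, ← hu, hne'', hlab]
        · rcases Nat.lt_succ_iff_lt_or_eq.1 hix with h' | rfl
          · exact List.mem_append_left _ (hd i hi h' ha)
          · simp [hu]
    -- Status and label are not both `0`. For an `A`-edge the status is `0`, so its end is labelled,
    -- that is, already in the queue.
    · intro heq
      refine Run.assign ⟨⟨L', hpre, by simp [h12'], hL'.of_eq (by simp), hX', hb', hlab,
        fun i hi hix ha => ?_⟩, by simp⟩
      rcases Nat.lt_succ_iff_lt_or_eq.1 hix with h' | rfl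
      · exact hd i hi h' ha
      · by_contra h'
        have h4 := (hb'.zero u).2 h'
        have h9 := ((H.adj _ (hX _ hm) u).1 ha).2
        simp [h14, e13, e3, eask, e9, ← hu, h4, h9] at heq
  · rintro c' T hf ⟨L', hpre, h12', hL', hX', hb', hlab, hd⟩ hT
    have hh' : h < L'.length := hh.trans_le hpre.length_le
    have hLh : L'[h] = L[h] := (hpre.getElem hh).symm
    refine ⟨L', hpre, h12', hL', hX', hb'.next hh' fun y hy => ?_, ?_⟩
    swap
    · simp at hT; omega
    rw [hLh] at hy
    have hy' := ((H.adj _ (hX _ hm) y).1 hy).1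
    obtain ⟨i, hi, rfl⟩ := List.getElem_of_mem ((I.mem_nb H.pos).2 hy')
    exact hd i hi hi hy

theorem BfsPre.of_frame {κ : ℕ} {A : SimpleGraph (Fin n)} {X : Finset (Fin n)} {c c' : Config}
    (H : BfsPre I U κ A X c) (h0 : c'.reg 0 = c.reg 0) (h3 : c'.reg 3 = c.reg 3)
    (h9 : c'.mem 9 = c.mem 9) : BfsPre I U κ A X c' :=
  { H with
    adj := by rw [h9]; exact H.adj
    level := by rw [h0, H.level]
    size := by rw [h3, H.size] }

theorem bfs_spec {κ : ℕ} {A : SimpleGraph (Fin n)} {X : Finset (Fin n)} {s : Fin n} (hs : s ∈ X)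
    {c : Config} (H : BfsPre I U κ A X c) (h10 : c.reg 10 = s) (h4 : ∀ v : Fin n, c.mem 4 v = 0) :
    Run (I.ask Q) U bfs c fun c' T => ∃ L : List (Fin n), L.Nodup ∧
      (∀ v, v ∈ L ↔ A.Reachable s v) ∧ (∀ v ∈ L, v ∈ X) ∧ c'.reg 12 = L.length ∧ ListAt c' 3 L ∧
      (∀ v : Fin n, c'.mem 4 v = if v ∈ L then A.dist s v + 1 else 0) ∧
      T ≤ 120 * ∑ v ∈ X, ((I.nb κ v).length + 1) + 20 := by
  have hcard : 0 < X.card := Finset.card_pos.2 ⟨s, hs⟩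
  refine Run.seq (Run.store (by simpa [h10] using H.cell4 s hs) (Run.seq (Run.store
    (by simpa using H.cell3 0 hcard) (Run.seq (Run.assign (Run.seq (Run.assign ?_)))))))
  -- The time is charged to the entries processed, in proportion to their list lengths. Entries are
  -- distinct members of `X`, so the final sum is at most the sum over `X`.
  refine Run.loop (fun c' T => ∃ L : List (Fin n), ∃ h ≤ L.length, c'.reg 11 = h ∧
    c'.reg 12 = L.length ∧ ListAt c' 3 L ∧ (∀ v ∈ L, v ∈ X) ∧ 
    BfsInv A s L (fun v => c'.mem 4 v) h ∧
    T ≤ ((L.take h).map fun v => 120 * ((I.nb κ v).length + 1)).sum)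
    (fun c' => X.card - c'.reg 11) ?_ ?_ ?_
  · refine ⟨[s], 0, by simp, by simp, by simp, fun i hi => ?_, by simp [hs], ?_, by simp⟩
    · obtain rfl : i = 0 := by simpa using hi
      simp [h10]
    · convert BfsInv.init A s using 1
      funext v
      simp [h10, h4, Function.update_apply, Fin.ext_iff]
  · rintro c' T hf ⟨L, h, hle, h11, h12, hL, hX, hb, hT⟩ hne
    have hh : h < L.length := by simpa [h11, h12] using hne
    have H' : BfsPre I U κ A X c' := H.of_frame (by simp [hf.reg 0]) (by simp [hf.reg 3])
      (by simp [hf.mem 9])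
    have hlen : L.length ≤ X.card := by
      rw [← List.toFinset_card_of_nodup hb.nodup]
      exact Finset.card_le_card fun v hv => hX v (List.mem_toFinset.1 hv)
    have hmem := hL h hh
    refine Run.seq (Run.load (by simpa [h11] using H.cell3 h (by omega)) (Run.seq (Run.assign
      (Run.seq ((countProg_spec (I := I) (κ := κ) (v := L[h]) (by simp [H'.level])
        (by simp [h11, hmem])).conseq ?_)))))
    rintro c1 T1 hf1 ⟨h16, hT1⟩
    have e13 : c1.reg 13 = L[h] := by rw [hf1.reg 13]; simp [h11, hmem]
    refine Run.seq (Run.load (by simpa [e13] using H.cell4 _ (hX _ (L.getElem_mem hh))) ?_)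
    refine (bfsScan_spec (s := s) hh (H'.of_frame (by simp [hf1.reg 0]) (by simp [hf1.reg 3])
      (by simp [hf1.mem 9])) (by simp [e13]) (by simp [h16]) (by simp [e13])
      (by simp [hf1.reg 12, h12]) (hL.of_eq (by simp [hf1.mem 3])) hX
      (by simpa [hf1.mem 4] using hb)).conseq ?_
    rintro c2 T2 hf2 ⟨L', hpre, h12', hL', hX', hb', hT2⟩
    have e11 : c2.reg 11 = h + 1 := by rw [hf2.reg 11]; simp [hf1.reg 11, h11]
    have hh' : h < L'.length := hh.trans_le hpre.length_le
    refine ⟨⟨L', h + 1, hh', e11, h12', hL', hX', hb', ?_⟩, by omega⟩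
    have : L'.take (h + 1) = L.take h ++ [L[h]] := by
      rw [← List.take_succ_eq_append_getElem hh]
      obtain ⟨M, rfl⟩ := hpre
      rw [List.take_append_of_le_length hh]
    rw [this]
    simp only [List.map_append, List.sum_append, List.map_cons, List.map_nil, List.sum_singleton,
      Expr.cost] at hT ⊢
    omega
  · rintro c' T hf ⟨L, h, hle, h11, h12, hL, hX, hb, hT⟩ heq
    have hh : L.length ≤ h := by simpa [h11, h12] using heq
    refine ⟨L, hb.nodup, hb.mem_iff hh, hX, h12, hL, hb.label hh, ?_⟩
    rw [List.take_of_length_le hh] at hT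
    have h1 : (L.map fun v => 120 * ((I.nb κ v).length + 1)).sum =
        ∑ v ∈ L.toFinset, 120 * ((I.nb κ v).length + 1) := (List.sum_toFinset _ hb.nodup).symm
    have h2 : ∑ v ∈ L.toFinset, 120 * ((I.nb κ v).length + 1) ≤
        ∑ v ∈ X, 120 * ((I.nb κ v).length + 1) :=
      Finset.sum_le_sum_of_subset fun v hv => hX v (List.mem_toFinset.1 hv)
    simp only [← Finset.mul_sum] at h1 h2
    simp only [Expr.cost]
    omega

/-- Collecting the result of a search. -/
theorem absorb_spec {X : Finset (Fin n)} {L : List (Fin n)} (hn : L.Nodup) (hX : ∀ v ∈ L, v ∈ X)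
    {c : Config} (h12 : c.reg 12 = L.length) (hL : ListAt c 3 L)
    (h4 : ∀ v : Fin n, v ∉ L → c.mem 4 v = 0)
    (cell : ∀ v ∈ X, (4, (v : ℕ)) ∈ U ∧ (5, (v : ℕ)) ∈ U ∧ (6, (v : ℕ)) ∈ U)
    (cell3 : ∀ i < X.card, (3, i) ∈ U) :
    Run (I.ask Q) U absorb c fun c' T => (∀ v : Fin n, c'.mem 4 v = 0) ∧
      (∀ v : Fin n, c'.mem 5 v = c.mem 5 v + if v ∈ L ∧ 1 < L.length then 1 else 0) ∧
      (∀ v : Fin n, c'.mem 6 v = max (c.mem 6 v) (c.mem 4 v)) ∧ T ≤ 60 * X.card + 10 := by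
  have hlen : L.length ≤ X.card := by
    rw [← List.toFinset_card_of_nodup hn]
    exact Finset.card_le_card fun v hv => hX v (List.mem_toFinset.1 hv)
  refine Run.for (fun x c' =>
    (∀ v : Fin n, c'.mem 4 v = if v ∈ L.take x then 0 else c.mem 4 v) ∧
    (∀ v : Fin n, c'.mem 5 v = c.mem 5 v + if v ∈ L.take x ∧ 1 < L.length then 1 else 0) ∧
    (∀ v : Fin n, c'.mem 6 v = if v ∈ L.take x then max (c.mem 6 v) (c.mem 4 v) else c.mem 6 v))
    (fun _ => 52) h12 (by decide) (by decide) ?_ ?_ ?_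
  · simp
  · rintro x hx c' hf h14 ⟨i4, i5, i6⟩
    have e3 : c'.mem 3 x = (L[x] : Fin n) := by rw [hf.mem 3]; exact hL x hx
    have e12 : c'.reg 12 = L.length := by rw [hf.reg 12, h12]
    have hxX := hX _ (L.getElem_mem hx)
    have htake : ∀ v, v ∈ L.take (x + 1) ↔ v ∈ L.take x ∨ v = L[x] := fun v => by
      rw [List.take_succ_eq_append_getElem hx, List.mem_append, List.mem_singleton]
    have hnot : L[x] ∉ L.take x := by
      intro h
      obtain ⟨i, hi, he⟩ := List.getElem_of_mem h
      simp only [List.length_take] at hi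
      rw [List.getElem_take] at he
      have := (hn.getElem_inj_iff).1 he
      omega
    have j4 := i4 L[x]
    have j5 := i5 L[x]
    have j6 := i6 L[x]
    simp only [hnot, if_false, false_and] at j4 j5 j6
    refine Run.seq (Run.load ?_ (Run.seq (Run.load ?_ (Run.seq (Run.store ?_ (Run.seq
      (Run.load ?_ (Run.seq (Run.load ?_ (Run.seq (Run.ite ?_ ?_)))))))))))
    · simpa [h14] using cell3 x (by omega)
    · simpa [h14, e3] using (cell _ hxX).2.1
    · simpa [h14, e3] using (cell _ hxX).2.1
    · simpa [h14, e3] using (cell _ hxX).2.2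
    · simpa [h14, e3] using (cell _ hxX).1
    · intro hne
      have hlt : c.mem 6 L[x] < c.mem 4 L[x] := by simpa [h14, e3, j4, j6] using hne
      refine Run.store (by simpa [h14, e3] using (cell _ hxX).2.2) (Run.store
        (by simpa [h14, e3] using (cell _ hxX).1) ⟨⟨fun v => ?_, fun v => ?_, fun v => ?_⟩,
        by simp⟩)
      · by_cases hv : v = L[x]
        · subst hv; simp [h14, e3, htake]
        · have : (v : ℕ) ≠ (L[x] : Fin n) := fun h => hv (Fin.ext h)
          simp [h14, e3, htake, hv, this, i4]
      · by_cases hv : v = L[x]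
        · subst hv; simp [h14, e3, htake, j5, e12]
        · have : (v : ℕ) ≠ (L[x] : Fin n) := fun h => hv (Fin.ext h)
          simp [h14, e3, htake, hv, this, i5]
      · by_cases hv : v = L[x]
        · subst hv; simp [h14, e3, htake, j4, hlt.le]
        · have : (v : ℕ) ≠ (L[x] : Fin n) := fun h => hv (Fin.ext h)
          simp [h14, e3, htake, hv, this, i6]
    · intro hne
      have hlt : c.mem 4 L[x] ≤ c.mem 6 L[x] := by simpa [h14, e3, j4, j6] using hne
      refine Run.assign (Run.store
        (by simpa [h14, e3] using (cell _ hxX).1) ⟨⟨fun v => ?_, fun v => ?_, fun v => ?_⟩,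
        by simp⟩)
      · by_cases hv : v = L[x]
        · subst hv; simp [h14, e3, htake]
        · have : (v : ℕ) ≠ (L[x] : Fin n) := fun h => hv (Fin.ext h)
          simp [h14, e3, htake, hv, this, i4]
      · by_cases hv : v = L[x]
        · subst hv; simp [h14, e3, htake, j5, e12]
        · have : (v : ℕ) ≠ (L[x] : Fin n) := fun h => hv (Fin.ext h)
          simp [h14, e3, htake, hv, this, i5]
      · by_cases hv : v = L[x]
        · subst hv; simp [h14, e3, htake, j6, hlt]
        · have : (v : ℕ) ≠ (L[x] : Fin n) := fun h => hv (Fin.ext h)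
          simp [h14, e3, htake, hv, i6]
  · rintro c' T hf ⟨i4, i5, i6⟩ hT
    simp only [List.take_length] at i4 i5 i6
    refine ⟨fun v => ?_, i5, fun v => ?_, ?_⟩
    · rw [i4]; split
      · rfl
      · exact h4 v ‹_›
    · rw [i6]; split
      · rfl
      · rw [h4 v ‹_›]; simp
    · simp at hT; omega

end TrussSearch

namespace TrussSearch

/-! ### The analysis of the current graph -/

variable {n : ℕ} {G : SimpleGraph (Fin n)} {I : TrussIndex G} {Q : List (Fin n)} {U : Set (ℕ × ℕ)}

/-- A loop running through a list without repetitions. -/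
theorem Run.forList {inp : Query → ℕ → ℕ → ℕ} {α : Type*} [DecidableEq α] {i N : ℕ} {p : Prog}
    {c : Config} {Post : Config → ℕ → Prop} {L : List α} (hL : L.Nodup)
    (P : Finset α → Config → Prop) (t : α → ℕ) (hm : c.reg N = L.length)
    (hset : ∀ S c x, P S c → P S (c.setReg i x)) (h0 : P ∅ c)
    (hstep : ∀ x (hx : x < L.length) S c', Frame (forLoop i N p) c c' → c'.reg i = x →
      L[x] ∉ S → (∀ a ∈ S, a ∈ L) → P S c' →
      Run inp U p c' fun c'' T => P (insert L[x] S) c'' ∧ T ≤ t L[x])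
    (hend : ∀ c' T, Frame (forLoop i N p) c c' → P L.toFinset c' →
      T ≤ ∑ a ∈ L.toFinset, (t a + 8) + 6 → Post c' T)
    (hN : N ∉ (Prog.assign i (.lit 0) ;ᵣ p).regs := by decide) (hi : i ∉ p.regs := by decide) :
    Run inp U (forLoop i N p) c Post := by
  have hsum : ∀ x ≤ L.length, ∑ y ∈ Finset.range x, ((if h : y < L.length then t L[y] else 0) + 8) =
      ∑ a ∈ (L.take x).toFinset, (t a + 8) := by
    intro x
    induction x with
    | zero => simp
    | succ x ih =>
        intro hx
        have hx' : x < L.length := hx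
        rw [Finset.sum_range_succ, ih hx'.le, List.sum_toFinset _ (hL.sublist (List.take_sublist _ _)),
          List.sum_toFinset _ (hL.sublist (List.take_sublist _ _)),
          List.take_succ_eq_append_getElem hx']
        simp [hx']
  refine Run.for (fun x c' => P (L.take x).toFinset c')
    (fun y => if h : y < L.length then t L[y] else 0) hm hN hi ?_ ?_ ?_
  · exact hset _ _ _ (by simpa using h0)
  · intro x hx c' hf hi' hP
    have hnot : L[x] ∉ (L.take x).toFinset := by
      rw [List.mem_toFinset]
      intro h
      obtain ⟨i, hi, he⟩ := List.getElem_of_mem h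
      simp only [List.length_take] at hi
      rw [List.getElem_take] at he
      have := (hL.getElem_inj_iff).1 he
      omega
    refine (hstep x hx _ c' hf hi' hnot (fun a ha => List.mem_of_mem_take (List.mem_toFinset.1 ha))
      hP).conseq fun c'' T _ h => ⟨hset _ _ _ ?_, by simpa [hx] using h.2⟩
    convert h.1 using 1
    rw [List.take_succ_eq_append_getElem hx]
    ext a; simp only [Finset.mem_insert, List.mem_toFinset, List.mem_append, List.mem_singleton, or_comm]
  · intro c' T hf hP hT
    rw [hsum _ le_rfl] at hT
    rw [List.take_length] at hP hT
    exact hend c' T hf hP hT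

/-- `X` is the vertex set of the initial graph, and `U` contains the cells provided for. -/
structure Env (I : TrussIndex G) (Q : List (Fin n)) (U : Set (ℕ × ℕ)) (k : ℕ)
    (X : Finset (Fin n)) : Prop where
  pos : 1 ≤ k
  closed : ∀ u ∈ X, ∀ v, k ≤ edgeTrussness G u v → v ∈ X
  nodup : Q.Nodup
  nonempty : Q ≠ []
  query : ∀ q ∈ Q, q ∈ X
  vcell : ∀ A ∈ [0, 4, 5, 6, 8], ∀ v ∈ X, (A, (v : ℕ)) ∈ U
  icell : ∀ A ∈ [2, 3, 7], ∀ i < X.card, (A, i) ∈ U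
  ecell : ∀ A ∈ [1, 9, 10], ∀ u ∈ X, ∀ v, k ≤ edgeTrussness G u v → (A, (u * n + v : ℕ)) ∈ U
  qcell : ∀ A ∈ [11, 12], ∀ i, 2 * i < ∑ v ∈ X, (I.nb k v).length → (A, i) ∈ U

/-- The number of vertices and twice the number of edges of the initial graph. -/
noncomputable def weight (I : TrussIndex G) (k : ℕ) (X : Finset (Fin n)) : ℕ :=
  ∑ v ∈ X, ((I.nb k v).length + 1)

theorem card_le_weight (I : TrussIndex G) (k : ℕ) (X : Finset (Fin n)) : X.card ≤ weight I k X := by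
  rw [Finset.card_eq_sum_ones]
  exact Finset.sum_le_sum fun v _ => by omega

/-- The data prepared by the initial part. -/
structure Setup (I : TrussIndex G) (Q : List (Fin n)) (k : ℕ) (X : Finset (Fin n))
    (L : List (Fin n)) (c : Config) : Prop where
  level : c.reg 0 = k
  size : c.reg 3 = n
  queries : c.reg 4 = Q.length
  count : c.reg 7 = L.length
  list : ListAt c 7 L
  nodup : L.Nodup
  mem_iff : ∀ v, v ∈ L ↔ v ∈ X
  degree : ∀ v ∈ X, c.mem 8 v = (I.nb k v).length

theorem Setup.toFinset {k X L c} (H : Setup I Q k X L c) : L.toFinset = X := by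
  ext v; simp [H.mem_iff]

theorem Setup.length {k X L c} (H : Setup I Q k X L c) : L.length = X.card := by
  rw [← H.toFinset, List.toFinset_card_of_nodup H.nodup]

theorem Setup.of_frame {k X L p c c'} (H : Setup I Q k X L c) (hf : Frame p c c')
    (h0 : 0 ∉ p.regs := by decide) (h3 : 3 ∉ p.regs := by decide) (h4 : 4 ∉ p.regs := by decide)
    (h7 : 7 ∉ p.regs := by decide) (h7' : 7 ∉ p.arrays := by decide)
    (h8 : 8 ∉ p.arrays := by decide) : Setup I Q k X L c' where
  level := by rw [hf.reg 0 h0, H.level]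
  size := by rw [hf.reg 3 h3, H.size]
  queries := by rw [hf.reg 4 h4, H.queries]
  count := by rw [hf.reg 7 h7, H.count]
  list := H.list.of_eq (hf.mem 7 h7')
  nodup := H.nodup
  mem_iff := H.mem_iff
  degree := by rw [hf.mem 8 h8]; exact H.degree

theorem Setup.setReg {k X L c} (H : Setup I Q k X L c) {r x : ℕ} (hr : r ∉ [0, 3, 4, 7] := by decide) :
    Setup I Q k X L (c.setReg r x) := by
  simp only [List.mem_cons, List.not_mem_nil, not_or, or_false] at hr
  obtain ⟨h0, h3, h4, h7⟩ := hr
  exact ⟨by simp [Ne.symm h0, H.level], by simp [Ne.symm h3, H.size],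
    by simp [Ne.symm h4, H.queries], by simp [Ne.symm h7, H.count], H.list, H.nodup, H.mem_iff, H.degree⟩

/-- The edges of `A` are the edges of the initial graph of status `0`. -/
def Alive (k : ℕ) (X : Finset (Fin n)) (A : SimpleGraph (Fin n)) (c : Config) : Prop :=
  ∀ u ∈ X, ∀ v, A.Adj u v ↔ k ≤ edgeTrussness G u v ∧ c.mem 9 (u * n + v) = 0

theorem Env.bfsPre {k X L A c} (E : Env I Q U k X) (S : Setup I Q k X L c)
    (hA : Alive (G := G) k X A c) : BfsPre I U k A X c where
  pos := E.pos
  closed := E.closed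
  adj := hA
  level := S.level
  size := S.size
  cell4 := E.vcell 4 (by simp)
  cell3 := E.icell 3 (by simp)
  cell9 := E.ecell 9 (by simp)

/-- This is the meaning of the length test in `absorb`: the source of the search is not isolated. -/
theorem one_lt_length_iff {A : SimpleGraph (Fin n)} {s : Fin n} {L : List (Fin n)} (hn : L.Nodup)
    (hL : ∀ v, v ∈ L ↔ A.Reachable s v) : 1 < L.length ↔ ∃ w, A.Adj s w := by
  rw [← List.toFinset_card_of_nodup hn, Finset.one_lt_card_iff]
  constructor
  · rintro ⟨a, b, ha, hb, hab⟩
    simp only [List.mem_toFinset, hL] at ha hb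
    obtain ⟨c, hc, hcs⟩ : ∃ c, A.Reachable s c ∧ s ≠ c := by
      by_cases h : s = a
      · exact ⟨b, hb, h ▸ hab⟩
      · exact ⟨a, ha, h⟩
    obtain ⟨p⟩ := hc
    cases p with
    | nil => exact absurd rfl hcs
    | cons h p => exact ⟨_, h⟩
  · rintro ⟨w, hw⟩
    refine ⟨s, w, ?_, ?_, hw.ne⟩
    · simp [hL]
    · simpa [hL] using hw.reachable

open Classical in
/-- Queries reaching `v` in `A`, isolated ones excluded. -/
noncomputable def reachCount (Q : List (Fin n)) (A : SimpleGraph (Fin n)) (v : Fin n) : ℕ :=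
  (Q.toFinset.filter fun q => A.Reachable q v ∧ ∃ w, A.Adj q w).card

open Classical in
/-- The maximum of `dist_A(q, v) + 1` over the queries `q` reaching `v`. -/
noncomputable def farthest (Q : List (Fin n)) (A : SimpleGraph (Fin n)) (v : Fin n) : ℕ :=
  Q.toFinset.sup fun q => if A.Reachable q v then A.dist q v + 1 else 0

theorem distances_spec {k X L A} {c : Config} (E : Env I Q U k X) (S : Setup I Q k X L c)
    (hA : Alive (G := G) k X A c) (hz : ∀ v : Fin n, c.mem 4 v = 0) :
    Run (I.ask Q) U distances c fun c' T => (∀ v : Fin n, c'.mem 4 v = 0) ∧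
      (∀ v ∈ X, c'.mem 5 v = reachCount Q A v) ∧ (∀ v ∈ X, c'.mem 6 v = farthest Q A v) ∧
      T ≤ 400 * (Q.length * weight I k X) := by
  classical
  refine Run.seq (Run.forList S.nodup
    (fun M c' => ∀ v ∈ M, c'.mem 5 v = 0 ∧ c'.mem 6 v = 0) (fun _ => 20) S.count
    (fun _ _ _ h => h) (by simp) ?_ ?_)
  · intro x hx M c' hf h21 hxM hM hP
    have hxX := (S.mem_iff _).1 (L.getElem_mem hx)
    have e := S.list.of_eq (hf.mem 7) x hx
    refine Run.seq (Run.load ?_ (Run.seq (Run.store ?_ (Run.store ?_ ⟨?_, by simp⟩))))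
    · simpa [h21] using E.icell 7 (by simp) x (S.length ▸ hx)
    · simpa [h21, e] using E.vcell 5 (by simp) _ hxX
    · simpa [h21, e] using E.vcell 6 (by simp) _ hxX
    · intro v hv
      rcases Finset.mem_insert.1 hv with rfl | hv
      · simp [h21, e]
      · have hne : (v : ℕ) ≠ (L[x] : Fin n) := fun h => hxM (Fin.ext h ▸ hv)
        simpa [h21, e, hne] using hP v hv
  intro c1 T1 hf1 hP1 hT1
  rw [S.toFinset] at hP1 hT1
  have S1 := S.of_frame hf1
  have hA1 : Alive (G := G) k X A c1 := by intro u hu v; rw [hf1.mem 9]; exact hA u hu v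
  refine Run.forList E.nodup (fun M c' => (∀ v : Fin n, c'.mem 4 v = 0) ∧
    (∀ v ∈ X, c'.mem 5 v = (M.filter fun q => A.Reachable q v ∧ ∃ w, A.Adj q w).card) ∧
    (∀ v ∈ X, c'.mem 6 v = M.sup fun q => if A.Reachable q v then A.dist q v + 1 else 0))
    (fun _ => 190 * weight I k X + 60) S1.queries (fun _ _ _ h => h) ?_ ?_ ?_
  · exact ⟨fun v => by rw [hf1.mem 4]; exact hz v, fun v hv => by simpa using (hP1 v hv).1,
      fun v hv => by simpa using (hP1 v hv).2⟩
  · rintro x hx M c' hf h21 hxM hM ⟨i4, i5, i6⟩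
    have hxX := E.query _ (Q.getElem_mem hx)
    have S' := S1.of_frame hf
    have e := I.ask_queryNode Q hx 0
    have hA' : Alive (G := G) k X A c' := by intro u hu v; rw [hf.mem 9]; exact hA1 u hu v
    refine Run.seq (Run.ask (Run.seq ((bfs_spec hxX (E.bfsPre S'.setReg hA') ?_ ?_).conseq ?_)))
    · simp [h21, e]
    · simpa using i4
    rintro c2 T2 hf2 ⟨L2, hn2, hr2, hX2, h12, hL2, h4, hT2⟩
    refine (absorb_spec hn2 hX2 h12 hL2 (fun v hv => by rw [h4, if_neg hv])
      (fun v hv => ⟨E.vcell 4 (by simp) v hv, E.vcell 5 (by simp) v hv, E.vcell 6 (by simp) v hv⟩)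
      (E.icell 3 (by simp))).conseq ?_
    rintro c3 T3 hf3 ⟨j4, j5, j6, hT3⟩
    have hcw := card_le_weight I k X
    rw [← weight] at hT2
    refine ⟨⟨j4, fun v hv => ?_, fun v hv => ?_⟩, by simp; omega⟩
    · rw [j5, hf2.mem 5]
      simp only [Config.setReg_mem]
      rw [i5 v hv, Finset.filter_insert]
      have hiff : v ∈ L2 ∧ 1 < L2.length ↔ A.Reachable Q[x] v ∧ ∃ w, A.Adj Q[x] w := by
        rw [hr2, one_lt_length_iff hn2 hr2]
      by_cases hc : A.Reachable Q[x] v ∧ ∃ w, A.Adj Q[x] w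
      · rw [if_pos hc, if_pos (hiff.2 hc), Finset.card_insert_of_notMem (by simp [hxM])]
      · rw [if_neg hc, if_neg (mt hiff.1 hc), Nat.add_zero]
    · rw [j6, hf2.mem 6]
      simp only [Config.setReg_mem]
      rw [i6 v hv, h4, Finset.sup_insert, max_comm]
      simp only [hr2]
  · rintro c' T hf ⟨i4, i5, i6⟩ hT
    refine ⟨i4, i5, i6, ?_⟩
    have hcw := card_le_weight I k X
    have hq : 1 ≤ Q.length := List.length_pos_iff.2 E.nonempty
    have hXpos : 1 ≤ X.card := by
      obtain ⟨q, hq⟩ := List.exists_mem_of_ne_nil Q E.nonempty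
      exact Finset.card_pos.2 ⟨q, E.query q hq⟩
    simp only [Finset.sum_const, List.toFinset_card_of_nodup E.nodup, smul_eq_mul] at hT hT1
    generalize weight I k X = W at *
    have h1 : Q.length * (190 * W + 60 + 8) ≤ 258 * (Q.length * W) := by
      calc Q.length * (190 * W + 60 + 8) ≤ Q.length * (258 * W) :=
            Nat.mul_le_mul_left _ (by omega)
        _ = _ := by ring
    have h2 : W ≤ Q.length * W := Nat.le_mul_of_pos_left _ hq
    omega

theorem connectTest_spec {k X L} {c : Config} (E : Env I Q U k X) (S : Setup I Q k X L c) :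
    Run (I.ask Q) U connectTest c fun c' T =>
      c'.reg 5 = (if ∀ q ∈ Q, c.mem 5 q = Q.length then 1 else 0) ∧ T ≤ 40 * (Q.length + 1) := by
  refine Run.seq (Run.assign ?_)
  refine Run.forList E.nodup
    (fun M c' => c'.reg 5 = if ∀ q ∈ M, c.mem 5 q = Q.length then 1 else 0) (fun _ => 24)
    (by simp [S.queries]) (fun _ _ _ h => h) (by simp) ?_ ?_
  · intro x hx M c' hf h21 hxM hM hP
    have hxX := E.query _ (Q.getElem_mem hx)
    have e := I.ask_queryNode Q hx 0
    have e4 : c'.reg 4 = Q.length := by rw [hf.reg 4]; simpa using S.queries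
    have e5 : c'.mem 5 = c.mem 5 := hf.mem 5
    refine Run.seq (Run.ask (Run.seq (Run.load ?_ (Run.assign ⟨?_, by simp⟩))))
    · simpa [h21, e] using E.vcell 5 (by simp) _ hxX
    · simp only [Finset.mem_insert, forall_eq_or_imp]
      by_cases h1 : c.mem 5 Q[x] = Q.length <;> simp [h21, e, e4, e5, h1, hP]
  · intro c' T hf hP hT
    simp only [Finset.sum_const, List.toFinset_card_of_nodup E.nodup, smul_eq_mul] at hT
    refine ⟨by simpa using hP, by simp; omega⟩

/-- The ends of an edge are quotient and remainder of its address modulo `n`. -/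
theorem edgeAddr_inj {u v u' v' : Fin n} :
    (u * n + v : ℕ) = u' * n + v' ↔ u = u' ∧ v = v' := by
  constructor
  · intro h
    have hn : 0 < n := u.pos
    have h1 := congrArg (· / n) h
    have h2 := congrArg (· % n) h
    simp only [Nat.mul_comm _ n, Nat.mul_add_div hn, Nat.div_eq_of_lt v.2, Nat.div_eq_of_lt v'.2,
      Nat.mul_add_mod, Nat.mod_eq_of_lt v.2, Nat.mod_eq_of_lt v'.2] at h1 h2
    exact ⟨Fin.ext h1, Fin.ext h2⟩
  · rintro ⟨rfl, rfl⟩; rfl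

theorem TrussIndex.toFinset_nb (I : TrussIndex G) {k : ℕ} (hk : 1 ≤ k) (v : Fin n) :
    (I.nb k v).toFinset = Finset.univ.filter fun u => k ≤ edgeTrussness G v u := by
  ext u; simp [I.mem_nb hk]

/-- Components cut off from `Q` keep edges of status `0`. They are excluded from the recorded graph
by the test that the tail is reached by a query. -/
theorem record_spec {k X L} {c : Config} (E : Env I Q U k X) (S : Setup I Q k X L c) :
    Run (I.ask Q) U record c fun c' T =>
      (∀ v : Fin n, c'.mem 0 v = c.mem 0 v + if v ∈ X ∧ 0 < c.mem 5 v then 1 else 0) ∧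
      (∀ u v : Fin n, c'.mem 1 (u * n + v) = c.mem 1 (u * n + v) +
        if u ∈ X ∧ k ≤ edgeTrussness G u v ∧ c.mem 9 (u * n + v) = 0 ∧ 0 < c.mem 5 u
          then 1 else 0) ∧
      T ≤ 80 * weight I k X + 6 := by
  refine Run.forList S.nodup (fun M c' => 
      (∀ v : Fin n, c'.mem 0 v = c.mem 0 v + if v ∈ M ∧ 0 < c.mem 5 v then 1 else 0) ∧
      (∀ u v : Fin n, c'.mem 1 (u * n + v) = c.mem 1 (u * n + v) +
        if u ∈ M ∧ k ≤ edgeTrussness G u v ∧ c.mem 9 (u * n + v) = 0 ∧ 0 < c.mem 5 u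
          then 1 else 0)) (fun v => 60 * (I.nb k v).length + 50) S.count (fun _ _ _ h => h)
      (by simp) ?_ ?_
  · rintro x hx M c' hf h21 hxM hM ⟨i0, i1⟩
    have hxX := (S.mem_iff _).1 (L.getElem_mem hx)
    have S' := S.of_frame hf
    have e := S'.list x hx
    have e5 : c'.mem 5 = c.mem 5 := hf.mem 5
    have e8 := S'.degree _ hxX
    have e0 := i0 L[x]
    simp only [hxM, false_and, if_false] at e0
    refine Run.seq (Run.load ?_ (Run.seq (Run.load ?_ (Run.seq (Run.load ?_ (Run.seq (Run.store ?_
      (Run.seq (Run.load ?_ ?_)))))))))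
    · simpa [h21] using E.icell 7 (by simp) x (S.length ▸ hx)
    · simpa [h21, e] using E.vcell 5 (by simp) _ hxX
    · simpa [h21, e] using E.vcell 0 (by simp) _ hxX
    · simpa [h21, e] using E.vcell 0 (by simp) _ hxX
    · simpa [h21, e] using E.vcell 8 (by simp) _ hxX
    refine Run.forList (I.nb_nodup k L[x]) (fun M' c'' => 
      (∀ v : Fin n, c''.mem 0 v = c.mem 0 v + if v ∈ insert L[x] M ∧ 0 < c.mem 5 v then 1 else 0) ∧
      (∀ u v : Fin n, c''.mem 1 (u * n + v) = c.mem 1 (u * n + v) +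
        if (u ∈ M ∨ u = L[x] ∧ v ∈ M') ∧ k ≤ edgeTrussness G u v ∧ c.mem 9 (u * n + v) = 0 ∧ 0 < c.mem 5 u
          then 1 else 0)) (fun v => 50) (by simp [h21, e, e8]) (fun _ _ _ h => h) ?_ ?_ ?_
    · refine ⟨fun v => ?_, by simpa using i1⟩
      by_cases hv : v = L[x]
      · subst hv; simp [h21, e, e0, e5]
      · have : (v : ℕ) ≠ (L[x] : Fin n) := fun h => hv (Fin.ext h)
        simp [h21, e, hv, this, i0]
    · rintro y hy M' c'' hf' h14 hyM hM' ⟨j0, j1⟩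
      have hτ : k ≤ edgeTrussness G L[x] (I.nb k L[x])[y] := (I.mem_nb E.pos).1 (List.getElem_mem hy)
      have eask := I.ask_nb Q L[x] hy
      set w := (I.nb k L[x])[y]
      have e13 : c''.reg 13 = L[x] := by rw [hf'.reg 13]; simp [h21, e]
      have e3 : c''.reg 3 = n := by rw [hf'.reg 3]; simp [S'.size]
      have e15 : c''.reg 15 = c.mem 5 L[x] := by rw [hf'.reg 15]; simp [h21, e, e5]
      have e9 : c''.mem 9 = c.mem 9 := by rw [hf'.mem 9]; simp [hf.mem 9]
      have e1 := j1 L[x] w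
      simp only [hxM, hyM, and_false, or_false, false_and, if_false] at e1
      refine Run.seq (Run.ask (Run.seq (Run.load ?_ (Run.seq (Run.load ?_
        (Run.store ?_ ⟨⟨j0, fun u v => ?_⟩, by simp⟩))))))
      · simpa [e13, h14, eask, e3] using E.ecell 9 (by simp) _ hxX w hτ
      · simpa [e13, h14, eask, e3] using E.ecell 1 (by simp) _ hxX w hτ
      · simpa [e13, h14, eask, e3] using E.ecell 1 (by simp) _ hxX w hτ
      · by_cases huv : u = L[x] ∧ v = w
        · obtain ⟨rfl, rfl⟩ := huv
          by_cases h1 : c.mem 9 (L[x] * n + w) = 0 <;> by_cases h2 : 0 < c.mem 5 L[x] <;>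
            simp [e13, h14, eask, e3, e9, e15, e1, hτ, h1, h2]
        · have h1 : (u * n + v : ℕ) ≠ L[x] * n + w := fun h => huv (edgeAddr_inj.1 h)
          have h2 : (u = L[x] ∧ v ∈ insert w M') ↔ (u = L[x] ∧ v ∈ M') := by
            constructor
            · rintro ⟨rfl, h⟩
              exact ⟨rfl, (Finset.mem_insert.1 h).resolve_left fun h => huv ⟨rfl, h⟩⟩
            · rintro ⟨h, h'⟩; exact ⟨h, Finset.mem_insert_of_mem h'⟩
          simp only [h2]
          simpa [e13, h14, eask, e3, h1] using j1 u v
    · rintro c'' T hf' ⟨j0, j1⟩ hT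
      refine ⟨⟨j0, fun u v => ?_⟩, ?_⟩
      · rw [j1, I.toFinset_nb E.pos]
        congr 2
        simp only [Finset.mem_insert, Finset.mem_filter, Finset.mem_univ, true_and, eq_iff_iff]
        constructor
        · rintro ⟨h | ⟨h, -⟩, h'⟩
          · exact ⟨Or.inr h, h'⟩
          · exact ⟨Or.inl h, h'⟩
        · rintro ⟨h | h, h'⟩
          · subst h; exact ⟨Or.inr ⟨rfl, h'.1⟩, h'⟩
          · exact ⟨Or.inl h, h'⟩
      · simp only [Finset.sum_const, List.toFinset_card_of_nodup (I.nb_nodup k _), smul_eq_mul] at hT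
        simp; omega
  · rintro c' T hf ⟨i0, i1⟩ hT
    rw [S.toFinset] at i0 i1 hT
    refine ⟨i0, i1, hT.trans ?_⟩
    rw [weight, Finset.mul_sum]
    gcongr
    omega

/-- The condition on the round number makes cell `l` of array `2` one of those provided for. The
truncated `- 1` undoes the shift of the labels. -/
theorem measure_spec {k X L} {c : Config} (E : Env I Q U k X) (S : Setup I Q k X L c)
    (hl : c.reg 1 < X.card) {g : ℕ}
    (hg : g = (X.filter fun v => 0 < c.mem 5 (v : Fin n)).sup (fun v => c.mem 6 v) - 1) :
    Run (I.ask Q) U measure c fun c' T =>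
      (∀ i, c'.mem 2 i = if i = c.reg 1 then g else c.mem 2 i) ∧
      c'.reg 6 = min (c.reg 6) g ∧ c'.reg 2 = (if g < c.reg 6 then c.reg 1 else c.reg 2) ∧
      T ≤ 80 * weight I k X + 40 := by
  refine Run.seq (Run.assign (Run.seq ?_))
  refine Run.forList S.nodup (fun M c' => c'.reg 30 =
      (M.filter fun v : Fin n => 0 < c.mem 5 v).sup (fun v => c.mem 6 v)) (fun _ => 50)
      (by simp [S.count]) (fun _ _ _ h => h) (by simp) ?_ ?_
  · intro x hx M c' hf h21 hxM hM hP
    have hxX := (S.mem_iff _).1 (L.getElem_mem hx)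
    have e : c'.mem 7 x = (L[x] : Fin n) := by rw [hf.mem 7]; exact S.list x hx
    have e5 : c'.mem 5 = c.mem 5 := hf.mem 5
    have e6 : c'.mem 6 = c.mem 6 := hf.mem 6
    refine Run.seq (Run.load ?_ (Run.seq (Run.load ?_ (Run.seq (Run.load ?_ (Run.ite ?_ ?_))))))
    · simpa [h21] using E.icell 7 (by simp) x (S.length ▸ hx)
    · simpa [h21, e] using E.vcell 5 (by simp) _ hxX
    · simpa [h21, e] using E.vcell 6 (by simp) _ hxX
    · intro hne
      have h1 : c'.reg 30 < c.mem 6 L[x] ∧ 0 < c.mem 5 L[x] := by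
        simpa [Nat.pos_iff_ne_zero, h21, e, e5, e6] using hne
      refine Run.assign ⟨?_, by simp⟩
      rw [Finset.filter_insert, if_pos h1.2, Finset.sup_insert, ← hP]
      simp [h21, e, e6, h1.1.le]
    · intro heq
      have h1 : c'.reg 30 < c.mem 6 L[x] → c.mem 5 L[x] = 0 := by
        simpa [h21, e, e5, e6] using heq
      refine Run.assign ⟨?_, by simp⟩
      rw [Finset.filter_insert]
      split
      case isTrue h =>
        have : c.mem 6 L[x] ≤ c'.reg 30 := by
          by_contra h'
          have := h1 (by omega)
          omega
        rw [Finset.sup_insert, ← hP]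
        simp [this]
      case isFalse h => simpa using hP
  · intro c' T hf hP hT
    rw [S.toFinset] at hP hT
    have e1 : c'.reg 1 = c.reg 1 := by rw [hf.reg 1]; simp
    have e2 : c'.reg 2 = c.reg 2 := by rw [hf.reg 2]; simp
    have e6 : c'.reg 6 = c.reg 6 := by rw [hf.reg 6]; simp
    have m2 : c'.mem 2 = c.mem 2 := by rw [hf.mem 2]; simp
    have hcw := card_le_weight I k X
    simp only [Finset.sum_const, smul_eq_mul] at hT
    refine Run.seq (Run.assign (Run.seq (Run.store ?_ (Run.ite ?_ ?_))))
    · simpa [e1] using E.icell 2 (by simp) _ hl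
    · intro hne
      have hlt : g < c.reg 6 := by simpa [hP, ← hg, e6] using hne
      refine Run.seq (Run.assign (Run.assign ⟨fun i => ?_, ?_, ?_, ?_⟩))
      · simp [hP, ← hg, e1, m2, Function.update_apply]
      · simp [hP, ← hg, hlt.le]
      · simp [e1, hlt]
      · simp; omega
    · intro hne
      have hlt : c.reg 6 ≤ g := by simpa [hP, ← hg, e6] using hne
      refine Run.assign ⟨fun i => ?_, ?_, ?_, ?_⟩
      · simp [hP, ← hg, e1, m2, Function.update_apply]
      · simp [e6, hlt]
      · simp [e2, hlt]
      · simp; omega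

end TrussSearch

namespace TrussSearch

/-! ### Counting triangles while edges are removed -/

section Triangles

variable {V : Type*} [Finite V] {N K A : SimpleGraph V}

/-- Every edge is in at least `k - 2` triangles. -/
def GTruss (K : SimpleGraph V) (k : ℕ) : Prop :=
  ∀ u v, K.Adj u v → k ≤ {c | K.Adj u c ∧ K.Adj v c}.ncard + 2

/-- The number of triangles at `xy`, where the triangles on the edge `ab` with third vertex in `S`
are not counted. -/
noncomputable def triCount (N : SimpleGraph V) (a b : V) (S : Set V) (x y : V) : ℕ :=
  {c | N.Adj x c ∧ N.Adj y c ∧ ¬ (s(x, c) = s(a, b) ∧ y ∈ S) ∧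
    ¬ (s(y, c) = s(a, b) ∧ x ∈ S)}.ncard

omit [Finite V] in
theorem triCount_empty (N : SimpleGraph V) (a b x y : V) :
    triCount N a b ∅ x y = {c | N.Adj x c ∧ N.Adj y c}.ncard := by
  simp [triCount]

omit [Finite V] in
-- If one of the other sides of a triangle on `xy` is `ab`, then the third vertex of this triangle
-- relative to `ab` is adjacent to `a`, hence in `S`. So at the end of the scan the counts are those
-- of the graph without `ab`.
theorem triCount_full {a b : V} {S : Set V} (hS : ∀ w, N.Adj a w → w ∈ S) {x y : V}
    (hxy : N.Adj x y) :
    triCount N a b S x y =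
      {c | (N.deleteEdges {s(a, b)}).Adj x c ∧ (N.deleteEdges {s(a, b)}).Adj y c}.ncard := by
  unfold triCount
  congr 1
  ext c
  simp only [SimpleGraph.deleteEdges_adj, Set.mem_singleton_iff, Set.mem_ofPred_eq]
  constructor
  · rintro ⟨h1, h2, h3, h4⟩
    refine ⟨⟨h1, fun h => h3 ⟨h, hS _ ?_⟩⟩, ⟨h2, fun h => h4 ⟨h, hS _ ?_⟩⟩⟩
    · rcases Sym2.eq_iff.1 h with ⟨rfl, rfl⟩ | ⟨rfl, rfl⟩
      · exact hxy
      · exact h2.symm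
    · rcases Sym2.eq_iff.1 h with ⟨rfl, rfl⟩ | ⟨rfl, rfl⟩
      · exact hxy.symm
      · exact h1.symm
  · rintro ⟨⟨h1, h3⟩, ⟨h2, h4⟩⟩
    exact ⟨h1, h2, fun h => h3 h.1, fun h => h4 h.1⟩

/-- Counts taken during the scan are at least the final ones. Hence an edge that falls below the
threshold halfway is bound to fall below it. -/
theorem le_triCount (a b : V) (S : Set V) (x y : V) :
    {c | (N.deleteEdges {s(a, b)}).Adj x c ∧ (N.deleteEdges {s(a, b)}).Adj y c}.ncard ≤
      triCount N a b S x y := by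
  refine Set.ncard_le_ncard ?_ (Set.toFinite _)
  rintro c ⟨h1, h2⟩
  simp only [SimpleGraph.deleteEdges_adj, Set.mem_singleton_iff] at h1 h2
  exact ⟨h1.1, h2.1, fun h => h1.2 h.1, fun h => h2.2 h.1⟩

omit [Finite V] in
-- Without a triangle `abw` there is nothing to discount at `w`.
theorem triCount_insert_of_not {a b w : V} {S : Set V} (h : ¬ (N.Adj a w ∧ N.Adj b w)) {x y : V}
    (hxy : N.Adj x y) : triCount N a b (insert w S) x y = triCount N a b S x y := by
  unfold triCount
  congr 1
  ext c
  simp only [Set.mem_ofPred_eq, Set.mem_insert_iff]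
  constructor
  · rintro ⟨h1, h2, h3, h4⟩
    exact ⟨h1, h2, fun h => h3 ⟨h.1, Or.inr h.2⟩, fun h => h4 ⟨h.1, Or.inr h.2⟩⟩
  · rintro ⟨h1, h2, h3, h4⟩
    refine ⟨h1, h2, ?_, ?_⟩
    · rintro ⟨h5, rfl | h6⟩
      · rcases Sym2.eq_iff.1 h5 with ⟨rfl, rfl⟩ | ⟨rfl, rfl⟩
        · exact h ⟨hxy, h2.symm⟩
        · exact h ⟨h2.symm, hxy⟩
      · exact h3 ⟨h5, h6⟩
    · rintro ⟨h5, rfl | h6⟩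
      · rcases Sym2.eq_iff.1 h5 with ⟨rfl, rfl⟩ | ⟨rfl, rfl⟩
        · exact h ⟨hxy.symm, h1.symm⟩
        · exact h ⟨h1.symm, hxy.symm⟩
      · exact h4 ⟨h5, h6⟩

omit [Finite V] in
theorem triCount_comm (a b : V) (S : Set V) (x y : V) :
    triCount N a b S x y = triCount N a b S y x := by
  unfold triCount
  congr 1
  ext c
  simp only [Set.mem_ofPred_eq]
  tauto

omit [Finite V] in
theorem triCount_swap (a b : V) (S : Set V) (x y : V) :
    triCount N a b S x y = triCount N b a S x y := by
  unfold triCount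
  rw [Sym2.eq_swap]

/-- Discounting the triangle `abw` removes exactly the third vertex `b` from the count at `aw`. -/
theorem triCount_insert {a b w : V} {S : Set V} (ha : N.Adj a w) (hb : N.Adj b w) (hab : N.Adj a b)
    (hw : w ∉ S) : triCount N a b (insert w S) a w + 1 = triCount N a b S a w := by
  have haw := ha.ne
  have hbw := hb.ne
  have hmem : b ∈ {c | N.Adj a c ∧ N.Adj w c ∧ ¬ (s(a, c) = s(a, b) ∧ w ∈ S) ∧
      ¬ (s(w, c) = s(a, b) ∧ a ∈ S)} := by
    refine ⟨hab, hb.symm, fun h => hw h.2, fun h => ?_⟩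
    rcases Sym2.eq_iff.1 h.1 with ⟨h, -⟩ | ⟨h, -⟩
    · exact haw h.symm
    · exact hbw h.symm
  rw [triCount, triCount, ← Set.ncard_sdiff_singleton_add_one hmem (Set.toFinite _)]
  congr 2
  ext c
  simp only [Set.mem_ofPred_eq, Set.mem_insert_iff, Set.mem_sdiff, Set.mem_singleton_iff, true_or,
    and_true, haw, false_or]
  constructor
  · rintro ⟨h1, h2, h3, h4⟩
    exact ⟨⟨h1, h2, fun h => hw h.2, h4⟩, fun h => h3 (by rw [h])⟩
  · rintro ⟨⟨h1, h2, h3, h4⟩, h5⟩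
    refine ⟨h1, h2, fun h => h5 ?_, h4⟩
    rcases Sym2.eq_iff.1 h with ⟨-, h⟩ | ⟨h, -⟩
    · exact h
    · exact absurd h hab.ne

omit [Finite V] in
theorem triCount_insert_of_ne {a b w : V} {S : Set V} {x y : V}
    (h1 : ¬ (x = w ∧ (y = a ∨ y = b))) (h2 : ¬ (y = w ∧ (x = a ∨ x = b))) :
    triCount N a b (insert w S) x y = triCount N a b S x y := by
  unfold triCount
  congr 1
  ext c
  simp only [Set.mem_ofPred_eq, Set.mem_insert_iff]
  constructor
  · rintro ⟨h1, h2, h3, h4⟩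
    exact ⟨h1, h2, fun h => h3 ⟨h.1, Or.inr h.2⟩, fun h => h4 ⟨h.1, Or.inr h.2⟩⟩
  · rintro ⟨h3, h4, h5, h6⟩
    refine ⟨h3, h4, ?_, ?_⟩
    · rintro ⟨h7, rfl | h8⟩
      · refine h2 ⟨rfl, ?_⟩
        rcases Sym2.eq_iff.1 h7 with ⟨h, -⟩ | ⟨h, -⟩
        · exact Or.inl h
        · exact Or.inr h
      · exact h5 ⟨h7, h8⟩
    · rintro ⟨h7, rfl | h8⟩
      · refine h1 ⟨rfl, ?_⟩
        rcases Sym2.eq_iff.1 h7 with ⟨h, -⟩ | ⟨h, -⟩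
        · exact Or.inl h
        · exact Or.inr h
      · exact h6 ⟨h7, h8⟩

/-- A truss in `A` avoids edges with too few triangles in a larger graph. -/
theorem GTruss.not_adj {k : ℕ} (hK : GTruss K k) (hKN : K ≤ N) {u v : V}
    (h : {c | N.Adj u c ∧ N.Adj v c}.ncard + 2 < k) : ¬ K.Adj u v := by
  intro huv
  have h1 := hK u v huv
  have h2 : {c | K.Adj u c ∧ K.Adj v c}.ncard ≤ {c | N.Adj u c ∧ N.Adj v c}.ncard :=
    Set.ncard_le_ncard (fun c hc => ⟨hKN hc.1, hKN hc.2⟩) (Set.toFinite _)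
  omega

end Triangles

end TrussSearch

namespace TrussSearch

/-! ### Restoring the truss property -/

variable {n : ℕ} {G : SimpleGraph (Fin n)} {I : TrussIndex G} {Q : List (Fin n)} {U : Set (ℕ × ℕ)}

theorem edgeTrussness_comm (u v : Fin n) : edgeTrussness G u v = edgeTrussness G v u := by
  simp only [edgeTrussness, SimpleGraph.Subgraph.adj_comm]

/-- The initial graph. -/
def baseGraph (G : SimpleGraph (Fin n)) (k : ℕ) (hk : 1 ≤ k) (X : Finset (Fin n)) :
    SimpleGraph (Fin n) where
  Adj u v := u ∈ X ∧ v ∈ X ∧ k ≤ edgeTrussness G u v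
  symm := ⟨fun u v h => ⟨h.2.1, h.1, by rw [edgeTrussness_comm]; exact h.2.2⟩⟩
  loopless := ⟨fun v h => (adj_of_le_edgeTrussness hk h.2.2).ne rfl⟩

/-- The deletion queue: `A` are the edges of status `0`, `N` those of status less than `2`, and the
list `W` of the edges of status `1` is waiting. -/
structure QueueState (k : ℕ) (X : Finset (Fin n)) (B N A : SimpleGraph (Fin n))
    (W : List (Fin n × Fin n)) (c : Config) : Prop where
  le : A ≤ N
  le_base : N ≤ B
  alive : Alive (G := G) k X A c
  present : ∀ u ∈ X, ∀ v, N.Adj u v ↔ k ≤ edgeTrussness G u v ∧ c.mem 9 (u * n + v) < 2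
  tail : c.reg 9 + A.edgeSet.ncard = B.edgeSet.ncard
  head : c.reg 8 + W.length = c.reg 9
  queue : ∀ i (h : i < W.length), c.mem 11 (c.reg 8 + i) = (W[i].1 : ℕ) ∧
    c.mem 12 (c.reg 8 + i) = (W[i].2 : ℕ)
  nodup : (W.map fun p => s(p.1, p.2)).Nodup
  mem : ∀ u v, s(u, v) ∈ (W.map fun p => s(p.1, p.2)) ↔ N.Adj u v ∧ ¬ A.Adj u v

theorem QueueState.of_eq {k X B N A W} {c c' : Config}
    (H : QueueState (G := G) k X B N A W c) (h8 : c'.reg 8 = c.reg 8) (h9 : c'.reg 9 = c.reg 9)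
    (m9 : c'.mem 9 = c.mem 9) (m11 : c'.mem 11 = c.mem 11) (m12 : c'.mem 12 = c.mem 12) :
    QueueState (G := G) k X B N A W c' where
  le := H.le
  le_base := H.le_base
  alive := fun u hu v => by rw [m9]; exact H.alive u hu v
  present := fun u hu v => by rw [m9]; exact H.present u hu v
  tail := by rw [h9]; exact H.tail
  head := by rw [h8, h9]; exact H.head
  queue := by rw [h8, m11, m12]; exact H.queue
  nodup := H.nodup
  mem := H.mem

/-- The handshake lemma; it turns the bound on queue positions in `Env.qcell` into a bound by the
number of edges. -/
theorem sum_nb_eq (hk : 1 ≤ k) (X : Finset (Fin n))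
    (hX : ∀ u ∈ X, ∀ v, k ≤ edgeTrussness G u v → v ∈ X) :
    ∑ v ∈ X, (I.nb k v).length = 2 * (baseGraph G k hk X).edgeSet.ncard := by
  classical
  have h := (baseGraph G k hk X).sum_degrees_eq_twice_card_edges
  rw [← SimpleGraph.coe_edgeFinset, Set.ncard_coe_finset, ← h]
  symm
  rw [← Finset.sum_subset (Finset.subset_univ X)]
  · refine Finset.sum_congr rfl fun v hv => ?_
    rw [← List.toFinset_card_of_nodup (I.nb_nodup k v), I.toFinset_nb hk,
      ← SimpleGraph.card_neighborFinset_eq_degree]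
    congr 1
    ext u
    simp only [SimpleGraph.mem_neighborFinset, Finset.mem_filter, Finset.mem_univ, true_and]
    exact ⟨fun h => h.2.2, fun h => ⟨hv, hX v hv u h, h⟩⟩
  · intro v _ hv
    rw [← SimpleGraph.card_neighborFinset_eq_degree, Finset.card_eq_zero]
    ext u
    simp only [SimpleGraph.mem_neighborFinset, Finset.notMem_empty, iff_false]
    exact fun h => hv h.1

theorem edgeSet_ncard_deleteEdge {A : SimpleGraph (Fin n)} {a b : Fin n} (h : A.Adj a b) :
    (A.deleteEdges {s(a, b)}).edgeSet.ncard + 1 = A.edgeSet.ncard := by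
  rw [SimpleGraph.edgeSet_deleteEdges]
  exact Set.ncard_sdiff_singleton_add_one h (Set.toFinite _)

theorem ne_or_swap_of_not_eq {u v a b : Fin n} (h : ¬ s(u, v) = s(a, b)) :
    (u * n + v : ℕ) ≠ a * n + b ∧ (u * n + v : ℕ) ≠ b * n + a := by
  constructor
  · intro h'
    obtain ⟨rfl, rfl⟩ := edgeAddr_inj.1 h'
    exact h rfl
  · intro h'
    obtain ⟨rfl, rfl⟩ := edgeAddr_inj.1 h'
    exact h Sym2.eq_swap

/-- The queue is never reset, and an edge leaves `A` when it is queued. So the tail of the queue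
counts the edges of `G₀` missing from `A`, and since `ab` still belongs to `A`, this number is less
than the number of edges of `G₀`. -/
theorem push_spec {k X hk N A W} {c : Config} {ra rb : ℕ} {a b : Fin n} (E : Env I Q U k X)
    (h3 : c.reg 3 = n) (ha : c.reg ra = a) (hb : c.reg rb = b)
    (H : QueueState (G := G) k X (baseGraph G k hk X) N A W c) (hab : A.Adj a b) :
    Run (I.ask Q) U (push ra rb) c fun c' T =>
      QueueState (G := G) k X (baseGraph G k hk X) N (A.deleteEdges {s(a, b)}) (W ++ [(a, b)]) c' ∧
      (∀ u v : Fin n, s(u, v) ≠ s(a, b) → c'.mem 9 (u * n + v) = c.mem 9 (u * n + v)) ∧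
      T ≤ 40 := by
  have hB := H.le_base (H.le hab)
  have hcard := edgeSet_ncard_deleteEdge hab
  have htail := H.tail
  have hq : 2 * c.reg 9 < ∑ v ∈ X, (I.nb k v).length := by
    rw [sum_nb_eq hk X E.closed]; omega
  have hnew : ∀ u v : Fin n, s(u, v) = s(a, b) →
      Function.update (Function.update (c.mem 9) (a * n + b) 1) (b * n + a) 1 (u * n + v) = 1 := by
    intro u v h
    rcases Sym2.eq_iff.1 h with ⟨rfl, rfl⟩ | ⟨rfl, rfl⟩ <;> simp [Function.update_apply]
  have hold : ∀ u v : Fin n, s(u, v) ≠ s(a, b) →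
      Function.update (Function.update (c.mem 9) (a * n + b) 1) (b * n + a) 1 (u * n + v) =
        c.mem 9 (u * n + v) := by
    intro u v h
    obtain ⟨h1, h2⟩ := ne_or_swap_of_not_eq h
    simp [h1, h2]
  have htr : ∀ u v : Fin n, s(u, v) = s(a, b) → k ≤ edgeTrussness G u v := by
    intro u v h
    rcases Sym2.eq_iff.1 h with ⟨rfl, rfl⟩ | ⟨rfl, rfl⟩
    · exact hB.2.2
    · rw [edgeTrussness_comm]; exact hB.2.2
  refine Run.seq (Run.store ?_ (Run.seq (Run.store ?_ (Run.seq (Run.store ?_ (Run.seq (Run.store ?_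
    (Run.assign ⟨?_, ?_, ?_⟩))))))))
  · simpa [ha, hb, h3] using E.ecell 9 (by simp) a hB.1 b hB.2.2
  · simpa [ha, hb, h3] using E.ecell 9 (by simp) b hB.2.1 a (edgeTrussness_comm a b ▸ hB.2.2)
  · simpa using E.qcell 11 (by simp) _ hq
  · simpa using E.qcell 12 (by simp) _ hq
  · have hN : N.Adj a b := H.le hab
    refine ⟨(SimpleGraph.deleteEdges_le _).trans H.le, H.le_base, fun u hu v => ?_,
      fun u hu v => ?_, ?_, ?_, fun i hi => ?_, ?_, fun u v => ?_⟩
    · simp only [SimpleGraph.deleteEdges_adj, Set.mem_singleton_iff]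
      by_cases h : s(u, v) = s(a, b)
      · simp [ha, hb, h3, h, hnew u v h]
      · simp [ha, hb, h3, h, hold u v h]
        simpa using H.alive u hu v
    · by_cases h : s(u, v) = s(a, b)
      · have hNuv : N.Adj u v := by
          rcases Sym2.eq_iff.1 h with ⟨rfl, rfl⟩ | ⟨rfl, rfl⟩
          · exact hN
          · exact hN.symm
        simp [ha, hb, h3, hnew u v h, hNuv, htr u v h]
      · simp [ha, hb, h3, hold u v h]
        simpa using H.present u hu v
    · simp [-SimpleGraph.edgeSet_deleteEdges]; omega
    · have := H.head
      simp; omega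
    · have hhead := H.head
      simp only [List.length_append, List.length_singleton] at hi
      rcases Nat.lt_succ_iff_lt_or_eq.1 hi with h' | rfl
      · rw [List.getElem_append_left h']
        have hne : c.reg 8 + i ≠ c.reg 9 := by omega
        simpa [hne, ha, hb] using H.queue i h'
      · simp [hhead, ha, hb]
    · rw [List.map_append, List.nodup_append]
      refine ⟨H.nodup, by simp, fun x hx y hy hxy => ?_⟩
      simp only [List.map_cons, List.map_nil, List.mem_singleton] at hy
      rw [hxy, hy] at hx
      exact ((H.mem a b).1 hx).2 hab
    · rw [List.map_append, List.mem_append, H.mem]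
      simp only [List.map_cons, List.map_nil, List.mem_singleton, SimpleGraph.deleteEdges_adj,
        Set.mem_singleton_iff]
      by_cases h : s(u, v) = s(a, b)
      · have hNuv : N.Adj u v := by
          rcases Sym2.eq_iff.1 h with ⟨rfl, rfl⟩ | ⟨rfl, rfl⟩
          · exact hN
          · exact hN.symm
        simp [h, hNuv]
      · simp [h]
  · intro u v h
    simp [ha, hb, h3, hold u v h]
  · simp

/-- Deleting a vertex means queueing its alive edges. The graph for which triangles are counted
remains `A` meanwhile; it shrinks only when the queue is processed. -/
theorem removeFar_spec {k X hk L A} {c : Config} (E : Env I Q U k X) (S : Setup I Q k X L c)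
    (H : QueueState (G := G) k X (baseGraph G k hk X) A A [] c) :
    Run (I.ask Q) U removeFar c fun c' T => ∃ (A' : SimpleGraph (Fin n)) (W : _),
      QueueState (G := G) k X (baseGraph G k hk X) A A' W c' ∧
      (∀ u v, A'.Adj u v ↔ A.Adj u v ∧ ¬ (0 < c.mem 5 u ∧ c.reg 6 ≤ c.mem 6 u) ∧
        ¬ (0 < c.mem 5 v ∧ c.reg 6 ≤ c.mem 6 v)) ∧
      T ≤ 120 * weight I k X + 10 := by
  set F : Fin n → Prop := fun u => 0 < c.mem 5 u ∧ c.reg 6 ≤ c.mem 6 u with hF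
  refine Run.forList S.nodup (fun M c' => ∃ (A' : SimpleGraph (Fin n)) (W : _),
      QueueState (G := G) k X (baseGraph G k hk X) A A' W c' ∧
      (∀ u v, A'.Adj u v ↔ A.Adj u v ∧ ¬ (u ∈ M ∧ F u) ∧ ¬ (v ∈ M ∧ F v)))
    (fun v => 90 * (I.nb k v).length + 70) S.count ?_ ?_ ?_ ?_
  · rintro M c' x ⟨A', W, hq, h⟩
    exact ⟨A', W, hq.of_eq (by simp) (by simp) (by simp) (by simp) (by simp), h⟩
  · exact ⟨A, [], H, by simp⟩
  · rintro x hx M c' hf h21 hxM hM ⟨A', W, hq, hadj⟩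
    have hxX := (S.mem_iff _).1 (L.getElem_mem hx)
    have S' := S.of_frame hf
    have e := S'.list x hx
    have e5 : c'.mem 5 = c.mem 5 := hf.mem 5
    have e6 : c'.mem 6 = c.mem 6 := hf.mem 6
    have r6 : c'.reg 6 = c.reg 6 := hf.reg 6
    have e8 := S'.degree _ hxX
    refine Run.seq (Run.load ?_ (Run.seq (Run.load ?_ (Run.seq (Run.load ?_ (Run.ite ?_ ?_))))))
    · simpa [h21] using E.icell 7 (by simp) x (S.length ▸ hx)
    · simpa [h21, e] using E.vcell 5 (by simp) _ hxX
    · simpa [h21, e] using E.vcell 6 (by simp) _ hxX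
    · intro hne
      have hFx : F L[x] := by
        have : 0 < c.mem 5 L[x] ∧ c.reg 6 ≤ c.mem 6 L[x] := by
          simpa [Nat.pos_iff_ne_zero, h21, e, e5, e6, r6, Nat.sub_eq_zero_iff_le] using hne
        exact this
      refine Run.seq (Run.load (by simpa [h21, e] using E.vcell 8 (by simp) _ hxX) ?_)
      refine Run.forList (I.nb_nodup k L[x]) (fun M' c' => ∃ (A' : SimpleGraph (Fin n)) (W : _),
          QueueState (G := G) k X (baseGraph G k hk X) A A' W c' ∧
          (∀ u v, A'.Adj u v ↔ A.Adj u v ∧ ¬ (u ∈ M ∧ F u) ∧ ¬ (v ∈ M ∧ F v) ∧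
            ¬ (u = L[x] ∧ v ∈ M') ∧ ¬ (v = L[x] ∧ u ∈ M')))
        (fun v => 75) (by simp [h21, e, e8]) ?_ ?_ ?_ ?_
      · rintro M c' x ⟨A', W, hq, h⟩
        exact ⟨A', W, hq.of_eq (by simp) (by simp) (by simp) (by simp) (by simp), h⟩
      · exact ⟨A', W, hq.of_eq (by simp) (by simp) (by simp) (by simp) (by simp),
          by simpa using hadj⟩
      · rintro y hy M' c'' hf' h14 hyM hM' ⟨A'', W', hq', hadj'⟩
        have hτ : k ≤ edgeTrussness G L[x] (I.nb k L[x])[y] :=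
          (I.mem_nb E.pos).1 (List.getElem_mem hy)
        have eask := I.ask_nb Q L[x] hy
        set w := (I.nb k L[x])[y]
        have e13 : c''.reg 13 = L[x] := by rw [hf'.reg 13]; simp [h21, e]
        have e3 : c''.reg 3 = n := by rw [hf'.reg 3]; simp [S'.size]
        have hst := hq'.alive _ hxX w
        have hwX := E.closed _ hxX _ hτ
        refine Run.seq (Run.ask (Run.seq (Run.load ?_ (Run.ite ?_ ?_))))
        · simpa [e13, h14, eask, e3] using E.ecell 9 (by simp) _ hxX w hτ
        · intro hne
          have h9 : c''.mem 9 (L[x] * n + w) = 0 := by simpa [e13, h14, eask, e3] using hne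
          have hA : A''.Adj L[x] w := hst.2 ⟨hτ, h9⟩
          refine (push_spec (N := A) (A := A'') (W := W') (a := L[x]) (b := w) E ?_ ?_ ?_
            (hq'.of_eq (by simp) (by simp) (by simp) (by simp) (by simp)) hA).conseq ?_
          · simp [e3]
          · simp [e13]
          · simp [e13, h14, eask]
          rintro c3 T3 hf3 ⟨hq3, -, hT3⟩
          refine ⟨⟨_, _, hq3, fun u v => ?_⟩, by simp; omega⟩
          simp only [SimpleGraph.deleteEdges_adj, Set.mem_singleton_iff, hadj', Sym2.eq_iff,
            Finset.mem_insert]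
          constructor
          · rintro ⟨⟨h1, h2, h3, h4, h5⟩, h6⟩
            exact ⟨h1, h2, h3, fun h => h.2.elim (fun b => h6 (Or.inl ⟨h.1, b⟩))
              fun b => h4 ⟨h.1, b⟩, fun h => h.2.elim (fun b => h6 (Or.inr ⟨b, h.1⟩))
              fun b => h5 ⟨h.1, b⟩⟩
          · rintro ⟨h1, h2, h3, h4, h5⟩
            exact ⟨⟨h1, h2, h3, fun h => h4 ⟨h.1, Or.inr h.2⟩, fun h => h5 ⟨h.1, Or.inr h.2⟩⟩,
              fun h => h.elim (fun h => h4 ⟨h.1, Or.inl h.2⟩) fun h => h5 ⟨h.2, Or.inl h.1⟩⟩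
        · intro heq
          have h9 : c''.mem 9 (L[x] * n + w) ≠ 0 := by simpa [e13, h14, eask, e3] using heq
          have hA : ¬ A''.Adj L[x] w := fun h => h9 (hst.1 h).2
          refine Run.assign ⟨⟨A'', W', hq'.of_eq (by simp) (by simp) (by simp) (by simp) (by simp),
            fun u v => ?_⟩, by simp⟩
          have h1 : ¬ (u = L[x] ∧ v = w ∧ A''.Adj u v) := by rintro ⟨rfl, rfl, h⟩; exact hA h
          have h2 : ¬ (v = L[x] ∧ u = w ∧ A''.Adj u v) := by
            rintro ⟨rfl, rfl, h⟩; exact hA h.symm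
          rw [hadj'] at h1 h2 ⊢
          simp only [Finset.mem_insert]
          constructor
          · rintro ⟨h3, h4, h5, h6, h7⟩
            exact ⟨h3, h4, h5, fun h => h.2.elim (fun b => h1 ⟨h.1, b, h3, h4, h5, h6, h7⟩)
              fun b => h6 ⟨h.1, b⟩, fun h => h.2.elim (fun b => h2 ⟨h.1, b, h3, h4, h5, h6, h7⟩)
              fun b => h7 ⟨h.1, b⟩⟩
          · rintro ⟨h3, h4, h5, h6, h7⟩
            exact ⟨h3, h4, h5, fun h => h6 ⟨h.1, Or.inr h.2⟩, fun h => h7 ⟨h.1, Or.inr h.2⟩⟩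
      · rintro c'' T hf' ⟨A'', W', hq', hadj'⟩ hT
        simp only [Finset.sum_const, List.toFinset_card_of_nodup (I.nb_nodup k _), smul_eq_mul] at hT
        refine ⟨⟨A'', W', hq', fun u v => ?_⟩, by simp; omega⟩
        rw [hadj', I.toFinset_nb E.pos]
        simp only [Finset.mem_filter, Finset.mem_univ, true_and, Finset.mem_insert]
        constructor
        · rintro ⟨h1, h2, h3, h4, h5⟩
          have hB := H.le_base h1
          refine ⟨h1, ?_, ?_⟩
          · rintro ⟨rfl | h, h'⟩
            · exact h4 ⟨rfl, hB.2.2⟩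
            · exact h2 ⟨h, h'⟩
          · rintro ⟨rfl | h, h'⟩
            · exact h5 ⟨rfl, edgeTrussness_comm u _ ▸ hB.2.2⟩
            · exact h3 ⟨h, h'⟩
        · rintro ⟨h1, h2, h3⟩
          refine ⟨h1, fun h => h2 ⟨Or.inr h.1, h.2⟩, fun h => h3 ⟨Or.inr h.1, h.2⟩, ?_, ?_⟩
          · rintro ⟨rfl, h⟩; exact h2 ⟨Or.inl rfl, hFx⟩
          · rintro ⟨rfl, h⟩; exact h3 ⟨Or.inl rfl, hFx⟩
    · intro heq
      have hFx : ¬ F L[x] := by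
        rintro ⟨h1, h2⟩
        simp [h21, e, e5, e6, r6, Nat.not_lt.2 h2, h1] at heq
      refine Run.assign ⟨⟨A', W, hq.of_eq (by simp) (by simp) (by simp) (by simp) (by simp),
        fun u v => ?_⟩, by simp⟩
      rw [hadj]
      simp only [Finset.mem_insert]
      constructor
      · rintro ⟨h1, h2, h3⟩
        refine ⟨h1, ?_, ?_⟩
        · rintro ⟨rfl | h, h'⟩
          · exact hFx h'
          · exact h2 ⟨h, h'⟩
        · rintro ⟨rfl | h, h'⟩
          · exact hFx h'
          · exact h3 ⟨h, h'⟩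
      · rintro ⟨h1, h2, h3⟩
        exact ⟨h1, fun h => h2 ⟨Or.inr h.1, h.2⟩, fun h => h3 ⟨Or.inr h.1, h.2⟩⟩
  · rintro c' T hf ⟨A', W, hq, hadj⟩ hT
    rw [S.toFinset] at hadj hT
    refine ⟨A', W, hq, fun u v => ?_, ?_⟩
    · rw [hadj]
      constructor
      · rintro ⟨h1, h2, h3⟩
        have hB := H.le_base h1
        exact ⟨h1, fun h => h2 ⟨hB.1, h⟩, fun h => h3 ⟨hB.2.1, h⟩⟩
      · rintro ⟨h1, h2, h3⟩
        exact ⟨h1, fun h => h2 h.2, fun h => h3 h.2⟩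
    · have : ∑ v ∈ X, (90 * (I.nb k v).length + 70 + 8) ≤ 120 * weight I k X := by
        rw [weight, Finset.mul_sum]
        gcongr
        omega
      omega

end TrussSearch

/-! ### Propagation of edge deletions through triangles -/

namespace TrussSearch

variable {n : ℕ} {G : SimpleGraph (Fin n)} {I : TrussIndex G} {Q : List (Fin n)} {U : Set (ℕ × ℕ)}

/-- The graph `S` is a reference fixed during the whole peeling: all trusses inside it have to
survive. Queueing `ab` is safe because, by `hlow`, a count below `k` rules out a truss through `ab`.
-/
theorem decrease_spec {k X hk N A W} {c : Config} {ra rb rs : ℕ} {a b : Fin n} (E : Env I Q U k X)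
    (hra : ra ≠ 16) (hrb : rb ≠ 16) (hrs : rs ≠ 16) (h0 : c.reg 0 = k) (h3 : c.reg 3 = n)
    (ha : c.reg ra = a) (hb : c.reg rb = b) (hs : c.reg rs = c.mem 9 (a * n + b))
    (H : QueueState (G := G) k X (baseGraph G k hk X) N A W c) (hab : N.Adj a b)
    {S : SimpleGraph (Fin n)} (hd : ∀ K ≤ S, GTruss K k → K ≤ A)
    (hlow : c.mem 10 (a * n + b) - 1 < k → ∀ K ≤ S, GTruss K k → ¬ K.Adj a b) :
    Run (I.ask Q) U (decrease ra rb rs) c fun c' T => ∃ (A' : SimpleGraph (Fin n)) (W' : _),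
      QueueState (G := G) k X (baseGraph G k hk X) N A' W' c' ∧ A' ≤ A ∧
      (∀ K ≤ S, GTruss K k → K ≤ A') ∧
      (∀ u v : Fin n, s(u, v) = s(a, b) → c'.mem 10 (u * n + v) = c.mem 10 (a * n + b) - 1) ∧
      (∀ u v : Fin n, s(u, v) ≠ s(a, b) → c'.mem 10 (u * n + v) = c.mem 10 (u * n + v)) ∧
      (A'.Adj a b → k ≤ c.mem 10 (a * n + b) - 1) ∧
      (∀ u v : Fin n, s(u, v) ≠ s(a, b) → c'.mem 9 (u * n + v) = c.mem 9 (u * n + v)) ∧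
      T ≤ 100 := by
  have hB := H.le_base hab
  have hB' : k ≤ edgeTrussness G b a := by rw [edgeTrussness_comm]; exact hB.2.2
  have hst := H.alive a hB.1 b
  have hnew : ∀ (x : ℕ) (u v : Fin n), s(u, v) = s(a, b) →
      Function.update (Function.update (c.mem 10) (a * n + b) x) (b * n + a) x (u * n + v) = x := by
    intro x u v h
    rcases Sym2.eq_iff.1 h with ⟨rfl, rfl⟩ | ⟨rfl, rfl⟩ <;> simp [Function.update_apply]
  have hold : ∀ (x : ℕ) (u v : Fin n), s(u, v) ≠ s(a, b) →
      Function.update (Function.update (c.mem 10) (a * n + b) x) (b * n + a) x (u * n + v) =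
        c.mem 10 (u * n + v) := by
    intro x u v h
    obtain ⟨h1, h2⟩ := ne_or_swap_of_not_eq h
    simp [h1, h2]
  refine Run.seq (Run.load ?_ (Run.seq (Run.assign (Run.seq (Run.store ?_ (Run.seq (Run.store ?_
    (Run.ite ?_ ?_))))))))
  · simpa [ha, hb, h3] using E.ecell 10 (by simp) a hB.1 b hB.2.2
  · simpa [ha, hb, h3, hra, hrb] using E.ecell 10 (by simp) a hB.1 b hB.2.2
  · simpa [ha, hb, h3, hra, hrb] using E.ecell 10 (by simp) b hB.2.1 a hB'
  · intro hne
    have hne' : c.mem 10 (a * n + b) - 1 < k ∧ c.mem 9 (a * n + b) = 0 := by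
      simpa [ha, hb, h3, hra, hrb, hrs, h0, hs] using hne
    have hA : A.Adj a b := hst.2 ⟨hB.2.2, hne'.2⟩
    refine (push_spec (a := a) (b := b) E ?_ ?_ ?_
      (H.of_eq (by simp) (by simp) (by simp) (by simp) (by simp)) hA).conseq ?_
    · simp [h3]
    · simp [ha, hra]
    · simp [hb, hrb]
    rintro c' T hf ⟨hq, h9, hT⟩
    have m10 := hf.mem' 10 (by simp [push, Prog.arrays])
    refine ⟨_, _, hq, SimpleGraph.deleteEdges_le _, fun K hK hKt u v huv => ?_, fun u v h => ?_,
      fun u v h => ?_, fun h => ?_, fun u v h => ?_, by simp; omega⟩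
    · refine SimpleGraph.deleteEdges_adj.2 ⟨hd K hK hKt huv, fun h => ?_⟩
      rcases Sym2.eq_iff.1 h with ⟨rfl, rfl⟩ | ⟨rfl, rfl⟩
      · exact hlow hne'.1 K hK hKt huv
      · exact hlow hne'.1 K hK hKt huv.symm
    · rw [m10]; simp [ha, hb, h3, hra, hrb, hnew _ u v h]
    · rw [m10]; simp [ha, hb, h3, hra, hrb, hold _ u v h]
    · simp at h
    · rw [h9 u v h]; simp
  · intro heq
    refine Run.assign ⟨A, W, H.of_eq (by simp) (by simp) (by simp) (by simp) (by simp), le_rfl, hd,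
      fun u v h => ?_, fun u v h => ?_, fun h => ?_, fun u v h => by simp, by simp⟩
    · simp [ha, hb, h3, hra, hrb, hnew _ u v h]
    · simp [ha, hb, h3, hra, hrb, hold _ u v h]
    · have h9 := (hst.1 h).2
      by_contra hlt
      simp [ha, hb, h3, hra, hrb, hrs, h0, hs, h9, Nat.not_le.1 hlt] at heq

/-- After the third vertices in `M` have been treated, the stored counts are two plus `triCount N a
b M`. This interpolates between the supports in `N` and those in `N` without `ab`. -/
theorem scanTriangles_spec {k X hk N A W} {c : Config} {a b : Fin n} (E : Env I Q U k X)
    (h0 : c.reg 0 = k) (h3 : c.reg 3 = n) (ha : c.reg 13 = a) (hb : c.reg 15 = b)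
    (h25 : c.reg 25 = (I.nb k a).length) (hab : N.Adj a b) (hN : N ≤ baseGraph G k hk X)
    (H : QueueState (G := G) k X (baseGraph G k hk X) (N.deleteEdges {s(a, b)}) A W c)
    {S : SimpleGraph (Fin n)} (hd : ∀ K ≤ S, GTruss K k → K ≤ A)
    (hok : ∀ x y : Fin n, A.Adj x y → k ≤ c.mem 10 (x * n + y))
    (hsup : ∀ x y : Fin n, (N.deleteEdges {s(a, b)}).Adj x y →
      c.mem 10 (x * n + y) = 2 + {z | N.Adj x z ∧ N.Adj y z}.ncard) :
    Run (I.ask Q) U scanTriangles c fun c' T => ∃ (A' : SimpleGraph (Fin n)) (W' : _),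
      QueueState (G := G) k X (baseGraph G k hk X) (N.deleteEdges {s(a, b)}) A' W' c' ∧ A' ≤ A ∧
      (∀ K ≤ S, GTruss K k → K ≤ A') ∧
      (∀ x y : Fin n, A'.Adj x y → k ≤ c'.mem 10 (x * n + y)) ∧
      (∀ x y : Fin n, (N.deleteEdges {s(a, b)}).Adj x y → c'.mem 10 (x * n + y) =
        2 + {z | (N.deleteEdges {s(a, b)}).Adj x z ∧ (N.deleteEdges {s(a, b)}).Adj y z}.ncard) ∧
      T ≤ 300 * (I.nb k a).length + 10 := by
  set N' := N.deleteEdges {s(a, b)} with hN'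
  have hNle : N' ≤ N := SimpleGraph.deleteEdges_le _
  have haX := (hN hab).1
  have hbX := (hN hab).2.1
  have hne := hab.ne
  refine Run.forList (I.nb_nodup k a) (fun M c' => ∃ (A' : SimpleGraph (Fin n)) (W' : _),
      QueueState (G := G) k X (baseGraph G k hk X) N' A' W' c' ∧ A' ≤ A ∧
      (∀ K ≤ S, GTruss K k → K ≤ A') ∧
      (∀ x y : Fin n, A'.Adj x y → k ≤ c'.mem 10 (x * n + y)) ∧
      (∀ x y : Fin n, N'.Adj x y → c'.mem 10 (x * n + y) = 2 + triCount N a b M x y))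
    (fun _ => 280) h25 ?_ ?_ ?_ ?_
  · rintro M c' x ⟨A', W', hq, h⟩
    exact ⟨A', W', hq.of_eq (by simp) (by simp) (by simp) (by simp) (by simp), h⟩
  · exact ⟨A, W, H, le_rfl, hd, hok, by simpa [triCount_empty] using hsup⟩
  · rintro y hy M c' hf h14 hyM hM ⟨A', W', hq, hle, hd', hok', hsup'⟩
    have hτ : k ≤ edgeTrussness G a (I.nb k a)[y] := (I.mem_nb E.pos).1 (List.getElem_mem hy)
    have eask := I.ask_nb Q a hy
    set w := (I.nb k a)[y]
    have e13 : c'.reg 13 = a := by rw [hf.reg 13, ha]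
    have e15 : c'.reg 15 = b := by rw [hf.reg 15, hb]
    have e3 : c'.reg 3 = n := by rw [hf.reg 3, h3]
    have e0 : c'.reg 0 = k := by rw [hf.reg 0, h0]
    have hwX := E.closed _ haX _ hτ
    have hnot : ∀ c'' : Config, c''.reg 8 = c'.reg 8 → c''.reg 9 = c'.reg 9 → c''.mem 9 = c'.mem 9 →
        c''.mem 11 = c'.mem 11 → c''.mem 12 = c'.mem 12 → c''.mem 10 = c'.mem 10 →
        ¬ (N.Adj a w ∧ N.Adj b w) → ∃ (A' : SimpleGraph (Fin n)) (W' : _),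
      QueueState (G := G) k X (baseGraph G k hk X) N' A' W' c'' ∧ A' ≤ A ∧
      (∀ K ≤ S, GTruss K k → K ≤ A') ∧
      (∀ x y : Fin n, A'.Adj x y → k ≤ c''.mem 10 (x * n + y)) ∧
      (∀ x y : Fin n, N'.Adj x y → c''.mem 10 (x * n + y) =
        2 + triCount N a b (insert w M : Finset (Fin n)) x y) := by
      intro c'' h8 h9 m9 m11 m12 m10 hnot
      refine ⟨A', W', hq.of_eq h8 h9 m9 m11 m12, hle, hd', by rw [m10]; exact hok',
        fun x y hxy => ?_⟩
      rw [m10, hsup' x y hxy, Finset.coe_insert, triCount_insert_of_not hnot (hNle hxy)]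
    refine Run.seq (Run.ask (Run.seq (Run.ask (Run.ite ?_ ?_))))
    · intro hlt
      have hlt' : edgeTrussness G b w < k := by
        simpa [e13, h14, eask, e15, e0] using hlt
      refine Run.assign ⟨hnot _ (by simp) (by simp) (by simp) (by simp) (by simp) (by simp) ?_,
        by simp⟩
      rintro ⟨-, h⟩
      have := (hN h).2.2
      omega
    · intro hge
      have hge' : k ≤ edgeTrussness G b w := by
        simpa [e13, h14, eask, e15, e0] using hge
      have hNa := hq.present a haX w
      have hNb := hq.present b hbX w
      refine Run.seq (Run.load ?_ (Run.seq (Run.load ?_ (Run.ite ?_ ?_))))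
      · simpa [e13, h14, eask, e3] using E.ecell 9 (by simp) a haX w hτ
      · simpa [e13, e15, h14, eask, e3] using E.ecell 9 (by simp) b hbX w hge'
      · intro hlt
        have hlt' : c'.mem 9 (a * n + w) < 2 ∧ c'.mem 9 (b * n + w) < 2 := by
          have : c'.mem 9 (b * n + w) < 2 ∧ c'.mem 9 (a * n + w) < 2 := by
            simpa [e13, h14, eask, e15, e0, e3] using hlt
          exact this.symm
        have haw : N'.Adj a w := hNa.2 ⟨hτ, hlt'.1⟩
        have hbw : N'.Adj b w := hNb.2 ⟨hge', hlt'.2⟩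
        have hsne : s(b, w) ≠ s(a, w) := by
          intro h
          rcases Sym2.eq_iff.1 h with ⟨h, -⟩ | ⟨h, -⟩
          · exact hne h.symm
          · exact hbw.ne h
        have hwM : w ∉ (M : Set (Fin n)) := hyM
        have t1 := triCount_insert (hNle haw) (hNle hbw) hab hwM
        have t2 := triCount_insert (hNle hbw) (hNle haw) hab.symm hwM
        rw [← triCount_swap, ← triCount_swap (N := N) a b] at t2
        have s1 := hsup' a w haw
        have s2 := hsup' b w hbw
        -- Trusses inside `S` lie in `N'`, and the support in `N'` is at most the partial count.
        have low : ∀ x, N'.Adj x w → 2 + triCount N a b (insert w M : Set (Fin n)) x w < k →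
            ∀ K ≤ S, GTruss K k → ¬ K.Adj x w := by
          intro x hx hlt K hK hKt
          refine hKt.not_adj ((hd' K hK hKt).trans hq.le) ?_
          have := le_triCount (N := N) a b (insert w M : Set (Fin n)) x w
          rw [← hN'] at this
          omega
        refine Run.seq ((decrease_spec (a := a) (b := w) E (by decide) (by decide) (by decide)
          ?_ ?_ ?_ ?_ ?_ (hq.of_eq (by simp) (by simp) (by simp) (by simp) (by simp)) haw hd'
          ?_).conseq ?_)
        · simp [e0]
        · simp [e3]
        · simp [e13]
        · simp [e13, h14, eask]
        · simp [e13, h14, eask, e3]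
        · intro h
          refine low a haw ?_
          simp at h
          omega
        rintro c1 T1 hf1 ⟨A1, W1, hq1, hle1, hd1, m1, m1', a1, n1, hT1⟩
        have f13 := hf1.reg' 13 (by simp [decrease, push, skip, Prog.regs])
        have f15 := hf1.reg' 15 (by simp [decrease, push, skip, Prog.regs])
        have f22 := hf1.reg' 22 (by simp [decrease, push, skip, Prog.regs])
        have f31 := hf1.reg' 31 (by simp [decrease, push, skip, Prog.regs])
        have f0 := hf1.reg' 0 (by simp [decrease, push, skip, Prog.regs])
        have f3 := hf1.reg' 3 (by simp [decrease, push, skip, Prog.regs])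
        have low2 : ∀ K ≤ S, GTruss K k → K ≤ A1 := hd1
        refine (decrease_spec (a := b) (b := w) E (by decide) (by decide) (by decide)
          ?_ ?_ ?_ ?_ ?_ hq1 hbw hd1 ?_).conseq ?_
        · rw [f0]; simp [e0]
        · rw [f3]; simp [e3]
        · rw [f15]; simp [e15]
        · rw [f22]; simp [e13, h14, eask]
        -- The status of `bw` was loaded before `aw` was treated; it is still correct because these
        -- are different edges.
        · rw [f31, n1 b w hsne]; simp [e13, e15, h14, eask, e3]
        · rw [m1' b w hsne]
          intro h
          refine low b hbw ?_
          simp at h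
          omega
        rintro c2 T2 hf2 ⟨A2, W2, hq2, hle2, hd2, m2, m2', a2, n2, hT2⟩
        rw [m1' b w hsne] at m2 a2
        simp only [Config.setReg_mem, Config.touch_mem] at m1 m1' a1 m2 a2
        refine ⟨⟨A2, W2, hq2, hle2.trans (hle1.trans hle), hd2, fun x y hxy => ?_,
          fun x y hxy => ?_⟩, by simp; omega⟩
        · by_cases h2 : s(x, y) = s(b, w)
          · rw [m2 x y h2]
            apply a2
            rcases Sym2.eq_iff.1 h2 with ⟨rfl, rfl⟩ | ⟨rfl, rfl⟩
            · exact hxy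
            · exact hxy.symm
          · rw [m2' x y h2]
            by_cases h1 : s(x, y) = s(a, w)
            · rw [m1 x y h1]
              apply a1
              rcases Sym2.eq_iff.1 h1 with ⟨rfl, rfl⟩ | ⟨rfl, rfl⟩
              · exact hle2 hxy
              · exact hle2 hxy.symm
            · rw [m1' x y h1]
              exact hok' x y (hle1 (hle2 hxy))
        · rw [Finset.coe_insert]
          by_cases h2 : s(x, y) = s(b, w)
          · rw [m2 x y h2]
            rcases Sym2.eq_iff.1 h2 with ⟨rfl, rfl⟩ | ⟨rfl, rfl⟩
            · omega
            · rw [triCount_comm]; omega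
          · rw [m2' x y h2]
            by_cases h1 : s(x, y) = s(a, w)
            · rw [m1 x y h1]
              rcases Sym2.eq_iff.1 h1 with ⟨rfl, rfl⟩ | ⟨rfl, rfl⟩
              · omega
              · rw [triCount_comm]; omega
            · rw [m1' x y h1]
              simp only [hsup' x y hxy]
              rw [triCount_insert_of_ne]
              · rintro ⟨rfl, rfl | rfl⟩
                · exact h1 Sym2.eq_swap
                · exact h2 Sym2.eq_swap
              · rintro ⟨rfl, rfl | rfl⟩
                · exact h1 rfl
                · exact h2 rfl
      -- Were `abw` a triangle of `N`, its sides `aw` and `bw` would survive in `N'`, being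
      -- different from `ab`, and both would have status less than `2`.
      · intro hge2
        refine Run.assign ⟨hnot _ (by simp) (by simp) (by simp) (by simp) (by simp) (by simp) ?_,
          by simp⟩
        rintro ⟨h1, h2⟩
        have hwb : w ≠ b := fun h => h2.ne h.symm
        have hwa : w ≠ a := fun h => h1.ne h.symm
        have h1' : N'.Adj a w := by
          simp [hN', h1, hwb, hne]
        have h2' : N'.Adj b w := by
          simp [hN', h2, hwa, hne.symm]
        have g1 := (hNa.1 h1').2
        have g2 := (hNb.1 h2').2
        simp [e13, h14, eask, e15, e3, g1, g2] at hge2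
  · rintro c' T hf ⟨A', W', hq, hle, hd', hok', hsup'⟩ hT
    refine ⟨A', W', hq, hle, hd', hok', fun x y hxy => ?_, ?_⟩
    · rw [hsup' x y hxy, triCount_full _ (hNle hxy)]
      intro w hw
      simp only [List.coe_toFinset, Set.mem_ofPred_eq]
      exact (I.mem_nb E.pos).2 (hN hw).2.2
    · simp only [Finset.sum_const, List.toFinset_card_of_nodup (I.nb_nodup k _), smul_eq_mul] at hT
      omega

open Classical in
/-- A bound for the work of removing all edges of `N`. -/
noncomputable def edgeWork (I : TrussIndex G) (k : ℕ) (N : SimpleGraph (Fin n)) : ℕ :=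
  ∑ p ∈ Finset.univ.filter (fun p : Fin n × Fin n => N.Adj p.1 p.2),
    (1 + min (I.nb k p.1).length (I.nb k p.2).length)

/-- The sum runs over ordered pairs. The term of one orientation pays for the scan, that of the
other is given away. -/
theorem edgeWork_deleteEdge {k : ℕ} {N : SimpleGraph (Fin n)} {a b : Fin n} (h : N.Adj a b) :
    edgeWork I k (N.deleteEdges {s(a, b)}) + (1 + min (I.nb k a).length (I.nb k b).length) ≤
      edgeWork I k N := by
  classical
  have hmem : (a, b) ∈ Finset.univ.filter (fun p : Fin n × Fin n => N.Adj p.1 p.2) := by simpa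
  rw [edgeWork, edgeWork, ← Finset.sum_erase_add _ _ hmem]
  gcongr
  intro p hp
  simp only [Finset.mem_filter, Finset.mem_univ, true_and, SimpleGraph.deleteEdges_adj,
    Set.mem_singleton_iff] at hp
  simp only [Finset.mem_erase, Finset.mem_filter, Finset.mem_univ, true_and]
  exact ⟨fun h => hp.2 (by rw [h]), hp.1⟩

/-- A queued edge has already left `A`, so popping it changes `N` only. -/
theorem QueueState.pop {k X hk N A W} {c c' : Config} {a b : Fin n}
    (H : QueueState (G := G) k X (baseGraph G k hk X) N A ((a, b) :: W) c)
    (h8 : c'.reg 8 = c.reg 8 + 1) (h9 : c'.reg 9 = c.reg 9)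
    (m9 : ∀ u v : Fin n, c'.mem 9 (u * n + v) =
      if s(u, v) = s(a, b) then 2 else c.mem 9 (u * n + v))
    (m11 : c'.mem 11 = c.mem 11) (m12 : c'.mem 12 = c.mem 12) :
    QueueState (G := G) k X (baseGraph G k hk X) (N.deleteEdges {s(a, b)}) A W c' := by
  have hnA : ∀ u v, s(u, v) = s(a, b) → ¬ A.Adj u v := by
    intro u v h
    exact ((H.mem u v).1 (by rw [h]; simp)).2
  have hnd := H.nodup
  rw [List.map_cons, List.nodup_cons] at hnd
  refine ⟨fun u v h => SimpleGraph.deleteEdges_adj.2 ⟨H.le h, fun h' => hnA u v h' h⟩,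
    (SimpleGraph.deleteEdges_le _).trans H.le_base, fun u hu v => ?_, fun u hu v => ?_, ?_, ?_,
    fun i hi => ?_, hnd.2, fun u v => ?_⟩
  · rw [m9]
    split
    case isTrue h => simp [hnA u v h]
    case isFalse h => exact H.alive u hu v
  · rw [m9, SimpleGraph.deleteEdges_adj, H.present u hu v]
    split
    case isTrue h => simp [h]
    case isFalse h => simp [h]
  · rw [h9]; exact H.tail
  · have := H.head
    simp only [List.length_cons] at this
    rw [h8, h9]; omega
  · have := H.queue (i + 1) (by simpa using hi)
    rw [h8, m11, m12, Nat.add_assoc, Nat.add_comm 1 i]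
    simpa using this
  · have := H.mem u v
    rw [List.map_cons, List.mem_cons] at this
    rw [SimpleGraph.deleteEdges_adj]
    by_cases h : s(u, v) = s(a, b)
    · simp only [h, Set.mem_singleton_iff, not_true, and_false, false_and, iff_false]
      exact hnd.1
    · simp only [h, Set.mem_singleton_iff, not_false_eq_true, and_true]
      rw [← this]
      simp [h]

/-- The elapsed time plus the potential `300 * edgeWork` of the edges present never grows. The loop
ends because the head of the queue advances and cannot pass the number of edges of `G₀`. With an
empty queue the two graphs coincide, so the counts, all at least `k`, are true supports plus two. -/
theorem peel_spec {k X hk L N A W} {c : Config} (E : Env I Q U k X) (S : Setup I Q k X L c)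
    (H : QueueState (G := G) k X (baseGraph G k hk X) N A W c)
    {S₀ : SimpleGraph (Fin n)} (hd : ∀ K ≤ S₀, GTruss K k → K ≤ A)
    (hok : ∀ x y : Fin n, A.Adj x y → k ≤ c.mem 10 (x * n + y))
    (hsup : ∀ x y : Fin n, N.Adj x y →
      c.mem 10 (x * n + y) = 2 + {z | N.Adj x z ∧ N.Adj y z}.ncard) :
    Run (I.ask Q) U peel c fun c' T => ∃ (A' : SimpleGraph (Fin n)),
      QueueState (G := G) k X (baseGraph G k hk X) A' A' [] c' ∧ A' ≤ A ∧
      (∀ K ≤ S₀, GTruss K k → K ≤ A') ∧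
      (∀ x y : Fin n, A'.Adj x y → k ≤ c'.mem 10 (x * n + y)) ∧
      (∀ x y : Fin n, A'.Adj x y →
        c'.mem 10 (x * n + y) = 2 + {z | A'.Adj x z ∧ A'.Adj y z}.ncard) ∧
      T + 300 * edgeWork I k A' ≤ 300 * edgeWork I k N + 10 := by
  refine Run.loop (fun c' T => ∃ (N' A' : SimpleGraph (Fin n)) (W' : _),
      QueueState (G := G) k X (baseGraph G k hk X) N' A' W' c' ∧ A' ≤ A ∧
      (∀ K ≤ S₀, GTruss K k → K ≤ A') ∧
      (∀ x y : Fin n, A'.Adj x y → k ≤ c'.mem 10 (x * n + y)) ∧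
      (∀ x y : Fin n, N'.Adj x y →
        c'.mem 10 (x * n + y) = 2 + {z | N'.Adj x z ∧ N'.Adj y z}.ncard) ∧
      T + 300 * edgeWork I k N' ≤ 300 * edgeWork I k N)
    (fun c' => (baseGraph G k hk X).edgeSet.ncard - c'.reg 8) ?_ ?_ ?_
  · exact ⟨N, A, W, H, le_rfl, hd, hok, hsup, by simp⟩
  · rintro c' T hf ⟨N', A', W', hq, hle, hd', hok', hsup', hT⟩ hne
    have hhead := hq.head
    have htail := hq.tail
    have hlt : c'.reg 8 < c'.reg 9 := by
      by_contra h
      simp [h] at hne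
    obtain _ | ⟨⟨a, b⟩, W'⟩ := W'
    · simp at hhead; omega
    have hN := ((hq.mem a b).1 (by simp)).1
    have hB := hq.le_base hN
    have hB' : k ≤ edgeTrussness G b a := by rw [edgeTrussness_comm]; exact hB.2.2
    have hqu := hq.queue 0 (by simp)
    simp only [Nat.add_zero, List.getElem_cons_zero] at hqu
    have S' := S.of_frame hf
    have e3 := S'.size
    have hwork := edgeWork_deleteEdge (I := I) (k := k) hN
    have hcell : ∀ A ∈ [11, 12], (A, c'.reg 8) ∈ U := by
      intro A hA
      refine E.qcell A hA _ ?_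
      rw [sum_nb_eq hk X E.closed]; omega
    refine Run.seq (Run.load (by simpa using hcell 11 (by simp)) (Run.seq (Run.load
      (by simpa using hcell 12 (by simp)) (Run.seq (Run.assign (Run.seq (Run.store ?_ (Run.seq
      (Run.store ?_ (Run.seq (Run.load ?_ (Run.seq (Run.load ?_ (Run.seq ?_))))))))))))))
    · simpa [hqu, e3] using E.ecell 9 (by simp) a hB.1 b hB.2.2
    · simpa [hqu, e3] using E.ecell 9 (by simp) b hB.2.1 a hB'
    · simpa [hqu] using E.vcell 8 (by simp) a hB.1
    · simpa [hqu] using E.vcell 8 (by simp) b hB.2.1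
    have d1 := S'.degree a hB.1
    have d2 := S'.degree b hB.2.1
    -- The optional exchange lets `a'` be the end with the shorter list; the edge as an unordered
    -- pair is unchanged.
    refine Run.conseq (Post := fun c1 T1 => (∃ a' b', s(a', b') = s(a, b) ∧ c1.reg 13 = a' ∧
      c1.reg 15 = b' ∧ c1.reg 25 = (I.nb k a').length ∧
      (I.nb k a').length = min (I.nb k a).length (I.nb k b).length) ∧ c1.reg 8 = c'.reg 8 + 1 ∧
      c1.reg 9 = c'.reg 9 ∧ c1.reg 0 = c'.reg 0 ∧ c1.reg 3 = c'.reg 3 ∧ (∀ u v : Fin n,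
        c1.mem 9 (u * n + v) = if s(u, v) = s(a, b) then 2 else c'.mem 9 (u * n + v)) ∧
      c1.mem 10 = c'.mem 10 ∧ c1.mem 11 = c'.mem 11 ∧ c1.mem 12 = c'.mem 12 ∧ T1 ≤ 20)
      ?_ ?_
    · have hm9 : ∀ u v : Fin n, Function.update (Function.update (c'.mem 9) (a * n + b) 2)
          (b * n + a) 2 (u * n + v) = if s(u, v) = s(a, b) then 2 else c'.mem 9 (u * n + v) := by
        intro u v
        split
        case isTrue h =>
          rcases Sym2.eq_iff.1 h with ⟨rfl, rfl⟩ | ⟨rfl, rfl⟩ <;> simp [Function.update_apply]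
        case isFalse h =>
          obtain ⟨h1, h2⟩ := ne_or_swap_of_not_eq h
          simp [h1, h2]
      refine Run.ite (fun h => ?_) (fun h => ?_)
      · have h' : (I.nb k b).length < (I.nb k a).length := by
          simpa [hqu, d1, d2] using h
        refine Run.seq (Run.assign (Run.seq (Run.assign (Run.seq (Run.assign (Run.assign ⟨⟨b, a,
          Sym2.eq_swap, ?_⟩, ?_⟩))))))
        · simp [hqu, d1, d2, h'.le]
        · simp [hqu, e3, hm9]
      · have h' : (I.nb k a).length ≤ (I.nb k b).length := by
          simpa [hqu, d1, d2] using h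
        refine Run.assign ⟨⟨a, b, rfl, ?_⟩, ?_⟩
        · simp [hqu, d1, d2, h']
        · simp [hqu, e3, hm9]
    rintro c1 T1 hf1 ⟨⟨a', b', hab', r13, r15, r25, hmin⟩, r8, r9, r0, r3, m9, m10, m11, m12, hT1⟩
    have hq1 := hq.pop r8 r9 m9 m11 m12
    have hN' : N'.Adj a' b' := by
      rcases Sym2.eq_iff.1 hab' with ⟨rfl, rfl⟩ | ⟨rfl, rfl⟩
      · exact hN
      · exact hN.symm
    rw [← hab'] at hq1 hwork
    refine (scanTriangles_spec (a := a') (b := b') E (r0.trans S'.level) (r3.trans e3) r13 r15 r25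
      hN' hq.le_base hq1 hd' (by rw [m10]; exact hok') (fun x y hxy => ?_)).conseq ?_
    · rw [m10]; exact hsup' x y (SimpleGraph.deleteEdges_le _ hxy)
    rintro c2 T2 hf2 ⟨A2, W2, hq2, hle2, hd2, hok2, hsup2, hT2⟩
    refine ⟨⟨_, A2, W2, hq2, hle2.trans hle, hd2, hok2, hsup2, ?_⟩, ?_⟩
    · simp; omega
    · have f8 := hf2.reg 8
      omega
  · rintro c' T hf ⟨N', A', W', hq, hle, hd', hok', hsup', hT⟩ heq
    have hhead := hq.head
    have hge : c'.reg 9 ≤ c'.reg 8 := by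
      by_contra h; simp [Nat.not_le.1 h] at heq
    obtain rfl : W' = [] := List.length_eq_zero_iff.1 (by omega)
    have hNA : N' = A' := by
      ext u v
      refine ⟨fun h => ?_, fun h => hq.le h⟩
      by_contra h'
      simpa using (hq.mem u v).2 ⟨h, h'⟩
    subst hNA
    exact ⟨N', hq, hle, hd', hok', hsup', by simp; omega⟩

end TrussSearch

namespace TrussSearch

/-! ### The initial part -/

variable {n : ℕ} {G : SimpleGraph (Fin n)} {I : TrussIndex G} {Q : List (Fin n)} {U : Set (ℕ × ℕ)}

/-- The queue of the successful search lists `X`. It is copied to array `7` because later searches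
overwrite array `3`. -/
theorem listVerts_spec {k X L} {c : Config} (E : Env I Q U k X) (h0 : c.reg 0 = k)
    (h3 : c.reg 3 = n) (h4 : c.reg 4 = Q.length) (h12 : c.reg 12 = L.length) (hL : ListAt c 3 L)
    (hn : L.Nodup) (hm : ∀ v, v ∈ L ↔ v ∈ X) :
    Run (I.ask Q) U listVerts c fun c' T =>
      Setup I Q k X L c' ∧ T ≤ 100 * weight I k X + 10 := by
  have hLX : L.toFinset = X := by ext v; simp [hm]
  have hcard : L.length = X.card := by rw [← hLX, List.toFinset_card_of_nodup hn]
  refine Run.seq (Run.assign ?_)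
  refine Run.forList hn (fun M c' => (∀ i (h : i < L.length), L[i] ∈ M → c'.mem 7 i = (L[i] : Fin n)) ∧
    ∀ v ∈ M, c'.mem 8 v = (I.nb k v).length) (fun v => 30 * (I.nb k v).length + 90)
    (by simp [h12]) (fun _ _ _ h => h) (by simp) ?_ ?_
  · rintro x hx M c' hf h21 hxM hM ⟨i7, i8⟩
    have hxX := (hm _).1 (L.getElem_mem hx)
    have e : c'.mem 3 x = (L[x] : Fin n) := by rw [hf.mem 3]; simpa using hL x hx
    have e0 : c'.reg 0 = k := by rw [hf.reg 0]; simpa using h0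
    refine Run.seq (Run.load ?_ (Run.seq (Run.store ?_ (Run.seq ((countProg_spec (I := I) (κ := k)
      (v := L[x]) (by simp [e0]) (by simp [h21, e])).conseq ?_)))))
    · simpa [h21] using E.icell 3 (by simp) x (by omega)
    · simpa [h21] using E.icell 7 (by simp) x (by omega)
    rintro c1 T1 hf1 ⟨h16, hT1⟩
    have e13 : c1.reg 13 = L[x] := by rw [hf1.reg 13]; simp [h21, e]
    refine Run.store ?_ ⟨⟨fun i hi him => ?_, fun v hv => ?_⟩, ?_⟩
    · simpa [e13] using E.vcell 8 (by simp) _ hxX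
    · have m7 : c1.mem 7 = Function.update (c'.mem 7) x (L[x] : Fin n) := by
        rw [hf1.mem 7]; simp [h21, e]
      by_cases hix : i = x
      · subst hix; simp [m7]
      · rw [Finset.mem_insert] at him
        simp only [Config.setMem_mem, Config.touch_mem]
        simp [m7, hix]
        exact i7 i hi (him.resolve_left fun h => hix ((hn.getElem_inj_iff).1 h))
    · have m8 : c1.mem 8 = c'.mem 8 := by rw [hf1.mem 8]; simp
      rcases Finset.mem_insert.1 hv with rfl | hv
      · simp [e13, h16]
      · have hne : (v : ℕ) ≠ (L[x] : Fin n) := fun h => hxM (Fin.ext h ▸ hv)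
        simp [e13, hne, m8]; exact i8 v hv
    · simp; omega
  · rintro c' T hf ⟨i7, i8⟩ hT
    rw [hLX] at hT
    refine ⟨⟨by rw [hf.reg 0]; simpa using h0, by rw [hf.reg 3]; simpa using h3,
      by rw [hf.reg 4]; simpa using h4, by rw [hf.reg 7]; simp [h12],
      fun i hi => i7 i hi (by simp), hn, hm, fun v hv => i8 v (by simpa [hm] using hv)⟩, ?_⟩
    have : ∑ a ∈ X, (30 * (I.nb k a).length + 90 + 8) ≤ 100 * weight I k X := by
      rw [weight, Finset.mul_sum]; gcongr; omega
    simp; omega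

/-- An entry of the shorter list is a common neighbour exactly if its edge to the other end has
trussness at least `k`: `X` is closed under such edges, so the table of trussness decides adjacency
in `G₀`. -/
theorem countTriangles_spec {k X hk L} {c : Config} {u v : Fin n} (E : Env I Q U k X)
    (S : Setup I Q k X L c) (h13 : c.reg 13 = u) (h15 : c.reg 15 = v)
    (h25 : c.reg 25 = (I.nb k u).length) (huv : (baseGraph G k hk X).Adj u v) :
    Run (I.ask Q) U countTriangles c fun c' T =>
      c'.mem 10 = Function.update (c.mem 10) (u * n + v)
        ({w | (baseGraph G k hk X).Adj u w ∧ (baseGraph G k hk X).Adj v w}.ncard + 2) ∧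
      T ≤ 80 * (1 + min (I.nb k u).length (I.nb k v).length) := by
  obtain ⟨hu, hv, hτ⟩ := huv
  have d := S.degree v hv
  refine Run.seq (Run.load ?_ (Run.seq ?_))
  · simpa [h15] using E.vcell 8 (by simp) v hv
  refine Run.conseq (Post := fun c1 T1 => (∃ a b, s(a, b) = s(u, v) ∧ c1.reg 27 = a ∧
      c1.reg 28 = b ∧ c1.reg 29 = (I.nb k a).length ∧
      (I.nb k a).length = min (I.nb k u).length (I.nb k v).length) ∧ T1 ≤ 20) ?_ ?_
  · refine Run.ite (fun h => ?_) (fun h => ?_)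
    · have h' : (I.nb k v).length < (I.nb k u).length := by simpa [h15, h25, d] using h
      refine Run.seq (Run.assign (Run.seq (Run.assign (Run.assign ⟨⟨v, u, Sym2.eq_swap, ?_⟩, ?_⟩))))
      · simp [h13, h15, d, h'.le]
      · simp
    · have h' : (I.nb k u).length ≤ (I.nb k v).length := by simpa [h15, h25, d] using h
      refine Run.seq (Run.assign (Run.seq (Run.assign (Run.assign ⟨⟨u, v, rfl, ?_⟩, ?_⟩))))
      · simp [h13, h15, h25, h']
      · simp
  rintro c1 T1 hf1 ⟨⟨a, b, hab, r27, r28, r29, hmin⟩, hT1⟩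
  have e0 : c1.reg 0 = k := by rw [hf1.reg 0]; simpa using S.level
  refine Run.seq (Run.assign (Run.seq ?_))
  refine Run.forList (I.nb_nodup k a)
    (fun M c' => c'.reg 20 = (M.filter fun w => k ≤ edgeTrussness G b w).card + 2) (fun _ => 20)
    (by simp [r29]) ?_ ?_ ?_ ?_
  · intro M c x h; simpa using h
  · simp
  · intro x hx M c' hf h30 hxM hM hP
    have e27 : c'.reg 27 = a := by rw [hf.reg 27]; simpa using r27
    have e28 : c'.reg 28 = b := by rw [hf.reg 28]; simpa using r28
    have e0' : c'.reg 0 = k := by rw [hf.reg 0]; simpa using e0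
    have e := I.ask_nb Q a hx
    refine Run.seq (Run.ask (Run.seq (Run.ask (Run.assign ⟨?_, by simp⟩))))
    rw [Finset.filter_insert]
    by_cases h1 : k ≤ edgeTrussness G b (I.nb k a)[x]
    · rw [if_pos h1, Finset.card_insert_of_notMem (by simp [hxM])]
      simp [e27, e28, e0', e, h30, Nat.not_lt.2 h1, hP]
    · rw [if_neg h1]
      simp [e27, e28, e0', e, h30, Nat.not_le.1 h1, hP]
  · intro c' T hf hP hT
    have e13 : c'.reg 13 = u := by rw [hf.reg 13]; simp [hf1.reg 13, h13]
    have e15 : c'.reg 15 = v := by rw [hf.reg 15]; simp [hf1.reg 15, h15]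
    have e3 : c'.reg 3 = n := by rw [hf.reg 3]; simp [hf1.reg 3, S.size]
    have m10 : c'.mem 10 = c.mem 10 := by rw [hf.mem 10]; simp [hf1.mem 10]
    refine Run.store ?_ ⟨?_, ?_⟩
    · simpa [e13, e15, e3] using E.ecell 10 (by simp) u hu v hτ
    · have hcount : ((I.nb k a).toFinset.filter fun w => k ≤ edgeTrussness G b w).card =
          {w | (baseGraph G k hk X).Adj u w ∧ (baseGraph G k hk X).Adj v w}.ncard := by
        rw [← Set.ncard_coe_finset]
        congr 1
        ext w
        simp only [Finset.coe_filter, List.mem_toFinset, I.mem_nb E.pos, Set.mem_ofPred_eq]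
        rcases Sym2.eq_iff.1 hab with ⟨rfl, rfl⟩ | ⟨rfl, rfl⟩
        · exact ⟨fun h => ⟨⟨hu, E.closed _ hu _ h.1, h.1⟩, hv, E.closed _ hu _ h.1, h.2⟩,
            fun h => ⟨h.1.2.2, h.2.2.2⟩⟩
        · exact ⟨fun h => ⟨⟨hu, E.closed _ hu _ h.2, h.2⟩, hv, E.closed _ hu _ h.2, h.1⟩,
            fun h => ⟨h.2.2.2, h.1.2.2⟩⟩
      simp [e13, e15, e3, m10, hP, hcount]
    · simp only [Finset.sum_const, List.toFinset_card_of_nodup (I.nb_nodup k _), smul_eq_mul] at hT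
      simp; omega

theorem edgeWork_baseGraph {k : ℕ} (hk : 1 ≤ k) {X : Finset (Fin n)}
    (hX : ∀ u ∈ X, ∀ v, k ≤ edgeTrussness G u v → v ∈ X) :
    edgeWork I k (baseGraph G k hk X) = ∑ u ∈ X, ∑ v ∈ (I.nb k u).toFinset,
      (1 + min (I.nb k u).length (I.nb k v).length) := by
  classical
  rw [edgeWork, Finset.sum_filter, ← Finset.univ_product_univ, Finset.sum_product,
    ← Finset.sum_subset (Finset.subset_univ X)]
  · refine Finset.sum_congr rfl fun u hu => ?_
    rw [I.toFinset_nb hk, Finset.sum_filter]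
    refine Finset.sum_congr rfl fun v _ => ?_
    congr 1
    exact propext ⟨fun h => h.2.2, fun h => ⟨hu, hX u hu v h, h⟩⟩
  · intro u _ hu
    exact Finset.sum_eq_zero fun v _ => if_neg fun h => hu h.1

theorem supports_spec {k X hk L} {c : Config} (E : Env I Q U k X) (S : Setup I Q k X L c) :
    Run (I.ask Q) U supports c fun c' T =>
      (∀ u v, (baseGraph G k hk X).Adj u v → c'.mem 10 (u * n + v) =
        {w | (baseGraph G k hk X).Adj u w ∧ (baseGraph G k hk X).Adj v w}.ncard + 2) ∧
      T ≤ 100 * edgeWork I k (baseGraph G k hk X) + 100 * weight I k X := by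
  refine Run.forList S.nodup (fun M c' => ∀ u ∈ M, ∀ v, (baseGraph G k hk X).Adj u v →
      c'.mem 10 (u * n + v) =
        {w | (baseGraph G k hk X).Adj u w ∧ (baseGraph G k hk X).Adj v w}.ncard + 2)
    (fun u => ∑ v ∈ (I.nb k u).toFinset, 100 * (1 + min (I.nb k u).length (I.nb k v).length) + 30)
    S.count (fun _ _ _ h => h) (by simp) ?_ ?_
  · intro x hx M c' hf h21 hxM hM hP
    have hxX := (S.mem_iff _).1 (L.getElem_mem hx)
    have S' := S.of_frame hf
    have e := S'.list x hx
    refine Run.seq (Run.load ?_ (Run.seq (Run.load ?_ ?_)))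
    · simpa [h21] using E.icell 7 (by simp) x (S.length ▸ hx)
    · simpa [h21, e] using E.vcell 8 (by simp) _ hxX
    refine Run.forList (I.nb_nodup k L[x]) (fun M' c'' => ∀ u v, u ∈ M ∨ u = L[x] ∧ v ∈ M' →
        (baseGraph G k hk X).Adj u v → c''.mem 10 (u * n + v) =
          {w | (baseGraph G k hk X).Adj u w ∧ (baseGraph G k hk X).Adj v w}.ncard + 2)
      (fun v => 80 * (1 + min (I.nb k L[x]).length (I.nb k v).length) + 5)
      (by simp [h21, e, S'.degree _ hxX]) (fun _ _ _ h => h) ?_ ?_ ?_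
    · rintro u v (hu | ⟨-, hv⟩) huv
      · simpa using hP u hu v huv
      · simp at hv
    · intro y hy M' c'' hf' h14 hyM hM' hP'
      have hτ := (I.mem_nb E.pos).1 (List.getElem_mem hy)
      have S'' := (((S'.setReg (r := 13) (x := L[x])).setReg (r := 25)
        (x := (I.nb k L[x]).length)))
      have eask := I.ask_nb Q L[x] hy
      set w := (I.nb k L[x])[y]
      have hadj : (baseGraph G k hk X).Adj L[x] w := ⟨hxX, E.closed _ hxX _ hτ, hτ⟩
      have e13 : c''.reg 13 = L[x] := by rw [hf'.reg 13]; simp [h21, e]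
      have e25 : c''.reg 25 = (I.nb k L[x]).length := by
        rw [hf'.reg 25]; simp [h21, e, S'.degree _ hxX]
      have S3 : Setup I Q k X L c'' := by
        refine Setup.of_frame (p := .load 13 7 (.reg 21) ;ᵣ .load 25 8 (.reg 13) ;ᵣ
          forLoop 14 25 (.ask 15 .neighbour (.reg 13) (.reg 14) ;ᵣ countTriangles)) S' ?_
        refine ⟨fun r hr => ?_, fun A hA => ?_⟩
        · rw [hf'.1 r fun h => hr (by simp [Prog.regs] at h ⊢; tauto)]
          have h1 : r ≠ 13 := by rintro rfl; exact hr (by decide)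
          have h2 : r ≠ 25 := by rintro rfl; exact hr (by decide)
          simp [h1, h2]
        · rw [hf'.2 A fun h => hA (by simp [Prog.arrays] at h ⊢; tauto)]
          simp
      refine Run.seq (Run.ask ((countTriangles_spec (hk := hk) (u := L[x]) (v := w) E S3.setReg (by simp [e13])
        (by simp [e13, h14, eask]) (by simp [e25]) hadj).conseq ?_))
      rintro c3 T3 hf3 ⟨h10, hT3⟩
      refine ⟨fun u v h huv => ?_, by simp; omega⟩
      rw [h10]
      by_cases he : u = L[x] ∧ v = w
      · obtain ⟨rfl, rfl⟩ := he; simp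
      · have hne : (u * n + v : ℕ) ≠ L[x] * n + w := fun h => he (edgeAddr_inj.1 h)
        rw [Function.update_of_ne hne]
        simp only [Config.setReg_mem]
        refine hP' u v ?_ huv
        rcases h with h | ⟨h, h'⟩
        · exact Or.inl h
        · exact Or.inr ⟨h, (Finset.mem_insert.1 h').resolve_left fun h'' => he ⟨h, h''⟩⟩
    · intro c'' T hf' hP' hT
      refine ⟨fun u hu v huv => hP' u v ?_ huv, ?_⟩
      · rcases Finset.mem_insert.1 hu with rfl | hu
        · exact Or.inr ⟨rfl, by simpa [I.mem_nb E.pos] using huv.2.2⟩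
        · exact Or.inl hu
      · have : ∑ v ∈ (I.nb k L[x]).toFinset,
            (80 * (1 + min (I.nb k L[x]).length (I.nb k v).length) + 5 + 8) ≤
            ∑ v ∈ (I.nb k L[x]).toFinset, 100 * (1 + min (I.nb k L[x]).length (I.nb k v).length) := by
          gcongr; omega
        simp only [Expr.cost]; omega
  · intro c' T hf hP hT
    rw [S.toFinset] at hP hT
    refine ⟨fun u v huv => hP u huv.1 v huv, hT.trans ?_⟩
    rw [edgeWork_baseGraph hk E.closed]
    have hX : 1 ≤ X.card := by
      obtain ⟨q, hq⟩ := List.exists_mem_of_ne_nil Q E.nonempty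
      exact Finset.card_pos.2 ⟨q, E.query q hq⟩
    have hw := card_le_weight I k X
    simp only [Finset.sum_add_distrib, Finset.sum_const, smul_eq_mul, ← Finset.mul_sum, ← Finset.sum_mul, mul_one,
      mul_add, add_assoc] at hT ⊢
    omega

end TrussSearch

namespace TrussSearch

/-! ### Rounds -/

variable {n : ℕ} {G : SimpleGraph (Fin n)} {I : TrussIndex G} {Q : List (Fin n)} {U : Set (ℕ × ℕ)}

/-- The configuration before the analysis of the graph `A`. -/
structure Prepared (I : TrussIndex G) (Q : List (Fin n)) (k : ℕ) (hk : 1 ≤ k) (X : Finset (Fin n))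
    (A : SimpleGraph (Fin n)) (c : Config) : Prop where
  setup : ∃ L, Setup I Q k X L c
  queue : QueueState (G := G) k X (baseGraph G k hk X) A A [] c
  marks : ∀ v : Fin n, c.mem 4 v = 0
  count : ∀ x y : Fin n, A.Adj x y → c.mem 10 (x * n + y) = 2 + {z | A.Adj x z ∧ A.Adj y z}.ncard
  truss : GTruss A k

/-- The configuration between two rounds, with the present graph `A`. -/
structure Ready (I : TrussIndex G) (Q : List (Fin n)) (k : ℕ) (hk : 1 ≤ k) (X : Finset (Fin n))
    (A : SimpleGraph (Fin n)) (c : Config) : Prop extends Prepared I Q k hk X A c where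
  reach : ∀ v ∈ X, c.mem 5 v = reachCount Q A v
  far : ∀ v ∈ X, c.mem 6 v = farthest Q A v
  flag : c.reg 5 = if ∀ q ∈ Q, reachCount Q A q = Q.length then 1 else 0

open Classical in
theorem analyse_spec {k X hk A} {c : Config} (E : Env I Q U k X) (H : Prepared I Q k hk X A c) :
    Run (I.ask Q) U analyse c fun c' T => Ready I Q k hk X A c' ∧
      (∀ v : Fin n, c'.mem 0 v = c.mem 0 v + if v ∈ X ∧ 0 < reachCount Q A v then 1 else 0) ∧
      (∀ u v : Fin n, c'.mem 1 (u * n + v) = c.mem 1 (u * n + v) +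
        if A.Adj u v ∧ 0 < reachCount Q A u then 1 else 0) ∧
      T ≤ 600 * (Q.length * weight I k X) := by
  obtain ⟨L, S⟩ := H.setup
  refine Run.seq ((distances_spec E S H.queue.alive H.marks).conseq ?_)
  rintro c1 T1 hf1 ⟨i4, i5, i6, hT1⟩
  have S1 := S.of_frame hf1
  refine Run.seq ((connectTest_spec E S1).conseq ?_)
  rintro c2 T2 hf2 ⟨i5', hT2⟩
  have S2 := S1.of_frame hf2
  refine (record_spec E S2).conseq ?_
  rintro c3 T3 hf3 ⟨i0, i1, hT3⟩
  have S3 := S2.of_frame hf3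
  have m4 : c3.mem 4 = c1.mem 4 := by rw [hf3.mem 4, hf2.mem 4]
  have m5 : c3.mem 5 = c1.mem 5 := by rw [hf3.mem 5, hf2.mem 5]
  have m5' : c2.mem 5 = c1.mem 5 := hf2.mem 5
  have m6 : c3.mem 6 = c1.mem 6 := by rw [hf3.mem 6, hf2.mem 6]
  have m9 : c2.mem 9 = c.mem 9 := by rw [hf2.mem 9, hf1.mem 9]
  have m9' : c3.mem 9 = c.mem 9 := by rw [hf3.mem 9, m9]
  have m10 : c3.mem 10 = c.mem 10 := by rw [hf3.mem 10, hf2.mem 10, hf1.mem 10]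
  have m11 : c3.mem 11 = c.mem 11 := by rw [hf3.mem 11, hf2.mem 11, hf1.mem 11]
  have m12 : c3.mem 12 = c.mem 12 := by rw [hf3.mem 12, hf2.mem 12, hf1.mem 12]
  have m0 : c2.mem 0 = c.mem 0 := by rw [hf2.mem 0, hf1.mem 0]
  have m1 : c2.mem 1 = c.mem 1 := by rw [hf2.mem 1, hf1.mem 1]
  have r5 : c3.reg 5 = c2.reg 5 := hf3.reg 5
  have r8 : c3.reg 8 = c.reg 8 := by rw [hf3.reg 8, hf2.reg 8, hf1.reg 8]
  have r9 : c3.reg 9 = c.reg 9 := by rw [hf3.reg 9, hf2.reg 9, hf1.reg 9]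
  refine ⟨⟨⟨⟨L, S3⟩, H.queue.of_eq r8 r9 m9' m11 m12, by rw [m4]; exact i4,
    by rw [m10]; exact H.count, H.truss⟩, by rw [m5]; exact i5, by rw [m6]; exact i6, ?_⟩,
    fun v => ?_, fun u v => ?_, ?_⟩
  · rw [r5, i5']
    have : (∀ q ∈ Q, c1.mem 5 q = Q.length) ↔ ∀ q ∈ Q, reachCount Q A q = Q.length :=
      forall₂_congr fun q hq => by rw [i5 q (E.query q hq)]
    simp only [this]
  · rw [i0, m0, m5']
    congr 2
    exact propext (and_congr_right fun hv => by rw [i5 v hv])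
  · rw [i1, m1, m5', m9]
    congr 2
    refine propext ⟨fun ⟨hu, h1, h2, h3⟩ => ⟨(H.queue.alive u hu v).2 ⟨h1, h2⟩, i5 u hu ▸ h3⟩,
      fun ⟨h1, h2⟩ => ?_⟩
    have hu := (H.queue.le_base h1).1
    obtain ⟨h3, h4⟩ := (H.queue.alive u hu v).1 h1
    exact ⟨hu, h3, h4, by rwa [i5 u hu]⟩
  · have hq : 1 ≤ Q.length := List.length_pos_iff.2 E.nonempty
    have hw := card_le_weight I k X
    have hX : 1 ≤ X.card := by
      obtain ⟨q, hq⟩ := List.exists_mem_of_ne_nil Q E.nonempty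
      exact Finset.card_pos.2 ⟨q, E.query q hq⟩
    generalize weight I k X = W at *
    have h1 : W ≤ Q.length * W := Nat.le_mul_of_pos_left _ hq
    have h2 : Q.length ≤ Q.length * W := Nat.le_mul_of_pos_right _ (by omega)
    omega

open Classical in
/-- The largest query distance of a vertex reached by a query, as measured by the program. -/
noncomputable def eccentricity (Q : List (Fin n)) (A : SimpleGraph (Fin n)) (X : Finset (Fin n)) :
    ℕ :=
  (X.filter fun v => 0 < reachCount Q A v).sup (farthest Q A) - 1

open Classical in
-- The new graph is characterised as the largest `k`-truss inside `A` without edges at distant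
-- vertices. The potential on both sides of the time bound makes the costs of peeling telescope over
-- the rounds.
theorem roundProg_spec {k X hk A} {c : Config} (E : Env I Q U k X) (H : Ready I Q k hk X A c)
    (hl : c.reg 1 < X.card) :
    Run (I.ask Q) U roundProg c fun c' T => ∃ A' : SimpleGraph (Fin n), Ready I Q k hk X A' c' ∧
      (∀ u v, A'.Adj u v → A.Adj u v ∧
        ¬ (0 < reachCount Q A u ∧ min (c.reg 6) (eccentricity Q A X) ≤ farthest Q A u)) ∧
      (∀ K ≤ A, GTruss K k → (∀ u v, K.Adj u v →
        ¬ (0 < reachCount Q A u ∧ min (c.reg 6) (eccentricity Q A X) ≤ farthest Q A u)) →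
        K ≤ A') ∧
      c'.reg 1 = c.reg 1 + 1 ∧ c'.reg 6 = min (c.reg 6) (eccentricity Q A X) ∧
      c'.reg 2 = (if eccentricity Q A X < c.reg 6 then c.reg 1 else c.reg 2) ∧
      (∀ i, c'.mem 2 i = if i = c.reg 1 then eccentricity Q A X else c.mem 2 i) ∧
      (∀ v : Fin n, c'.mem 0 v = c.mem 0 v + if v ∈ X ∧ 0 < reachCount Q A' v then 1 else 0) ∧
      (∀ u v : Fin n, c'.mem 1 (u * n + v) = c.mem 1 (u * n + v) +
        if A'.Adj u v ∧ 0 < reachCount Q A' u then 1 else 0) ∧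
      T + 300 * edgeWork I k A' ≤ 300 * edgeWork I k A + 1000 * (Q.length * weight I k X) := by
  classical
  obtain ⟨L, S⟩ := H.setup
  have hecc : eccentricity Q A X =
      (X.filter fun v => 0 < c.mem 5 (v : Fin n)).sup (fun v => c.mem 6 v) - 1 := by
    rw [eccentricity]
    congr 1
    rw [Finset.filter_congr (q := fun v => 0 < c.mem 5 (v : Fin n))
      fun v hv => by rw [H.reach v hv]]
    exact Finset.sup_congr rfl fun v hv => (H.far v (Finset.mem_filter.1 hv).1).symm
  refine Run.seq ((measure_spec E S hl hecc).conseq ?_)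
  rintro c1 T1 hf1 ⟨i2, i6, ir2, hT1⟩
  have S1 := S.of_frame hf1
  have q1 := H.queue.of_eq (hf1.reg 8) (hf1.reg 9) (hf1.mem 9) (hf1.mem 11) (hf1.mem 12)
  refine Run.seq ((removeFar_spec E S1 q1).conseq ?_)
  rintro c2 T2 hf2 ⟨A1, W, q2, hA1, hT2⟩
  have S2 := S1.of_frame hf2
  have m5 : c1.mem 5 = c.mem 5 := hf1.mem 5
  have m6 : c1.mem 6 = c.mem 6 := hf1.mem 6
  have m10 : c2.mem 10 = c.mem 10 := by rw [hf2.mem 10, hf1.mem 10]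
  -- The reference graph consists of the edges left after the distant vertices have gone; its
  -- trusses are trivially still there.
  refine Run.seq ((peel_spec (S₀ := A1) E S2 q2 (fun K hK _ => hK) (fun x y hxy => ?_)
    (fun x y hxy => by rw [m10]; exact H.count x y hxy)).conseq ?_)
  · rw [m10, H.count x y (q2.le hxy)]
    have := H.truss x y (q2.le hxy)
    omega
  rintro c3 T3 hf3 ⟨A2, q3, hle, hd, hok, hsup, hT3⟩
  have S3 := S2.of_frame hf3
  have hprep : Prepared I Q k hk X A2 c3 := by
    refine ⟨⟨L, S3⟩, q3, ?_, hsup, fun u v huv => ?_⟩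
    · rw [hf3.mem 4, hf2.mem 4, hf1.mem 4]; exact H.marks
    · have h1 := hok u v huv
      rw [hsup u v huv] at h1
      omega
  refine Run.seq ((analyse_spec E hprep).conseq ?_)
  rintro c4 T4 hf4 ⟨hr, i0, i1, hT4⟩
  have e1 : c4.reg 1 = c.reg 1 := by rw [hf4.reg 1, hf3.reg 1, hf2.reg 1, hf1.reg 1]
  have e6 : c4.reg 6 = c1.reg 6 := by rw [hf4.reg 6, hf3.reg 6, hf2.reg 6]
  have e2 : c4.reg 2 = c1.reg 2 := by rw [hf4.reg 2, hf3.reg 2, hf2.reg 2]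
  have m2 : c4.mem 2 = c1.mem 2 := by rw [hf4.mem 2, hf3.mem 2, hf2.mem 2]
  have m0 : c3.mem 0 = c.mem 0 := by rw [hf3.mem 0, hf2.mem 0, hf1.mem 0]
  have m1 : c3.mem 1 = c.mem 1 := by rw [hf3.mem 1, hf2.mem 1, hf1.mem 1]
  obtain ⟨L', S4⟩ := hr.setup
  have hfar : ∀ u ∈ X, (0 < c1.mem 5 u ∧ c1.reg 6 ≤ c1.mem 6 u) ↔
      (0 < reachCount Q A u ∧ min (c.reg 6) (eccentricity Q A X) ≤ farthest Q A u) := by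
    intro u hu
    rw [m5, m6, i6, H.reach u hu, H.far u hu]
  refine Run.assign ⟨A2, ⟨⟨⟨L', S4.setReg⟩, hr.queue.of_eq (by simp) (by simp) rfl rfl rfl, hr.marks,
    hr.count, hr.truss⟩, hr.reach, hr.far, by simpa using hr.flag⟩, fun u v huv => ?_,
    fun K hK hKt hKf => hd K (fun u v huv => ?_) hKt, by simp [e1], by simp [e6, i6],
    by simp [e2, ir2], by simpa [m2] using i2, by simpa [m0] using i0, by simpa [m1] using i1, ?_⟩
  · obtain ⟨h1, h2, h3⟩ := (hA1 u v).1 (hle huv)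
    exact ⟨h1, by rwa [← hfar u (H.queue.le_base h1).1]⟩
  · have h1 := hK huv
    have hb := H.queue.le_base h1
    exact (hA1 u v).2 ⟨h1, by rw [hfar u hb.1]; exact hKf u v huv,
      by rw [hfar v hb.2.1]; exact hKf v u huv.symm⟩
  · have hq : 1 ≤ Q.length := List.length_pos_iff.2 E.nonempty
    have hw := card_le_weight I k X
    generalize weight I k X = W at *
    have h1 : W ≤ Q.length * W := Nat.le_mul_of_pos_left _ hq
    simp only [Expr.cost]
    omega

/-! ### Finding the initial graph -/

/-- The edges of trussness at least `κ`. -/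
def levelGraph (G : SimpleGraph (Fin n)) (κ : ℕ) (hκ : 1 ≤ κ) : SimpleGraph (Fin n) :=
  baseGraph G κ hκ Finset.univ

theorem levelGraph_adj {κ : ℕ} {hκ : 1 ≤ κ} {u v : Fin n} :
    (levelGraph G κ hκ).Adj u v ↔ κ ≤ edgeTrussness G u v := by
  simp [levelGraph, baseGraph]

theorem levelGraph_mono {κ κ' : ℕ} {hκ : 1 ≤ κ} {hκ' : 1 ≤ κ'} (h : κ ≤ κ') :
    levelGraph G κ' hκ' ≤ levelGraph G κ hκ := fun u v huv => by
  rw [levelGraph_adj] at huv ⊢; omega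

theorem weight_anti (I : TrussIndex G) {k κ : ℕ} (hk : 1 ≤ k) (h : k ≤ κ) (X : Finset (Fin n)) :
    weight I κ X ≤ weight I k X := by
  refine Finset.sum_le_sum fun v _ => Nat.add_le_add_right ?_ 1
  rw [← List.toFinset_card_of_nodup (I.nb_nodup κ v), ← List.toFinset_card_of_nodup (I.nb_nodup k v),
    I.toFinset_nb hk, I.toFinset_nb (hk.trans h)]
  exact Finset.card_le_card (Finset.monotone_filter_right _ fun u _ hu => h.trans hu)

open Classical in
-- No level below `k` is tried, so every search stays inside `X` and costs `O(weight I k X)`, and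
-- there are at most `K + 1` of them. By `hbest`, the first level at which `q₀` reaches all of `Q`
-- is `k`.
theorem levelLoop_spec {k X hk} {q₀ : Fin n} {K : ℕ} {c : Config} (E : Env I Q U k X)
    (hX : ∀ v, v ∈ X ↔ (levelGraph G k hk).Reachable q₀ v)
    (hK : K = Finset.univ.sup fun u => edgeTrussness G q₀ u) (hkK : k ≤ K)
    (hbest : ∀ κ hκ, κ ≤ K → (∀ q ∈ Q, (levelGraph G κ hκ).Reachable q₀ q) → κ ≤ k)
    (h0 : c.reg 0 = K) (h3 : c.reg 3 = n) (h4 : c.reg 4 = Q.length) (h5 : c.reg 5 = 0)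
    (h10 : c.reg 10 = q₀) (m4 : ∀ v : Fin n, c.mem 4 v = 0) (m5 : ∀ v : Fin n, c.mem 5 v = 0)
    (m9 : ∀ i, c.mem 9 i = 0) :
    Run (I.ask Q) U levelLoop c fun c' T => c'.reg 0 = k ∧ c'.reg 3 = n ∧ c'.reg 4 = Q.length ∧
      (∀ v : Fin n, c'.mem 4 v = 0) ∧
      (∃ L : List (Fin n), c'.reg 12 = L.length ∧ ListAt c' 3 L ∧ L.Nodup ∧ ∀ v, v ∈ L ↔ v ∈ X) ∧
      T ≤ 500 * ((K + 1) * weight I k X) := by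
  have hXpos : 1 ≤ X.card := by
    obtain ⟨q, hq⟩ := List.exists_mem_of_ne_nil Q E.nonempty
    exact Finset.card_pos.2 ⟨q, E.query q hq⟩
  have hw := card_le_weight I k X
  have hQX : Q.length ≤ X.card := by
    rw [← List.toFinset_card_of_nodup E.nodup]
    exact Finset.card_le_card fun q hq => E.query q (List.mem_toFinset.1 hq)
  have hq₀ : q₀ ∈ X := (hX q₀).2 (SimpleGraph.Reachable.refl _)
  refine Run.loop (fun c' T => c'.reg 5 ≤ 1 ∧ k ≤ c'.reg 0 ∧ c'.reg 0 ≤ K ∧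
      (∀ v : Fin n, c'.mem 4 v = 0) ∧
      (c'.reg 5 = 0 → ∀ v : Fin n, 0 < c'.mem 5 v → ∀ hκ,
        (levelGraph G (c'.reg 0) hκ).Reachable q₀ v) ∧
      (c'.reg 5 = 1 → c'.reg 0 = k ∧ ∃ L : List (Fin n), c'.reg 12 = L.length ∧ ListAt c' 3 L ∧
        L.Nodup ∧ ∀ v, v ∈ L ↔ v ∈ X) ∧
      T ≤ 400 * ((K - c'.reg 0 + c'.reg 5) * weight I k X))
    (fun c' => c'.reg 0 + (1 - c'.reg 5)) ?_ ?_ ?_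
  · refine ⟨by omega, by omega, by omega, m4, fun _ v hv => ?_, by omega, by simp⟩
    simp [m5] at hv
  · rintro c' T hf ⟨i5, ik, iK, i4, ireach, -, hT⟩ hne
    have h5' : c'.reg 5 = 0 := by
      by_contra h; simp [h] at hne
    obtain ⟨κ, hκ⟩ : ∃ κ, κ = c'.reg 0 := ⟨_, rfl⟩
    rw [← hκ] at ik iK hT
    have hκ1 : 1 ≤ κ := hk.trans ik
    simp only [← hκ] at ireach
    have e3 : c'.reg 3 = n := by rw [hf.reg 3, h3]
    have e4 : c'.reg 4 = Q.length := by rw [hf.reg 4, h4]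
    have e10 : c'.reg 10 = q₀ := by rw [hf.reg 10, h10]
    have e9 : c'.mem 9 = c.mem 9 := hf.mem 9
    have hpre : BfsPre I U κ (levelGraph G κ hκ1) X c' := by
      refine ⟨hκ1, fun u hu v h => E.closed u hu v (ik.trans h), fun u hu v => ?_, hκ.symm, e3,
        E.vcell 4 (by simp), E.icell 3 (by simp),
        fun u hu v h => E.ecell 9 (by simp) u hu v (ik.trans h)⟩
      rw [levelGraph_adj, e9, m9]; simp
    refine Run.seq ((bfs_spec hq₀ hpre e10 i4).conseq ?_)
    rintro c1 T1 hf1 ⟨L, hn, hr, hLX, h12, hL, hlab, hT1⟩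
    refine Run.seq ((absorb_spec hn hLX h12 hL (fun v hv => by rw [hlab, if_neg hv])
      (fun v hv => ⟨E.vcell 4 (by simp) v hv, E.vcell 5 (by simp) v hv, E.vcell 6 (by simp) v hv⟩)
      (E.icell 3 (by simp))).conseq ?_)
    rintro c2 T2 hf2 ⟨j4, j5, j6, hT2⟩
    -- Since `κ ≤ K` and `K` is attained by an edge at `q₀`, the search leaves its source, and so
    -- `absorb` really marks what it reached.
    have hnbr : ∃ w, (levelGraph G κ hκ1).Adj q₀ w := by
      by_contra hno
      push Not at hno
      have : K < κ := by
        rw [hK, Finset.sup_lt_iff (by rw [Nat.bot_eq_zero]; omega)]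
        intro u _
        exact Nat.lt_of_not_le fun h => hno u (levelGraph_adj.2 h)
      omega
    have hlong : 1 < L.length := (one_lt_length_iff hn hr).2 hnbr
    have hpos : ∀ v : Fin n, 0 < c2.mem 5 v ↔ (levelGraph G κ hκ1).Reachable q₀ v := by
      intro v
      rw [j5, hf1.mem 5, ← hr]
      constructor
      · intro h
        by_cases hv : v ∈ L
        · exact hv
        · simp only [hv, false_and, if_false, Nat.add_zero] at h
          exact (hr v).2 (ireach h5' v h hκ1)
      · intro h
        simp [h, hlong]
    refine Run.seq (Run.assign (Run.seq (Run.forList E.nodup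
      (fun M c3 => c3.reg 5 = if ∀ q ∈ M, 0 < c2.mem 5 q then 1 else 0) (fun _ => 24)
      (by simp [hf2.reg 4, hf1.reg 4, e4]) (fun _ _ _ h => h) (by simp) ?_ ?_)))
    · intro x hx M c3 hf3 h21 hxM hM hP
      have hxX := E.query _ (Q.getElem_mem hx)
      have e := I.ask_queryNode Q hx 0
      have e5 : c3.mem 5 = c2.mem 5 := hf3.mem 5
      refine Run.seq (Run.ask (Run.seq (Run.load ?_ (Run.assign ⟨?_, by simp⟩))))
      · simpa [h21, e] using E.vcell 5 (by simp) _ hxX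
      · simp only [Finset.mem_insert, forall_eq_or_imp]
        by_cases h1 : 0 < c2.mem 5 Q[x]
        · simp [h21, e, e5, h1, hP]
        · simp [h21, e, e5, h1]
    intro c3 T3 hf3 hP hT3
    simp only [Finset.sum_const, List.toFinset_card_of_nodup E.nodup, smul_eq_mul] at hT3
    have hflag : c3.reg 5 = if ∀ q ∈ Q, (levelGraph G κ hκ1).Reachable q₀ q then 1 else 0 := by
      simpa [hpos] using hP
    have f0 : c3.reg 0 = κ := by
      rw [hf3.reg 0]; simp [hf2.reg 0, hf1.reg 0, hκ]
    have f12 : c3.reg 12 = L.length := by rw [hf3.reg 12]; simp [hf2.reg 12, h12]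
    have f3 : c3.mem 3 = c1.mem 3 := by rw [hf3.mem 3]; simp [hf2.mem 3]
    have f4 : c3.mem 4 = c2.mem 4 := by rw [hf3.mem 4]; simp
    have f5 : c3.mem 5 = c2.mem 5 := by rw [hf3.mem 5]; simp
    have hr' : T + (60 * X.card + Q.length * 32 + 120 * weight I k X + 100) ≤
        400 * ((K - κ + 1) * weight I k X) := by
      rw [Nat.add_mul, one_mul, Nat.mul_add]
      rw [h5', Nat.add_zero] at hT
      omega
    rw [← weight] at hT1
    have hwκ := weight_anti I hk ik X
    refine Run.ite (fun hne => ?_) (fun heq => ?_)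
    · have hall : ∀ q ∈ Q, (levelGraph G κ hκ1).Reachable q₀ q := by
        by_contra hno
        simp [hflag, hno] at hne
      have hkκ : κ = k := le_antisymm (hbest κ hκ1 iK hall) ik
      have hf5 : c3.reg 5 = 1 := by rw [hflag, if_pos hall]
      refine Run.assign ⟨⟨by simp [hf5], by simp [f0, ik], by simp [f0, iK], by simpa [f4] using j4,
        by simp [hf5], fun _ => ⟨by simp [f0, hkκ], L, by simp [f12], hL.of_eq (by simp [f3]), hn,
        fun v => ?_⟩, ?_⟩, ?_⟩
      · subst hkκ
        rw [hr, hX]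
      · simp [f0, hf5] at hT3 ⊢
        omega
      · simp [f0, hf5, h5', ← hκ]
    · have hall : ¬ ∀ q ∈ Q, (levelGraph G κ hκ1).Reachable q₀ q := by
        intro hyes
        rw [if_pos hyes] at hflag
        simp [hflag] at heq
      have hkκ : κ ≠ k := by
        rintro rfl
        exact hall fun q hq => (hX q).1 (E.query q hq)
      have hf5 : c3.reg 5 = 0 := by rw [hflag, if_neg hall]
      refine Run.assign ⟨⟨by simp [hf5], by simp [f0]; omega, by simp [f0]; omega,
        by simpa [f4] using j4, fun _ v hv hκ' => ?_, by simp [hf5], ?_⟩, ?_⟩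
      -- Lowering the level adds edges only, so old marks in array `5` stay valid and need not be
      -- cleared.
      · refine ((hpos v).1 (by simpa [f5] using hv)).mono (levelGraph_mono ?_)
        simp [f0]
      · have : K - (κ - 1) = K - κ + 1 := by omega
        simp [f0, hf5, this] at hT3 ⊢
        omega
      · simp [f0, hf5, h5', ← hκ]; omega
  · rintro c' T hf ⟨i5, ik, iK, i4, -, hend, hT⟩ heq
    have h5' : c'.reg 5 = 1 := by
      have : c'.reg 5 ≠ 0 := by
        intro h; simp [h] at heq
      omega
    obtain ⟨h1, h2⟩ := hend h5'
    refine ⟨h1, by rw [hf.reg 3, h3], by rw [hf.reg 4, h4], i4, h2, ?_⟩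
    have : (K - c'.reg 0 + c'.reg 5) * weight I k X ≤ (K + 1) * weight I k X :=
      Nat.mul_le_mul_right _ (by omega)
    have h6 : weight I k X ≤ (K + 1) * weight I k X := Nat.le_mul_of_pos_left _ (by omega)
    simp only [Expr.cost]
    omega

open Classical in
theorem initProg_spec {k X hk} {q₀ : Fin n} {K : ℕ} (E : Env I Q U k X) (hq : Q.head? = some q₀)
    (hX : ∀ v, v ∈ X ↔ (levelGraph G k hk).Reachable q₀ v)
    (hK : K = Finset.univ.sup fun u => edgeTrussness G q₀ u) (hkK : k ≤ K)
    (hbest : ∀ κ hκ, κ ≤ K → (∀ q ∈ Q, (levelGraph G κ hκ).Reachable q₀ q) → κ ≤ k)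
    (htruss : GTruss (baseGraph G k hk X) k) :
    Run (I.ask Q) U initProg Config.start fun c' T => Ready I Q k hk X (baseGraph G k hk X) c' ∧
      c'.reg 1 = 0 ∧ c'.reg 6 = n ∧
      (∀ v : Fin n, c'.mem 0 v =
        if v ∈ X ∧ 0 < reachCount Q (baseGraph G k hk X) v then 1 else 0) ∧
      (∀ u v : Fin n, c'.mem 1 (u * n + v) = if (baseGraph G k hk X).Adj u v ∧
        0 < reachCount Q (baseGraph G k hk X) u then 1 else 0) ∧
      T ≤ 1000 * ((K + 1) * weight I k X + Q.length * weight I k X +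
        edgeWork I k (baseGraph G k hk X)) := by
  have hlen : 0 < Q.length := List.length_pos_iff.2 E.nonempty
  have hq0 : Q[0] = q₀ := by
    rw [List.head?_eq_getElem?, List.getElem?_eq_getElem hlen] at hq
    simpa using hq
  have e := I.ask_queryNode Q hlen 0
  rw [hq0] at e
  refine Run.seq (Run.ask (Run.seq (Run.ask (Run.seq (Run.ask (Run.seq (Run.ask (Run.seq ?_))))))))
  refine (levelLoop_spec E hX hK hkK hbest (by simp [e, hK]) (by simp) (by simp)
    (by simp [Config.start]) (by simp [e]) (by simp [Config.start]) (by simp [Config.start])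
    (by simp [Config.start])).conseq ?_
  rintro c1 T1 hf1 ⟨h0, h3, h4, m4, ⟨L, h12, hL, hn, hm⟩, hT1⟩
  refine Run.seq ((listVerts_spec E h0 h3 h4 h12 hL hn hm).conseq ?_)
  rintro c2 T2 hf2 ⟨S2, hT2⟩
  refine Run.seq ((supports_spec (hk := hk) E S2).conseq ?_)
  rintro c3 T3 hf3 ⟨h10, hT3⟩
  have S3 := S2.of_frame hf3
  have m4' : c3.mem 4 = c1.mem 4 := by rw [hf3.mem 4, hf2.mem 4]
  have m9 : ∀ i, c3.mem 9 i = 0 := by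
    intro i; rw [hf3.mem 9, hf2.mem 9, hf1.mem 9]; simp [Config.start]
  have m0 : ∀ i, c3.mem 0 i = 0 := by
    intro i; rw [hf3.mem 0, hf2.mem 0, hf1.mem 0]; simp [Config.start]
  have m1 : ∀ i, c3.mem 1 i = 0 := by
    intro i; rw [hf3.mem 1, hf2.mem 1, hf1.mem 1]; simp [Config.start]
  have r8 : c3.reg 8 = 0 := by rw [hf3.reg 8, hf2.reg 8, hf1.reg 8]; simp [Config.start]
  have r9 : c3.reg 9 = 0 := by rw [hf3.reg 9, hf2.reg 9, hf1.reg 9]; simp [Config.start]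
  have r1 : c3.reg 1 = 0 := by rw [hf3.reg 1, hf2.reg 1, hf1.reg 1]; simp [Config.start]
  have hadj : ∀ u ∈ X, ∀ v, (baseGraph G k hk X).Adj u v ↔ k ≤ edgeTrussness G u v :=
    fun u hu v => ⟨fun h => h.2.2, fun h => ⟨hu, E.closed u hu v h, h⟩⟩
  have hprep : Prepared I Q k hk X (baseGraph G k hk X) (c3.setReg 6 n) := by
    refine ⟨⟨L, S3.setReg⟩, ⟨le_rfl, le_rfl, fun u hu v => ?_, fun u hu v => ?_, by simp [r9],
      by simp [r8, r9], by simp, by simp, by simp⟩, by simpa [m4'] using m4,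
      fun x y h => (h10 x y h).trans (add_comm _ _), htruss⟩
    · rw [hadj u hu]; simp [m9]
    · rw [hadj u hu]; simp [m9]
  refine Run.seq (Run.assign ?_)
  simp only [Expr.eval, S3.size]
  refine (analyse_spec E hprep).conseq ?_
  rintro c4 T4 hf4 ⟨hr, i0, i1, hT4⟩
  refine ⟨hr, by rw [hf4.reg 1]; simp [r1], by rw [hf4.reg 6]; simp, by simpa [m0] using i0,
    by simpa [m1] using i1, ?_⟩
  have hw : weight I k X ≤ Q.length * weight I k X := Nat.le_mul_of_pos_left _ hlen
  have hXpos : 1 ≤ X.card := Finset.card_pos.2 ⟨q₀, (hX q₀).2 (SimpleGraph.Reachable.refl _)⟩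
  have hcw := card_le_weight I k X
  simp only [Expr.cost]
  omega

end TrussSearch

namespace TrussSearch

/-! ### Covering graphs by forests -/

section Forests

variable {V : Type*}

/-- A vertex of maximal rank on a cycle would have two different neighbours of smaller rank there.
-/
theorem isAcyclic_of_rank {F : SimpleGraph V} (r : V → ℕ) (h1 : ∀ a b, F.Adj a b → r a ≠ r b)
    (h2 : ∀ a b b', F.Adj a b → F.Adj a b' → r b < r a → r b' < r a → b = b') : F.IsAcyclic := by
  classical
  intro u p hp
  obtain ⟨m, hm, hmax⟩ := p.support.toFinset.exists_max_image r ⟨u, by simp⟩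
  have hm' : m ∈ p.support := by simpa using hm
  have hq := SimpleGraph.Walk.IsCycle.rotate hm' hp
  have hmem : ∀ w, w ∈ (p.rotate m hm').support → r w ≤ r m := fun w hw => hmax w (by
    rw [List.mem_toFinset]
    exact (SimpleGraph.Walk.mem_support_rotate_iff _ _ hm').1 hw)
  have hnil := hq.not_nil
  have a1 := (p.rotate m hm').adj_snd hnil
  have a2 := ((p.rotate m hm').adj_penultimate hnil).symm
  have l1 := lt_of_le_of_ne (hmem _ ((p.rotate m hm').getVert_mem_support 1)) (h1 _ _ a1).symm
  have l2 := lt_of_le_of_ne (hmem _ ((p.rotate m hm').getVert_mem_support _)) (h1 _ _ a2).symm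
  exact hq.snd_ne_penultimate (h2 _ _ _ a1 a2 l1 l2)

/-- The edges of `H` are covered by `c` forests. -/
def CoveredByForests (c : ℕ) (H : SimpleGraph V) : Prop :=
  ∃ F : Fin c → SimpleGraph V, (∀ i, F i ≤ H ∧ (F i).IsAcyclic) ∧ H ≤ ⨆ i, F i

theorem eq_of_reachable_of_isolated {F : SimpleGraph V} {v u : V} (hv : ∀ w, ¬ F.Adj v w)
    (h : F.Reachable v u) : v = u := by
  obtain ⟨p⟩ := h
  cases p with
  | nil => rfl
  | cons h _ => exact absurd h (hv _)

variable [Finite V]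

/-- A set with fewer than `c` elements is padded by the default value `v`. -/
theorem exists_enumeration {s : Set V} {c : ℕ} (h : s.ncard ≤ c) (v : V) :
    ∃ f : Fin c → V, (∀ i, f i = v ∨ f i ∈ s) ∧ ∀ w ∈ s, ∃ i, f i = w := by
  classical
  obtain ⟨t, rfl⟩ : ∃ t : Finset V, (t : Set V) = s := ⟨_, s.toFinite.coe_toFinset⟩
  rw [Set.ncard_coe_finset] at h
  refine ⟨fun i => t.toList.getD i v, fun i => ?_, fun w hw => ?_⟩
  · rcases Nat.lt_or_ge i t.toList.length with hi | hi
    · right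
      simp only [List.getD_eq_getElem _ _ hi]
      exact Finset.mem_coe.2 (Finset.mem_toList.1 (List.getElem_mem hi))
    · left
      exact List.getD_eq_default _ _ hi
  · obtain ⟨i, hi, rfl⟩ := List.getElem_of_mem (Finset.mem_toList.2 (Finset.mem_coe.1 hw))
    have hi' : i < c := by rw [Finset.length_toList] at hi; omega
    exact ⟨⟨i, hi'⟩, List.getD_eq_getElem _ _ hi⟩

/-- The vertex `v` is isolated in each given forest, so one edge at `v` can be hung on each of them
without closing a cycle. The padding `f i = v` yields a loop, that is, no edge. -/
theorem CoveredByForests.of_deleteIncidenceSet {c : ℕ} {H : SimpleGraph V} {v : V}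
    (hv : (H.neighborSet v).ncard ≤ c) (h : CoveredByForests c (H.deleteIncidenceSet v)) :
    CoveredByForests c H := by
  obtain ⟨F, hF, hcov⟩ := h
  obtain ⟨f, hf, hf'⟩ := exists_enumeration hv v
  refine ⟨fun i => F i ⊔ SimpleGraph.edge v (f i), fun i => ⟨?_, ?_⟩, fun a b hab => ?_⟩
  · refine sup_le ((hF i).1.trans (H.deleteIncidenceSet_le v)) fun a b hab => ?_
    rw [SimpleGraph.edge_adj] at hab
    obtain ⟨⟨rfl, rfl⟩ | ⟨rfl, rfl⟩, hne⟩ := hab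
    · exact (hf i).resolve_left fun h => hne h.symm
    · exact ((hf i).resolve_left fun h => hne h).symm
  · refine SimpleGraph.isAcyclic_sup_fromEdgeSet_iff.2 ⟨(hF i).2, fun hr => Or.inl ?_⟩
    refine eq_of_reachable_of_isolated (fun w hw => ?_) hr
    exact (SimpleGraph.deleteIncidenceSet_adj.1 ((hF i).1 hw)).2.1 rfl
  · rw [SimpleGraph.iSup_adj]
    by_cases ha : a = v
    · obtain ⟨i, hi⟩ := hf' b (ha ▸ hab)
      exact ⟨i, Or.inr ((SimpleGraph.edge_adj _ _ _ _).2 ⟨Or.inl ⟨ha, hi.symm⟩, hab.ne⟩)⟩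
    by_cases hb : b = v
    · obtain ⟨i, hi⟩ := hf' a (hb ▸ hab.symm)
      exact ⟨i, Or.inr ((SimpleGraph.edge_adj _ _ _ _).2 ⟨Or.inr ⟨hi.symm, hb⟩, hab.ne⟩)⟩
    · obtain ⟨i, hi⟩ := SimpleGraph.iSup_adj.1
        (hcov (SimpleGraph.deleteIncidenceSet_adj.2 ⟨hab, ha, hb⟩))
      exact ⟨i, Or.inl hi⟩

omit [Finite V] in
theorem coveredByForests_of_forall_not_adj {c : ℕ} {H : SimpleGraph V} (h : ∀ a b, ¬ H.Adj a b) :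
    CoveredByForests c H :=
  ⟨fun _ => ⊥, fun _ => ⟨bot_le, SimpleGraph.isAcyclic_bot⟩, fun a b hab => absurd hab (h a b)⟩

omit [Finite V] in
theorem ncard_neighborSet [Fintype V] (H : SimpleGraph V) [DecidableRel H.Adj] (v : V) :
    (H.neighborSet v).ncard = H.degree v := by
  rw [Set.ncard_eq_toFinset_card', ← SimpleGraph.card_neighborFinset_eq_degree]
  rfl

theorem ncard_edgeSet_deleteIncidenceSet (H : SimpleGraph V) (v : V) :
    (H.deleteIncidenceSet v).edgeSet.ncard + (H.neighborSet v).ncard = H.edgeSet.ncard := by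
  classical
  have := Fintype.ofFinite V
  have h := H.card_edgeFinset_deleteIncidenceSet v
  have h' : H.degree v ≤ H.edgeFinset.card := by
    rw [← SimpleGraph.card_incidenceFinset_eq_degree]
    exact Finset.card_le_card (H.incidenceFinset_subset v)
  rw [← SimpleGraph.coe_edgeFinset, Set.ncard_coe_finset, ← SimpleGraph.coe_edgeFinset,
    Set.ncard_coe_finset, h, ncard_neighborSet]
  omega

/-- Graphs of maximum degree `c` are covered by `c` forests. -/
theorem coveredByForests_of_degree_le {c : ℕ} {H : SimpleGraph V}
    (h : ∀ v, (H.neighborSet v).ncard ≤ c) : CoveredByForests c H := by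
  induction hm : H.edgeSet.ncard using Nat.strong_induction_on generalizing H with
  | _ m ih =>
    by_cases hE : ∃ a b, H.Adj a b
    · obtain ⟨a, b, hab⟩ := hE
      have hpos : 0 < (H.neighborSet a).ncard := (Set.ncard_pos (Set.toFinite _)).2 ⟨b, hab⟩
      have hdel := ncard_edgeSet_deleteIncidenceSet H a
      refine CoveredByForests.of_deleteIncidenceSet (h a) (ih _ (by omega) (fun v => ?_) rfl)
      exact (Set.ncard_le_ncard (fun w hw => H.deleteIncidenceSet_le a hw) (Set.toFinite _)).trans
        (h v)
    · push Not at hE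
      exact coveredByForests_of_forall_not_adj hE

/-! ### Graphs with few edges -/

/-- The double star with the centres `(i, false)` and `(i, true)`; these trees decompose a complete
graph. -/
def doubleStar (c : ℕ) (i : Fin c) (p q : Fin c × Bool) : Prop :=
  p.1 = i ∧ (q.1 = i ∨ i < q.1 ∧ q.2 = p.2 ∨ q.1 < i ∧ q.2 ≠ p.2)

/-- Vertices with indices `i < j` are joined in star `i` if their bits agree and in star `j` if they
differ. -/
theorem exists_doubleStar {c : ℕ} {p q : Fin c × Bool} :
    ∃ i, doubleStar c i p q ∨ doubleStar c i q p := by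
  rcases lt_trichotomy p.1 q.1 with h | h | h
  · by_cases hb : q.2 = p.2
    · exact ⟨p.1, Or.inl ⟨rfl, Or.inr (Or.inl ⟨h, hb⟩)⟩⟩
    · exact ⟨q.1, Or.inr ⟨rfl, Or.inr (Or.inr ⟨h, Ne.symm hb⟩)⟩⟩
  · exact ⟨p.1, Or.inl ⟨rfl, Or.inl h.symm⟩⟩
  · by_cases hb : q.2 = p.2
    · exact ⟨q.1, Or.inr ⟨rfl, Or.inr (Or.inl ⟨h, hb.symm⟩)⟩⟩
    · exact ⟨p.1, Or.inl ⟨rfl, Or.inr (Or.inr ⟨h, hb⟩)⟩⟩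

omit [Finite V] in
-- Ranking the two centres `0` and `1` and all leaves `2`, each vertex has at most one neighbour of
-- smaller rank.
theorem isAcyclic_of_doubleStar {c : ℕ} (i : Fin c) {F : SimpleGraph V} (φ : V → Fin c × Bool)
    (hφ : ∀ a b a' b', F.Adj a b → F.Adj a' b' → φ a = φ a' → a = a')
    (hF : ∀ a b, F.Adj a b → doubleStar c i (φ a) (φ b) ∨ doubleStar c i (φ b) (φ a)) :
    F.IsAcyclic := by
  set r : V → ℕ := fun a => if (φ a).1 = i then (if (φ a).2 then 1 else 0) else 2 with hr
  refine isAcyclic_of_rank r (fun a b hab h => ?_) fun a b b' hab hab' h h' => ?_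
  · have hne : φ a ≠ φ b := fun h => hab.ne (hφ a b b a hab hab.symm h)
    have hne' : (φ a).1 = (φ b).1 → (φ a).2 ≠ (φ b).2 := fun h h' => hne (Prod.ext h h')
    have key := hF a b hab
    simp only [hr] at h
    unfold doubleStar at key
    by_cases h1 : (φ a).1 = i <;> by_cases h2 : (φ b).1 = i
    · have := hne' (h1.trans h2.symm)
      cases h3 : (φ a).2 <;> cases h4 : (φ b).2 <;> simp_all
    · cases h3 : (φ a).2 <;> simp_all
    · cases h3 : (φ b).2 <;> simp_all
    · rcases key with key | key
      · exact h1 key.1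
      · exact h2 key.1
  · refine hφ b a b' a hab.symm hab'.symm ?_
    have key := hF a b hab
    have key' := hF a b' hab'
    unfold doubleStar at key key'
    simp only [hr] at h h'
    by_cases h1 : (φ a).1 = i
    · by_cases h2 : (φ b).1 = i <;> by_cases h2' : (φ b').1 = i
      · refine Prod.ext (h2.trans h2'.symm) ?_
        cases h3 : (φ a).2 <;> cases h4 : (φ b).2 <;> cases h5 : (φ b').2 <;> simp_all
      · cases h3 : (φ a).2 <;> simp_all
      · cases h3 : (φ a).2 <;> simp_all
      · cases h3 : (φ a).2 <;> simp_all
    · have k1 := key.resolve_left fun h => h1 h.1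
      have k2 := key'.resolve_left fun h => h1 h.1
      refine Prod.ext (k1.1.trans k2.1.symm) ?_
      have k1' := k1.2.resolve_left h1
      have k2' := k2.2.resolve_left h1
      rcases k1' with ⟨x1, y1⟩ | ⟨x1, y1⟩ <;> rcases k2' with ⟨x2, y2⟩ | ⟨x2, y2⟩
      · exact y1.symm.trans y2
      · exact absurd x1 (lt_asymm x2)
      · exact absurd x1 (lt_asymm x2)
      · cases h3 : (φ a).2 <;> cases h4 : (φ b).2 <;> cases h5 : (φ b').2 <;> simp_all

/-- The part of `H` that a labelling maps into a double star. -/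
def starPart {c : ℕ} (H : SimpleGraph V) (φ : V → Fin c × Bool) (i : Fin c) : SimpleGraph V where
  Adj a b := H.Adj a b ∧ (doubleStar c i (φ a) (φ b) ∨ doubleStar c i (φ b) (φ a))
  symm := ⟨fun _ _ h => ⟨h.1.symm, h.2.symm⟩⟩
  loopless := ⟨fun _ h => h.1.ne rfl⟩

omit [Finite V] in
theorem starPart_le {c : ℕ} (H : SimpleGraph V) (φ : V → Fin c × Bool) (i : Fin c) :
    starPart H φ i ≤ H := fun _ _ h => h.1

omit [Finite V] in
theorem isAcyclic_starPart {c : ℕ} {H : SimpleGraph V} {φ : V → Fin c × Bool}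
    (hφ : Set.InjOn φ H.support) (i : Fin c) : (starPart H φ i).IsAcyclic :=
  isAcyclic_of_doubleStar i φ (fun _ b _ b' h h' e => hφ ⟨b, h.1⟩ ⟨b', h'.1⟩ e) fun _ _ h => h.2

omit [Finite V] in
theorem le_iSup_starPart {c : ℕ} (H : SimpleGraph V) (φ : V → Fin c × Bool) :
    H ≤ ⨆ i, starPart H φ i := fun a b hab => by
  rw [SimpleGraph.iSup_adj]
  obtain ⟨i, hi⟩ := exists_doubleStar (p := φ a) (q := φ b)
  exact ⟨i, hab, hi⟩

theorem exists_injOn {c : ℕ} (hc : 0 < c) {S : Set V} (hS : S.ncard ≤ 2 * c) :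
    ∃ φ : V → Fin c × Bool, Set.InjOn φ S := by
  classical
  have := Fintype.ofFinite V
  have hcard : Fintype.card S ≤ Fintype.card (Fin c × Bool) := by
    rw [Set.fintypeCard_eq_ncard]
    simpa [mul_comm] using hS
  obtain ⟨e⟩ := Function.Embedding.nonempty_of_card_le hcard
  refine ⟨fun a => if h : a ∈ S then e ⟨a, h⟩ else (⟨0, hc⟩, false), fun a ha b hb h => ?_⟩
  simp only [ha, hb, dif_pos] at h
  simpa using e.injective h

theorem exists_injOn_of_ne {c : ℕ} {S : Set V} (hS : S.ncard ≤ 2 * (c + 1)) {x y : V}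
    (hx : x ∈ S) (hy : y ∈ S) (hxy : x ≠ y) :
    ∃ φ : V → Fin (c + 1) × Bool, Set.InjOn φ S ∧ φ x = (0, false) ∧ φ y = (0, true) := by
  obtain ⟨φ, hφ⟩ := exists_injOn (Nat.succ_pos c) hS
  set σ := Equiv.swap (φ x) (0, false)
  have h1 : σ (φ x) = (0, false) := Equiv.swap_apply_left _ _
  have h2 : σ (φ y) ≠ (0, false) := by
    rw [← h1]
    exact fun h => hxy (hφ hx hy (σ.injective h).symm)
  set ρ := Equiv.swap (σ (φ y)) (0, true)
  refine ⟨fun a => ρ (σ (φ a)), (ρ.injective.comp σ.injective).injOn.comp hφ (Set.mapsTo_univ _ _),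
    ?_, Equiv.swap_apply_left _ _⟩
  simp only [h1]
  exact Equiv.swap_apply_of_ne_of_ne h2.symm (by simp)

omit [Finite V] in
theorem sum_ncard_neighborSet [Fintype V] (H : SimpleGraph V) :
    ∑ v, (H.neighborSet v).ncard = 2 * H.edgeSet.ncard := by
  classical
  have h := H.sum_degrees_eq_twice_card_edges
  rw [← SimpleGraph.coe_edgeFinset, Set.ncard_coe_finset, ← h]
  exact Finset.sum_congr rfl fun v _ => ncard_neighborSet H v

theorem ncard_mul_le {H : SimpleGraph V} {S : Set V} {d : ℕ}
    (h : ∀ v ∈ S, d ≤ (H.neighborSet v).ncard) : S.ncard * d ≤ 2 * H.edgeSet.ncard := by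
  classical
  have := Fintype.ofFinite V
  rw [← sum_ncard_neighborSet]
  obtain ⟨t, rfl⟩ : ∃ t : Finset V, (t : Set V) = S := ⟨_, S.toFinite.coe_toFinset⟩
  rw [Set.ncard_coe_finset, ← smul_eq_mul]
  exact (Finset.card_nsmul_le_sum t _ d fun v hv => h v (Finset.mem_coe.2 hv)).trans
    (Finset.sum_le_sum_of_subset (Finset.subset_univ t))

/-- Attaching a vertex `v` of degree at most `c + 2` to a graph on `2c + 2` vertices that is not
complete. -/
theorem coveredByForests_of_missing_edge {c : ℕ} {H : SimpleGraph V} {v x y : V}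
    (hsupp : H.support.ncard ≤ 2 * (c + 1) + 1) (hv : v ∈ H.support)
    (hdeg : (H.neighborSet v).ncard = c + 2) (hx : x ∈ H.support \ {v}) (hy : y ∈ H.support \ {v})
    (hne : x ≠ y) (hxy : ¬ H.Adj x y) : CoveredByForests (c + 1) H := by
  classical
  have hS := Set.ncard_sdiff_singleton_add_one hv (Set.toFinite _)
  obtain ⟨φ, hφ, hφx, hφy⟩ := exists_injOn_of_ne (c := c) (S := H.support \ {v}) (by omega) hx hy hne
  set H' := H.deleteIncidenceSet v with hH'
  have hsub : H'.support ⊆ H.support \ {v} := H.support_deleteIncidenceSet_subset v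
  have hiso : ∀ i w, ¬ (starPart H' φ i).Adj v w := fun i w h =>
    (SimpleGraph.deleteIncidenceSet_adj.1 h.1).2.1 rfl
  have hNS : H.neighborSet v ⊆ H.support \ {v} := fun w hw =>
    ⟨⟨v, hw.symm⟩, fun h => hw.ne h.symm⟩
  -- The `c + 2` neighbours of `v` cannot all carry the same bit, since only `c + 1` labels do.
  have hside : ∀ β : Bool, ∃ a ∈ H.neighborSet v, (φ a).2 = β := by
    intro β
    by_contra hno
    push Not at hno
    have hinj : Set.InjOn (fun a => (φ a).1) (H.neighborSet v) := by
      intro a ha b hb hab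
      refine hφ (hNS ha) (hNS hb) (Prod.ext hab ?_)
      have h1 := hno a ha
      have h2 := hno b hb
      cases β <;> simp_all
    have h1 := hinj.ncard_image
    have h2 := Set.ncard_le_ncard (Set.subset_univ ((fun a => (φ a).1) '' H.neighborSet v))
    rw [Set.ncard_univ, Nat.card_fin] at h2
    omega
  obtain ⟨a, ha, ha'⟩ := hside false
  obtain ⟨b, hb, hb'⟩ := hside true
  have hab : b ≠ a := by rintro rfl; simp_all
  have hcard : ((H.neighborSet v \ {a}) \ {b}).ncard ≤ c := by
    have h1 := Set.ncard_sdiff_singleton_add_one ha (Set.toFinite _)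
    have h2 := Set.ncard_sdiff_singleton_add_one (s := H.neighborSet v \ {a}) (a := b) ⟨hb, hab⟩
      (Set.toFinite _)
    omega
  obtain ⟨f, hf, hf'⟩ := exists_enumeration hcard v
  set g : Fin (c + 1) → V := Fin.cons b f with hg
  have hgN : ∀ i, g i = v ∨ H.Adj v (g i) := by
    intro i
    refine Fin.cases ?_ (fun j => ?_) i
    · exact Or.inr hb
    · rw [hg, Fin.cons_succ]
      exact (hf j).imp_right fun h => h.1.1
  have hg' : ∀ w, H.Adj v w → w ≠ a → ∃ i, g i = w := by
    intro w hw hwa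
    by_cases hwb : w = b
    · exact ⟨0, by simp [hg, hwb]⟩
    · obtain ⟨j, hj⟩ := hf' w ⟨⟨hw, hwa⟩, hwb⟩
      exact ⟨j.succ, by simp [hg, hj]⟩
  have hedge : ∀ w, w = v ∨ H.Adj v w → SimpleGraph.edge v w ≤ H := by
    intro w hw p q hpq
    rw [SimpleGraph.edge_adj] at hpq
    obtain ⟨⟨rfl, rfl⟩ | ⟨rfl, rfl⟩, hne⟩ := hpq
    · exact hw.resolve_left fun h => hne h.symm
    · exact (hw.resolve_left fun h => hne h).symm
  have hleaf : ∀ i, (starPart H' φ i ⊔ SimpleGraph.edge v (g i)).IsAcyclic := fun i =>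
    SimpleGraph.isAcyclic_sup_fromEdgeSet_iff.2 ⟨isAcyclic_starPart (hφ.mono hsub) i,
      fun hr => Or.inl (eq_of_reachable_of_isolated (hiso i) hr)⟩
  refine ⟨fun i => (starPart H' φ i ⊔ SimpleGraph.edge v (g i)) ⊔
    SimpleGraph.edge v (if i = 0 then a else v), fun i => ⟨?_, ?_⟩, fun p q hpq => ?_⟩
  · refine sup_le (sup_le ((starPart_le _ _ _).trans (H.deleteIncidenceSet_le v)) (hedge _ (hgN i)))
      (hedge _ ?_)
    split
    · exact Or.inr ha
    · exact Or.inl rfl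
  · refine SimpleGraph.isAcyclic_sup_fromEdgeSet_iff.2 ⟨hleaf i, fun hr => Or.inl ?_⟩
    split at hr
    case isFalse h => rw [if_neg h]
    case isTrue h =>
      subst h
      exfalso
      -- Because the centre edge `xy` is missing, star `0` has no edge between labels of different
      -- bits. So `v`, already joined to `b` on one side, does not reach `a` on the other, and a
      -- second edge at `v` fits into this forest.
      have hclosed : ∀ p q, (starPart H' φ 0 ⊔ SimpleGraph.edge v (g 0)).Adj p q →
          (p = v ∨ (φ p).2 = true) → (q = v ∨ (φ q).2 = true) := by
        rintro p q (hpq | hpq) hp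
        · have hpv := (SimpleGraph.deleteIncidenceSet_adj.1 hpq.1).2.1
          have hadj := (SimpleGraph.deleteIncidenceSet_adj.1 hpq.1).1
          refine Or.inr ?_
          have hp' := hp.resolve_left hpv
          have hmem := hsub ⟨q, hpq.1⟩
          have hmem' := hsub ⟨p, hpq.1.symm⟩
          have hcent : ¬ ((φ p).1 = 0 ∧ (φ q).1 = 0 ∧ (φ q).2 = false) := by
            rintro ⟨h1, h2, h3⟩
            have e1 : p = y := hφ hmem hy (by rw [hφy]; exact Prod.ext h1 hp')
            have e2 : q = x := hφ hmem' hx (by rw [hφx]; exact Prod.ext h2 h3)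
            exact hxy (e1 ▸ e2 ▸ hadj.symm)
          rcases hpq.2 with ⟨h1, h2 | h2 | h2⟩ | ⟨h1, h2 | h2 | h2⟩
          · by_contra h
            exact hcent ⟨h1, h2, by simpa using h⟩
          · rw [h2.2, hp']
          · exact absurd h2.1 (Fin.not_lt_zero _)
          · by_contra h
            exact hcent ⟨h2, h1, by simpa using h⟩
          · rw [← h2.2, hp']
          · exact absurd h2.1 (Fin.not_lt_zero _)
        · rw [SimpleGraph.edge_adj] at hpq
          obtain ⟨⟨rfl, rfl⟩ | ⟨rfl, rfl⟩, -⟩ := hpq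
          · exact Or.inr (by simpa [hg] using hb')
          · exact Or.inl rfl
      have hreach : ∀ {p q}, (starPart H' φ 0 ⊔ SimpleGraph.edge v (g 0)).Walk p q →
          (p = v ∨ (φ p).2 = true) → (q = v ∨ (φ q).2 = true) := by
        intro p q w
        induction w with
        | nil => exact id
        | cons h _ ih => exact fun hp => ih (hclosed _ _ h hp)
      obtain ⟨w⟩ := hr
      rcases hreach w (Or.inl rfl) with h | h
      · exact ha.ne h.symm
      · rw [ha'] at h; exact Bool.false_ne_true h
  · rw [SimpleGraph.iSup_adj]
    have key : ∀ w, H.Adj v w → ∃ i, ((starPart H' φ i ⊔ SimpleGraph.edge v (g i)) ⊔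
        SimpleGraph.edge v (if i = 0 then a else v)).Adj v w := by
      intro w hw
      by_cases hwa : w = a
      · exact ⟨0, Or.inr ((SimpleGraph.edge_adj _ _ _ _).2 ⟨Or.inl ⟨rfl, by simp [hwa]⟩, hw.ne⟩)⟩
      · obtain ⟨i, hi⟩ := hg' w hw hwa
        exact ⟨i, Or.inl (Or.inr ((SimpleGraph.edge_adj _ _ _ _).2 ⟨Or.inl ⟨rfl, hi.symm⟩, hw.ne⟩))⟩
    by_cases hp : p = v
    · subst hp; exact key q hpq
    by_cases hq : q = v
    · subst hq
      obtain ⟨i, hi⟩ := key p hpq.symm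
      exact ⟨i, hi.symm⟩
    · obtain ⟨i, hi⟩ := SimpleGraph.iSup_adj.1 (le_iSup_starPart H' φ
        (SimpleGraph.deleteIncidenceSet_adj.2 ⟨hpq, hp, hq⟩))
      exact ⟨i, Or.inl (Or.inl hi)⟩

/-- Graphs with less than `(c + 1) ^ 2` edges are covered by `c` forests when `c ≥ 2`. -/
theorem coveredByForests_of_edges_le {c : ℕ} (hc : 2 ≤ c) {H : SimpleGraph V}
    (hm : H.edgeSet.ncard ≤ c ^ 2 + 2 * c) : CoveredByForests c H := by
  classical
  induction hE : H.edgeSet.ncard using Nat.strong_induction_on generalizing H with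
  | _ m ih =>
    by_cases hlow : ∃ v ∈ H.support, (H.neighborSet v).ncard ≤ c
    · obtain ⟨v, ⟨w, hw⟩, hv⟩ := hlow
      have hpos : 0 < (H.neighborSet v).ncard := (Set.ncard_pos (Set.toFinite _)).2 ⟨w, hw⟩
      have hdel := ncard_edgeSet_deleteIncidenceSet H v
      exact CoveredByForests.of_deleteIncidenceSet hv (ih _ (by omega) (by omega) rfl)
    push Not at hlow
    -- With minimum degree at least `c + 1`, a support of `2c + 2` vertices would give `2(c + 1)² ≤
    -- 2(c² + 2c)`.
    have hsum := ncard_mul_le (H := H) (S := H.support) (d := c + 1) hlow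
    have hsupp : H.support.ncard ≤ 2 * c + 1 := by
      by_contra hcon
      have : (2 * c + 2) * (c + 1) ≤ H.support.ncard * (c + 1) :=
        Nat.mul_le_mul_right _ (by omega)
      nlinarith
    rcases Nat.lt_or_ge (2 * c) H.support.ncard with hbig | hsmall
    -- Otherwise all degrees are at least `c + 2`, and `(2c + 1)(c + 2)` exceeds `2(c² + 2c)`.
    · have hexact : ∃ v ∈ H.support, (H.neighborSet v).ncard = c + 1 := by
        by_contra hno
        push Not at hno
        have h1 := ncard_mul_le (H := H) (S := H.support) (d := c + 2) fun v hv => by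
          have := hlow v hv
          have := hno v hv
          omega
        have : (2 * c + 1) * (c + 2) ≤ H.support.ncard * (c + 2) :=
          Nat.mul_le_mul_right _ (by omega)
        nlinarith
      obtain ⟨v, hv, hdeg⟩ := hexact
      have hS := Set.ncard_sdiff_singleton_add_one hv (Set.toFinite _)
      have hdel := ncard_edgeSet_deleteIncidenceSet H v
      -- A complete graph on the other `2c` vertices would give `2c(2c - 1) ≤ 2(c² + c - 1)`, that
      -- is `(c - 1)² ≤ 0`; this uses `c ≥ 2`.
      obtain ⟨x, hx, y, hy, hne, hxy⟩ : ∃ x ∈ H.support \ {v}, ∃ y ∈ H.support \ {v}, x ≠ y ∧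
          ¬ H.Adj x y := by
        by_contra hno
        push Not at hno
        have h1 := ncard_mul_le (H := H.deleteIncidenceSet v) (S := H.support \ {v})
          (d := 2 * c - 1) fun u hu => by
            have h2 := Set.ncard_sdiff_singleton_add_one hu (Set.toFinite _)
            have h3 : (H.support \ {v}) \ {u} ⊆ (H.deleteIncidenceSet v).neighborSet u :=
              fun w hw => SimpleGraph.deleteIncidenceSet_adj.2
                ⟨hno u hu w hw.1 (fun h => hw.2 h.symm), hu.2, hw.1.2⟩
            have h4 := Set.ncard_le_ncard h3 (Set.toFinite _)
            omega
        have h5 : (H.support \ {v}).ncard = 2 * c := by omega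
        rw [h5] at h1
        obtain ⟨d, rfl⟩ : ∃ d, c = d + 2 := ⟨c - 2, by omega⟩
        have h6 : 2 * (d + 2) - 1 = 2 * d + 3 := by omega
        rw [h6] at h1
        nlinarith
      obtain ⟨d, rfl⟩ : ∃ d, c = d + 1 := ⟨c - 1, by omega⟩
      exact coveredByForests_of_missing_edge hsupp hv hdeg hx hy hne hxy
    · obtain ⟨φ, hφ⟩ := exists_injOn (by omega : 0 < c) hsmall
      exact ⟨starPart H φ, fun i => ⟨starPart_le _ _ _, isAcyclic_starPart hφ i⟩,
        le_iSup_starPart H φ⟩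

/-- A graph with at most three edges that has a cycle is a triangle. -/
theorem triangle_of_not_isAcyclic {H : SimpleGraph V} (hm : H.edgeSet.ncard ≤ 3)
    (h : ¬ H.IsAcyclic) : H.edgeSet.ncard = 3 ∧ H.support.ncard = 3 := by
  classical
  simp only [SimpleGraph.IsAcyclic, not_forall, not_not] at h
  obtain ⟨u, p, hp⟩ := h
  have h3 := hp.three_le_length
  have hsub : (p.edges.toFinset : Set (Sym2 V)) ⊆ H.edgeSet := fun e he =>
    p.edges_subset_edgeSet (List.mem_toFinset.1 (Finset.mem_coe.1 he))
  have hcard : (p.edges.toFinset : Set (Sym2 V)).ncard = p.length := by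
    rw [Set.ncard_coe_finset, List.toFinset_card_of_nodup hp.edges_nodup, p.length_edges]
  have hle := Set.ncard_le_ncard hsub (Set.toFinite _)
  have heq : (p.edges.toFinset : Set (Sym2 V)) = H.edgeSet :=
    Set.eq_of_subset_of_ncard_le hsub (by omega) (Set.toFinite _)
  refine ⟨by omega, ?_⟩
  have hs : H.support = (p.support.tail.toFinset : Set V) := by
    ext v
    have htail : v ∈ p.support ↔ v ∈ p.support.tail := by
      rw [SimpleGraph.Walk.mem_support_iff]
      refine ⟨fun h => h.elim (fun h => ?_) id, Or.inr⟩
      rw [h]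
      exact SimpleGraph.Walk.end_mem_tail_support hp.not_nil
    rw [List.coe_toFinset, Set.mem_ofPred_eq, ← htail]
    constructor
    · rintro ⟨w, hw⟩
      have : s(v, w) ∈ (p.edges.toFinset : Set (Sym2 V)) := by rw [heq]; exact hw
      exact p.fst_mem_support_of_mem_edges (List.mem_toFinset.1 (Finset.mem_coe.1 this))
    · intro hv
      obtain ⟨e, he, hve⟩ := (p.mem_support_iff_exists_mem_edges_of_not_nil hp.not_nil).1 hv
      have hadj := p.edges_subset_edgeSet he
      obtain ⟨w, rfl⟩ := Sym2.mem_iff_exists.1 hve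
      exact ⟨w, hadj⟩
  rw [hs, Set.ncard_coe_finset, List.toFinset_card_of_nodup hp.support_nodup]
  simp; omega

end Forests

end TrussSearch

namespace TrussSearch

/-! ### Arboricity -/

section Arboricity

variable {V : Type*}

open Classical in
/-- An edge of a forest can be charged to one of its ends, no vertex being charged twice. -/
theorem sum_min_le_of_isAcyclic [Fintype V] {F : SimpleGraph V} (hF : F.IsAcyclic) (w : V → ℕ) :
    ∑ a, ∑ b, (if F.Adj a b then min (w a) (w b) else 0) ≤ 2 * ∑ v, w v := by
  cases isEmpty_or_nonempty V
  · simp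
  -- The forest is extended to a spanning tree of the complete graph and rooted. Each edge is
  -- charged to its end farther from the root, which determines it as the edge to the parent. The
  -- factor `2` comes from counting ordered pairs.
  obtain ⟨T, hFT, -, hT⟩ := (SimpleGraph.connected_top (V := V)).exists_isTree_le_of_le_of_isAcyclic
    le_top hF
  obtain ⟨r⟩ := ‹Nonempty V›
  set D : V → V → Prop := fun a b => T.Adj a b ∧ T.dist r b < T.dist r a with hD
  have huniq : ∀ a b b', D a b → D a b' → b = b' := by
    have key : ∀ a b, D a b → ∃ p : T.Walk r a, p.IsPath ∧ p.penultimate = b := by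
      rintro a b ⟨hab, hlt⟩
      obtain ⟨p, hp⟩ := (hT.connected.preconnected r b).exists_walk_length_eq_dist
      refine ⟨p.concat hab.symm, SimpleGraph.Walk.isPath_of_length_eq_dist _ ?_, by simp⟩
      have h1 := SimpleGraph.dist_le (p.concat hab.symm)
      rw [SimpleGraph.Walk.length_concat] at h1 ⊢
      omega
    intro a b b' h h'
    obtain ⟨p, hp, rfl⟩ := key a b h
    obtain ⟨p', hp', rfl⟩ := key a b' h'
    have := (hT.isAcyclic.subsingleton_path r a).elim ⟨p, hp⟩ ⟨p', hp'⟩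
    rw [Subtype.mk.injEq] at this
    rw [this]
  have hsum : ∑ a, ∑ b, (if D a b then w a else 0) ≤ ∑ v, w v := by
    refine Finset.sum_le_sum fun a _ => ?_
    rw [← Finset.sum_filter, Finset.sum_const, smul_eq_mul]
    refine (Nat.mul_le_mul_right _ (Finset.card_le_one.2 fun b hb b' hb' => ?_)).trans
      (one_mul _).le
    exact huniq a b b' (Finset.mem_filter.1 hb).2 (Finset.mem_filter.1 hb').2
  calc ∑ a, ∑ b, (if F.Adj a b then min (w a) (w b) else 0)
      ≤ ∑ a, ∑ b, ((if D a b then w a else 0) + if D b a then w b else 0) := by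
        refine Finset.sum_le_sum fun a _ => Finset.sum_le_sum fun b _ => ?_
        split
        case isFalse => exact Nat.zero_le _
        case isTrue h =>
          have hab := hFT h
          rcases lt_or_gt_of_ne (hT.dist_ne_of_adj r hab) with hlt | hlt
          · rw [if_pos (show D b a from ⟨hab.symm, hlt⟩)]
            exact (min_le_right _ _).trans (Nat.le_add_left _ _)
          · rw [if_pos (show D a b from ⟨hab, hlt⟩)]
            exact (min_le_left _ _).trans (Nat.le_add_right _ _)
    _ = ∑ a, ∑ b, (if D a b then w a else 0) + ∑ a, ∑ b, (if D a b then w a else 0) := by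
        simp only [Finset.sum_add_distrib]
        congr 1
        exact Finset.sum_comm
    _ ≤ 2 * ∑ v, w v := by omega

open Classical in
/-- The inequality of Chiba and Nishizeki. -/
theorem CoveredByForests.sum_min_le [Fintype V] {c : ℕ} {H : SimpleGraph V}
    (h : CoveredByForests c H) (w : V → ℕ) :
    ∑ a, ∑ b, (if H.Adj a b then min (w a) (w b) else 0) ≤ 2 * (c * ∑ v, w v) := by
  obtain ⟨F, hF, hcov⟩ := h
  calc ∑ a, ∑ b, (if H.Adj a b then min (w a) (w b) else 0)
      ≤ ∑ a, ∑ b, ∑ i, (if (F i).Adj a b then min (w a) (w b) else 0) := by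
        refine Finset.sum_le_sum fun a _ => Finset.sum_le_sum fun b _ => ?_
        split
        case isFalse => exact Nat.zero_le _
        case isTrue h =>
          obtain ⟨i, hi⟩ := SimpleGraph.iSup_adj.1 (hcov h)
          refine le_trans ?_ (Finset.single_le_sum (fun i _ => Nat.zero_le _) (Finset.mem_univ i))
          rw [if_pos hi]
    _ = ∑ i, ∑ a, ∑ b, (if (F i).Adj a b then min (w a) (w b) else 0) := by
        rw [Finset.sum_comm]
        rw [Finset.sum_congr rfl fun b _ => Finset.sum_comm, Finset.sum_comm]
        exact Finset.sum_congr rfl fun i _ => Finset.sum_comm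
    _ ≤ ∑ i : Fin c, 2 * ∑ v, w v :=
        Finset.sum_le_sum fun i _ => sum_min_le_of_isAcyclic (hF i).2 w
    _ = 2 * (c * ∑ v, w v) := by
        simp; ring

variable [Finite V] {G : SimpleGraph V}

theorem le_maxDegree (H : G.Subgraph) (v : V) : (H.neighborSet v).ncard ≤ maxDegree H :=
  le_ciSup (f := fun v => (H.neighborSet v).ncard) (Set.finite_range _).bddAbove v

omit [Finite V] in
theorem arboricity_le {H : G.Subgraph} {c : ℕ} (h : CoveredByForests c H.spanningCoe) :
    arboricity H ≤ c := Nat.sInf_le h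

theorem coveredByForests_maxDegree (H : G.Subgraph) :
    CoveredByForests (maxDegree H) H.spanningCoe :=
  coveredByForests_of_degree_le fun v => le_maxDegree H v

theorem arboricity_le_maxDegree (H : G.Subgraph) : arboricity H ≤ maxDegree H :=
  arboricity_le (coveredByForests_maxDegree H)

theorem coveredByForests_arboricity (H : G.Subgraph) :
    CoveredByForests (arboricity H) H.spanningCoe :=
  Nat.sInf_mem (s := {a | CoveredByForests a H.spanningCoe}) ⟨_, coveredByForests_maxDegree H⟩

theorem one_le_arboricity {H : G.Subgraph} {u v : V} (h : H.Adj u v) : 1 ≤ arboricity H := by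
  obtain ⟨F, -, hF⟩ := coveredByForests_arboricity H
  obtain ⟨i, -⟩ := SimpleGraph.iSup_adj.1 (hF (show H.spanningCoe.Adj u v from h))
  have := i.2
  omega

/-- For `c = ⌊√m⌋` one has `m ≤ c² + 2c`, which suffices if `c ≥ 2`. If `c = 1`, there are at most
three edges, and a cycle would make the graph a triangle; the absence of isolated vertices
identifies its vertex set with the support. -/
theorem arboricity_le_sqrt {H : G.Subgraph} (hv : ∀ v ∈ H.verts, ∃ w, H.Adj v w)
    (hE : ∃ u v, H.Adj u v) (h3 : ¬ (numVerts H = 3 ∧ numEdges H = 3)) :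
    (arboricity H : ℝ) ≤ √(numEdges H : ℝ) := by
  refine le_trans ?_ (Real.nat_sqrt_le_real_sqrt (a := numEdges H))
  rw [Nat.cast_le]
  refine arboricity_le ?_
  have hs : H.spanningCoe.edgeSet.ncard = numEdges H := by
    rw [SimpleGraph.Subgraph.edgeSet_spanningCoe, numEdges]
  have hpos : 0 < numEdges H := by
    obtain ⟨u, v, h⟩ := hE
    exact (Set.ncard_pos (Set.toFinite _)).2 ⟨s(u, v), h⟩
  have hlt := Nat.sqrt_lt' (m := numEdges H) (n := Nat.sqrt (numEdges H) + 1) |>.1 (by omega)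
  have h1 : 1 ≤ Nat.sqrt (numEdges H) := Nat.sqrt_pos.2 hpos
  generalize hc : Nat.sqrt (numEdges H) = c at *
  rcases Nat.lt_or_ge c 2 with h2 | h2
  · obtain rfl : c = 1 := by omega
    have hm : numEdges H ≤ 3 := by omega
    have hacyc : H.spanningCoe.IsAcyclic := by
      by_contra hno
      obtain ⟨e1, e2⟩ := triangle_of_not_isAcyclic (by omega) hno
      refine h3 ⟨?_, by omega⟩
      rw [numVerts, ← e2]
      congr 1
      ext v
      exact ⟨fun h => hv v h, fun ⟨w, hw⟩ => H.edge_vert hw⟩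
    exact ⟨fun _ => H.spanningCoe, fun _ => ⟨le_rfl, hacyc⟩, le_iSup (fun _ : Fin 1 => H.spanningCoe) 0⟩
  · exact coveredByForests_of_edges_le h2 (by rw [hs]; nlinarith)

end Arboricity

/-! ### Trusses -/

section Truss

variable {n : ℕ} {G : SimpleGraph (Fin n)}

theorem support_le (H : G.Subgraph) (u v : Fin n) : support H u v ≤ n := by
  have := Set.ncard_le_card (H.neighborSet u ∩ H.neighborSet v)
  rwa [Nat.card_fin] at this

theorem isTruss_trussness (H : G.Subgraph) : IsTruss H (trussness H) := fun u v h => by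
  have h1 : sInf {s | ∃ u v, H.Adj u v ∧ s = support H u v} ≤ support H u v :=
    Nat.sInf_le ⟨u, v, h, rfl⟩
  rw [trussness]
  omega

theorem IsTruss.mono {H : G.Subgraph} {k k' : ℕ} (h : IsTruss H k) (hk : k' ≤ k) : IsTruss H k' :=
  fun u v huv => hk.trans (h u v huv)

theorem IsTruss.le_trussness {H : G.Subgraph} {k : ℕ} (h : IsTruss H k) {u v : Fin n}
    (huv : H.Adj u v) : k ≤ trussness H := by
  obtain ⟨a, b, hab, hs⟩ := Nat.sInf_mem (s := {s | ∃ u v, H.Adj u v ∧ s = support H u v})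
    ⟨_, u, v, huv, rfl⟩
  have := h a b hab
  rw [trussness, hs]
  omega

theorem trussness_le {H : G.Subgraph} {u v : Fin n} (h : H.Adj u v) : trussness H ≤ n + 2 := by
  have h1 : sInf {s | ∃ u v, H.Adj u v ∧ s = support H u v} ≤ support H u v :=
    Nat.sInf_le ⟨u, v, h, rfl⟩
  have h2 := support_le H u v
  rw [trussness]
  omega

theorem bddAbove_edgeTrussness (u v : Fin n) :
    BddAbove {t | ∃ H : G.Subgraph, H.Adj u v ∧ t = trussness H} := by
  refine ⟨n + 2, ?_⟩
  rintro t ⟨H, h, rfl⟩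
  exact trussness_le h

theorem edgeTrussness_le (u v : Fin n) : edgeTrussness G u v ≤ n + 2 := by
  refine csSup_le' ?_
  rintro t ⟨H, h, rfl⟩
  exact trussness_le h

theorem IsTruss.le_edgeTrussness {H : G.Subgraph} {k : ℕ} (h : IsTruss H k) {u v : Fin n}
    (huv : H.Adj u v) : k ≤ edgeTrussness G u v :=
  (h.le_trussness huv).trans (le_csSup (bddAbove_edgeTrussness u v) ⟨H, huv, rfl⟩)

theorem exists_isTruss {k : ℕ} (hk : 1 ≤ k) {u v : Fin n} (h : k ≤ edgeTrussness G u v) :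
    ∃ H : G.Subgraph, H.Adj u v ∧ IsTruss H k := by
  obtain ⟨H, hH, ht⟩ := Nat.sSup_mem (s := {t | ∃ H : G.Subgraph, H.Adj u v ∧ t = trussness H})
    ⟨_, ⊤, adj_of_le_edgeTrussness hk h, rfl⟩ (bddAbove_edgeTrussness u v)
  refine ⟨H, hH, (isTruss_trussness H).mono ?_⟩
  rw [← ht]
  exact h

theorem reachable_of_connected {H : G.Subgraph} (h : H.Connected) {u v : Fin n} (hu : u ∈ H.verts)
    (hv : v ∈ H.verts) : H.spanningCoe.Reachable u v :=
  (h.preconnected ⟨u, hu⟩ ⟨v, hv⟩).map (⟨Subtype.val, fun h => h⟩ : H.coe →g H.spanningCoe)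

theorem connected_of_reachable {H : G.Subgraph} {u : Fin n} (hu : u ∈ H.verts)
    (h : ∀ v ∈ H.verts, H.spanningCoe.Reachable u v) : H.Connected := by
  have key : ∀ {a b : Fin n} (_ : H.spanningCoe.Walk a b) (ha : a ∈ H.verts),
      ∃ hb : b ∈ H.verts, H.coe.Reachable ⟨a, ha⟩ ⟨b, hb⟩ := by
    intro a b p
    induction p with
    | nil => exact fun ha => ⟨ha, SimpleGraph.Reachable.refl _⟩
    | cons hadj p ih =>
        intro ha
        have hadj' : H.Adj _ _ := hadj
        obtain ⟨hb, hr⟩ := ih hadj'.snd_mem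
        exact ⟨hb, (SimpleGraph.Adj.reachable (G := H.coe) (u := ⟨_, ha⟩) (v := ⟨_, hadj'.snd_mem⟩)
          hadj').trans hr⟩
  rw [SimpleGraph.Subgraph.connected_iff]
  refine ⟨SimpleGraph.Subgraph.Preconnected.mk ?_, u, hu⟩
  rintro ⟨a, ha⟩ ⟨b, hb⟩
  obtain ⟨p⟩ := h a ha
  obtain ⟨q⟩ := h b hb
  exact (key p hu).2.symm.trans (key q hu).2

/-- The component of `q₀` in the union of all `κ`-trusses. -/
def levelComponent (G : SimpleGraph (Fin n)) (κ : ℕ) (hκ : 1 ≤ κ) (q₀ : Fin n) : G.Subgraph where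
  verts := {v | (levelGraph G κ hκ).Reachable q₀ v}
  Adj u v := (levelGraph G κ hκ).Reachable q₀ u ∧ κ ≤ edgeTrussness G u v
  adj_sub h := adj_of_le_edgeTrussness hκ h.2
  edge_vert h := h.1
  symm := ⟨fun _ _ h => ⟨h.1.trans (levelGraph_adj.2 h.2).reachable, by
    rw [edgeTrussness_comm]; exact h.2⟩⟩

/-- The edge lies in a `κ`-truss. All edges of that truss have trussness at least `κ`, so its
triangles on the edge belong to the component as well. -/
theorem isTruss_levelComponent {κ : ℕ} {hκ : 1 ≤ κ} {q₀ : Fin n} :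
    IsTruss (levelComponent G κ hκ q₀) κ := by
  intro u v h
  obtain ⟨H, hH, ht⟩ := exists_isTruss hκ h.2
  refine (ht u v hH).trans (Nat.add_le_add_right (Set.ncard_le_ncard ?_ (Set.toFinite _)) 2)
  rintro w ⟨h1, h2⟩
  exact ⟨⟨h.1, ht.le_edgeTrussness h1⟩, ⟨h.1.trans (levelGraph_adj.2 h.2).reachable,
    ht.le_edgeTrussness h2⟩⟩

theorem connected_levelComponent {κ : ℕ} {hκ : 1 ≤ κ} {q₀ : Fin n} :
    (levelComponent G κ hκ q₀).Connected := by
  refine connected_of_reachable (u := q₀) (SimpleGraph.Reachable.refl _) fun v hv => ?_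
  have key : ∀ {a b : Fin n} (_ : (levelGraph G κ hκ).Walk a b),
      (levelGraph G κ hκ).Reachable q₀ a → (levelComponent G κ hκ q₀).spanningCoe.Reachable a b := by
    intro a b p
    induction p with
    | nil => exact fun _ => SimpleGraph.Reachable.refl _
    | cons hadj p ih =>
        intro ha
        have h1 : (levelComponent G κ hκ q₀).spanningCoe.Adj _ _ := ⟨ha, levelGraph_adj.1 hadj⟩
        exact h1.reachable.trans (ih (ha.trans hadj.reachable))
  obtain ⟨p⟩ := hv
  exact key p (SimpleGraph.Reachable.refl _)

theorem le_levelComponent {κ : ℕ} {hκ : 1 ≤ κ} {q₀ : Fin n} {H : G.Subgraph} (hc : H.Connected)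
    (hq : q₀ ∈ H.verts) (ht : IsTruss H κ) : H ≤ levelComponent G κ hκ q₀ := by
  have hle : H.spanningCoe ≤ levelGraph G κ hκ := fun u v h =>
    levelGraph_adj.2 (ht.le_edgeTrussness h)
  have hv : H.verts ⊆ (levelComponent G κ hκ q₀).verts := fun v hv =>
    (reachable_of_connected hc hq hv).mono hle
  exact ⟨hv, fun u v h => ⟨hv (H.edge_vert h), ht.le_edgeTrussness h⟩⟩

theorem exists_adj_of_connected {H : G.Subgraph} (hc : H.Connected) (hE : H.edgeSet.Nonempty)
    {v : Fin n} (hv : v ∈ H.verts) : ∃ w, H.Adj v w := by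
  obtain ⟨e, he⟩ := hE
  induction e with
  | _ a b =>
    have hab : H.Adj a b := he
    obtain ⟨p⟩ := reachable_of_connected hc hv hab.fst_mem
    cases p with
    | nil => exact ⟨b, hab⟩
    | cons h _ => exact ⟨_, h⟩

section Level

variable {Q : List (Fin n)} {q₀ : Fin n}

theorem bddAbove_maxTrussness (Q : Set (Fin n)) : BddAbove {t | ∃ H : G.Subgraph, H.Connected ∧
    Q ⊆ H.verts ∧ H.edgeSet.Nonempty ∧ t = trussness H} := by
  refine ⟨n + 2, ?_⟩
  rintro t ⟨H, -, -, ⟨e, he⟩, rfl⟩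
  induction e with
  | _ a b => exact trussness_le (show H.Adj a b from he)

theorem exists_isTruss_maxTrussness (hn : 2 ≤ n) (hG : G.Connected) (Q : Set (Fin n)) :
    2 ≤ maxTrussness G Q ∧ ∃ H : G.Subgraph, H.Connected ∧ Q ⊆ H.verts ∧ H.edgeSet.Nonempty ∧
      IsTruss H (maxTrussness G Q) := by
  have : Nontrivial (Fin n) := Fin.nontrivial_iff_two_le.2 hn
  have : Nonempty (Fin n) := ⟨⟨0, by omega⟩⟩
  have htop : (⊤ : G.Subgraph).Connected := by
    refine connected_of_reachable (u := ⟨0, by omega⟩) trivial fun v _ => ?_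
    simpa using hG.preconnected _ v
  obtain ⟨w, hw⟩ := hG.preconnected.exists_adj_of_nontrivial ⟨0, by omega⟩
  obtain ⟨H, h1, h2, h3, h4⟩ := Nat.sSup_mem (s := {t | ∃ H : G.Subgraph, H.Connected ∧
    Q ⊆ H.verts ∧ H.edgeSet.Nonempty ∧ t = trussness H})
    ⟨_, ⊤, htop, fun _ _ => trivial, ⟨s(_, w), hw⟩, rfl⟩ (bddAbove_maxTrussness Q)
  change maxTrussness G Q = trussness H at h4
  refine ⟨?_, H, h1, h2, h3, ?_⟩
  · rw [h4, trussness]; omega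
  · rw [h4]; exact isTruss_trussness H

/-- The component at level `κ` is a competitor in the definition of `maxTrussness`. The bound by the
vertex trussness of `q₀` ensures that it has an edge. -/
theorem le_maxTrussness {κ : ℕ} (hκ : 1 ≤ κ) {Q : Set (Fin n)}
    (hκq : κ ≤ Finset.univ.sup fun u => edgeTrussness G q₀ u)
    (hr : ∀ q ∈ Q, (levelGraph G κ hκ).Reachable q₀ q) : κ ≤ maxTrussness G Q := by
  obtain ⟨w, hw⟩ : ∃ w, κ ≤ edgeTrussness G q₀ w := by
    by_contra hno
    push Not at hno
    have := (Finset.sup_lt_iff (s := Finset.univ) (f := fun u => edgeTrussness G q₀ u)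
      (by rw [Nat.bot_eq_zero]; omega)).2 fun u _ => hno u
    omega
  have hadj : (levelComponent G κ hκ q₀).Adj q₀ w := ⟨SimpleGraph.Reachable.refl _, hw⟩
  exact (isTruss_levelComponent.le_trussness hadj).trans (le_csSup (bddAbove_maxTrussness Q)
    ⟨_, connected_levelComponent, fun q hq => hr q hq, ⟨s(_, _), hadj⟩, rfl⟩)

/-- The component at the optimal level is itself a connected truss through `Q` and contains all
others, so the supremum is attained by it. -/
theorem startGraph_eq (hn : 2 ≤ n) (hG : G.Connected) {Q : Set (Fin n)} (hq : q₀ ∈ Q)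
    (hk : 1 ≤ maxTrussness G Q) : startGraph G Q = levelComponent G (maxTrussness G Q) hk q₀ ∧
      maxTrussness G Q ≤ Finset.univ.sup (fun u => edgeTrussness G q₀ u) ∧
      (∀ q ∈ Q, (levelGraph G (maxTrussness G Q) hk).Reachable q₀ q) ∧
      ∃ w, (levelComponent G (maxTrussness G Q) hk q₀).Adj q₀ w := by
  obtain ⟨-, H, h1, h2, h3, h4⟩ := exists_isTruss_maxTrussness hn hG Q
  have hle := le_levelComponent (hκ := hk) h1 (h2 hq) h4
  obtain ⟨w, hw⟩ := exists_adj_of_connected h1 h3 (h2 hq)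
  refine ⟨le_antisymm ?_ ?_, ?_, fun q hq => hle.1 (h2 hq), w, hle.2 hw⟩
  · exact sSup_le fun K hK => le_levelComponent hK.1 (hK.2.1 hq) hK.2.2.2
  · exact le_sSup ⟨connected_levelComponent, h2.trans hle.1, ⟨s(_, _), hle.2 hw⟩,
      isTruss_levelComponent⟩
  · exact (h4.le_edgeTrussness hw).trans
      (Finset.le_sup (f := fun u => edgeTrussness G q₀ u) (Finset.mem_univ w))

end Level

end Truss

end TrussSearch

namespace TrussSearch

/-! ### The rounds of BulkDelete and the graph kept by the program -/

variable {n : ℕ} {G : SimpleGraph (Fin n)} {Q : List (Fin n)} {A A' : SimpleGraph (Fin n)}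

theorem reachCount_pos {v : Fin n} :
    0 < reachCount Q A v ↔ ∃ q ∈ Q, A.Reachable q v ∧ ∃ w, A.Adj q w := by
  classical
  rw [reachCount, Finset.card_pos]
  simp [Finset.Nonempty]

theorem reachCount_pos_of_reachable {u v : Fin n} (h : 0 < reachCount Q A u)
    (huv : A.Reachable u v) : 0 < reachCount Q A v := by
  rw [reachCount_pos] at h ⊢
  obtain ⟨q, hq, hr, hw⟩ := h
  exact ⟨q, hq, hr.trans huv, hw⟩

theorem exists_adj_of_reachCount_pos {v : Fin n} (h : 0 < reachCount Q A v) : ∃ w, A.Adj v w := by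
  obtain ⟨q, -, hr, w, hw⟩ := reachCount_pos.1 h
  obtain ⟨p⟩ := hr.symm
  cases p with
  | nil => exact ⟨w, hw⟩
  | cons h _ => exact ⟨_, h⟩

theorem reachCount_eq_length_iff (hQ : Q.Nodup) {v : Fin n} :
    reachCount Q A v = Q.length ↔ ∀ q ∈ Q, A.Reachable q v ∧ ∃ w, A.Adj q w := by
  classical
  rw [reachCount, ← List.toFinset_card_of_nodup hQ, Finset.card_filter_eq_iff]
  simp

/-- The subgraph `H` consists of the components of `A` that contain a query node and an edge. -/
structure Models (Q : List (Fin n)) (A : SimpleGraph (Fin n)) (H : G.Subgraph) : Prop where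
  verts : ∀ v, v ∈ H.verts ↔ 0 < reachCount Q A v
  adj : ∀ u v, H.Adj u v ↔ A.Adj u v ∧ 0 < reachCount Q A u

namespace Models

variable {H : G.Subgraph} (M : Models Q A H)
include M

theorem spanningCoe_le : H.spanningCoe ≤ A := fun u v h => ((M.adj u v).1 h).1

/-- `H` is a union of components of `A`, so a walk of `A` starting in `H` cannot leave it.
Reachability and distances from vertices of `H` therefore agree. -/
theorem walk {u v : Fin n} (p : A.Walk u v) (hu : u ∈ H.verts) :
    ∃ p' : H.spanningCoe.Walk u v, p'.length = p.length := by
  induction p with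
  | nil => exact ⟨.nil, rfl⟩
  | cons h p ih =>
      have hu' := (M.verts _).1 hu
      obtain ⟨p', hp'⟩ := ih ((M.verts _).2 (reachCount_pos_of_reachable hu' h.reachable))
      exact ⟨.cons ((M.adj _ _).2 ⟨h, hu'⟩) p', congrArg Nat.succ hp'⟩

theorem reachable_iff {u v : Fin n} (hu : u ∈ H.verts) :
    H.spanningCoe.Reachable u v ↔ A.Reachable u v :=
  ⟨fun h => h.mono M.spanningCoe_le, fun ⟨p⟩ => ⟨(M.walk p hu).choose⟩⟩

theorem edist_eq {u v : Fin n} (hu : u ∈ H.verts) : H.spanningCoe.edist u v = A.edist u v := by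
  refine le_antisymm ?_ (SimpleGraph.edist_anti M.spanningCoe_le)
  by_cases h : A.Reachable u v
  · obtain ⟨p, hp⟩ := h.exists_walk_length_eq_edist
    obtain ⟨p', hp'⟩ := M.walk p hu
    rw [← hp, ← hp']
    exact SimpleGraph.edist_le p'
  · rw [SimpleGraph.edist_eq_top_of_not_reachable h]
    exact le_top

/-- The count at `q` is full exactly if every query node has an edge and reaches `q`; isolated query
nodes have been dropped from the graph. -/
theorem connects_iff (hQ : Q.Nodup) :
    Connects H (nodes Q) ↔ ∀ q ∈ Q, reachCount Q A q = Q.length := by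
  simp only [reachCount_eq_length_iff hQ]
  constructor
  · rintro ⟨h1, h2⟩ q hq p hp
    exact ⟨(h2 p hp q hq).mono M.spanningCoe_le,
      exists_adj_of_reachCount_pos ((M.verts p).1 (h1 hp))⟩
  · intro h
    have h1 : nodes Q ⊆ H.verts := fun q hq =>
      (M.verts q).2 (reachCount_pos.2 ⟨q, hq, h q hq q hq⟩)
    exact ⟨h1, fun p hp q hq => (M.reachable_iff (h1 hp)).2 (h q hq p hp).1⟩

variable (hc : Connects H (nodes Q))
include hc

theorem reachable {u q : Fin n} (hu : u ∈ H.verts) (hq : q ∈ Q) : A.Reachable q u := by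
  obtain ⟨p, hp, hr, -⟩ := reachCount_pos.1 ((M.verts u).1 hu)
  exact ((hc.2 q hq p hp).mono M.spanningCoe_le).trans hr

omit M hc in
theorem nonempty_toFinset (hne : Q ≠ []) : Q.toFinset.Nonempty := by
  obtain ⟨q, hq⟩ := List.exists_mem_of_ne_nil Q hne
  exact ⟨q, List.mem_toFinset.2 hq⟩

theorem farthest_eq (hne : Q ≠ []) {u : Fin n} (hu : u ∈ H.verts) :
    farthest Q A u = (Q.toFinset.sup fun q => A.dist q u) + 1 := by
  classical
  rw [farthest]
  have h : (Q.toFinset.sup fun q => if A.Reachable q u then A.dist q u + 1 else 0) =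
      Q.toFinset.sup fun q => A.dist q u + 1 :=
    Finset.sup_congr rfl fun q hq => if_pos (M.reachable hc hu (List.mem_toFinset.1 hq))
  rw [h]
  refine le_antisymm (Finset.sup_le fun q hq => Nat.add_le_add_right
    (Finset.le_sup (f := fun q => A.dist q u) hq) 1) ?_
  obtain ⟨q, hq, he⟩ := Finset.exists_mem_eq_sup _ (nonempty_toFinset hne) fun q => A.dist q u
  rw [he]
  exact Finset.le_sup (f := fun q => A.dist q u + 1) hq

theorem queryDist_eq (hne : Q ≠ []) {u : Fin n} (hu : u ∈ H.verts) :
    queryDist H (nodes Q) u = ((Q.toFinset.sup fun q => A.dist q u : ℕ) : ℕ∞) := by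
  have he : ∀ q ∈ Q, H.spanningCoe.edist u q = (A.dist q u : ℕ∞) := fun q hq => by
    rw [M.edist_eq hu, SimpleGraph.edist_comm, (M.reachable hc hu hq).coe_dist_eq_edist]
  refine le_antisymm (iSup₂_le fun q hq => ?_) ?_
  · rw [he q hq, Nat.cast_le]
    exact Finset.le_sup (f := fun q => A.dist q u) (List.mem_toFinset.2 hq)
  · obtain ⟨q, hq, hs⟩ := Finset.exists_mem_eq_sup _ (nonempty_toFinset hne) fun q => A.dist q u
    have hq' := List.mem_toFinset.1 hq
    rw [hs, ← he q hq']
    exact le_iSup₂ (f := fun q (_ : q ∈ nodes Q) => H.spanningCoe.edist u q) q hq'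

theorem queryDist_add_one (hne : Q ≠ []) {u : Fin n} (hu : u ∈ H.verts) :
    queryDist H (nodes Q) u + 1 = (farthest Q A u : ℕ∞) := by
  rw [M.queryDist_eq hc hne hu, M.farthest_eq hc hne hu, Nat.cast_add, Nat.cast_one]

variable {X : Finset (Fin n)} (hX : ∀ v ∈ H.verts, v ∈ X)
include hX

theorem exists_farthest (hne : Q ≠ []) : ∃ u ∈ H.verts,
    farthest Q A u = eccentricity Q A X + 1 ∧
      ∀ v ∈ H.verts, farthest Q A v ≤ eccentricity Q A X + 1 := by
  classical
  obtain ⟨q, hq⟩ := List.exists_mem_of_ne_nil Q hne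
  have hmem : ∀ v, v ∈ X.filter (fun v => 0 < reachCount Q A v) ↔ v ∈ H.verts := fun v => by
    rw [Finset.mem_filter, M.verts]
    exact ⟨fun h => h.2, fun h => ⟨hX v ((M.verts v).2 h), h⟩⟩
  obtain ⟨u, hu, he⟩ := Finset.exists_mem_eq_sup _ ⟨q, (hmem q).2 (hc.1 hq)⟩ (farthest Q A)
  rw [hmem] at hu
  have hpos : 1 ≤ farthest Q A u := by rw [M.farthest_eq hc hne hu]; omega
  have hecc : eccentricity Q A X + 1 = farthest Q A u := by
    rw [eccentricity, he]; omega
  refine ⟨u, hu, hecc.symm, fun v hv => ?_⟩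
  rw [hecc, ← he]
  exact Finset.le_sup ((hmem v).2 hv)

theorem graphDist_eq (hne : Q ≠ []) :
    graphDist H (nodes Q) = (eccentricity Q A X : ℕ∞) := by
  obtain ⟨u, hu, h1, h2⟩ := M.exists_farthest hc hX hne
  refine le_antisymm (iSup₂_le fun v hv => ?_) ?_
  · have h3 := h2 v hv
    rw [M.farthest_eq hc hne hv] at h3
    rw [M.queryDist_eq hc hne hv, Nat.cast_le]
    omega
  · refine le_trans ?_ (le_iSup₂ (f := fun u (_ : u ∈ H.verts) => queryDist H (nodes Q) u) u hu)
    rw [M.farthest_eq hc hne hu] at h1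
    rw [M.queryDist_eq hc hne hu, Nat.cast_le]
    omega

/-- Distances are realised by paths, which have fewer than `n` edges. This justifies `n` as a
substitute for `+∞`. -/
theorem eccentricity_lt (hne : Q ≠ []) : eccentricity Q A X < n := by
  obtain ⟨u, hu, h1, -⟩ := M.exists_farthest hc hX hne
  rw [M.farthest_eq hc hne hu] at h1
  obtain ⟨q, hq, hs⟩ := Finset.exists_mem_eq_sup _ (nonempty_toFinset hne) fun q => A.dist q u
  obtain ⟨p, hp, hl⟩ := (M.reachable hc hu (List.mem_toFinset.1 hq)).exists_path_of_dist
  have := hp.length_lt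
  rw [Fintype.card_fin] at this
  omega

omit hX in
-- The hypotheses say that `A'` is the largest `k`-truss in `A` avoiding the distant vertices.
-- Triangles do not leave components, so on the components of `A` reached by a query it agrees with
-- `trussPart`. Dropping what is cut off from `Q` then amounts to counting queries in `A'` instead
-- of `A`.
theorem adj_nextState (hne : Q ≠ []) {k : ℕ} {dd : ℕ∞} {d : ℕ}
    (hd : min dd (graphDist H (nodes Q)) = (d : ℕ∞)) (ht : GTruss A' k)
    (h1 : ∀ u v, A'.Adj u v → A.Adj u v ∧ ¬ (0 < reachCount Q A u ∧ d ≤ farthest Q A u))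
    (h2 : ∀ K ≤ A, GTruss K k → (∀ u v, K.Adj u v →
      ¬ (0 < reachCount Q A u ∧ d ≤ farthest Q A u)) → K ≤ A') :
    Models Q A' (nextState k (nodes Q) ⟨H, dd⟩).graph := by
  set L : Set (Fin n) := {u | u ∈ H.verts ∧
    min dd (graphDist H (nodes Q)) ≤ queryDist H (nodes Q) u + 1} with hL
  have hfar : ∀ u, u ∈ L ↔ 0 < reachCount Q A u ∧ d ≤ farthest Q A u := by
    intro u
    rw [hL, Set.mem_ofPred_eq, hd, ← M.verts]
    refine and_congr_right fun hu => ?_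
    rw [M.queryDist_add_one hc hne hu, Nat.cast_le]
  set T := trussPart k (H.deleteVerts L) with hT
  have hTadj : ∀ u v, T.Adj u v ↔ A'.Adj u v ∧ 0 < reachCount Q A u := by
    intro u v
    constructor
    · intro h
      obtain ⟨K, ⟨hK, hKt, -⟩, hKadj⟩ := SimpleGraph.Subgraph.sSup_adj.1 h
      have hadj : ∀ a b, K.Adj a b → H.Adj a b ∧ a ∉ L := fun a b hab => by
        have := SimpleGraph.Subgraph.deleteVerts_adj.1 (hK.2 hab)
        exact ⟨this.2.2.2.2, this.2.1⟩
      have hle := h2 K.spanningCoe (fun a b hab => ((M.adj a b).1 (hadj a b hab).1).1)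
        (fun a b hab => hKt a b hab) fun a b hab => by
          rw [← hfar]; exact (hadj a b hab).2
      exact ⟨hle hKadj, ((M.adj u v).1 (hadj u v hKadj).1).2⟩
    · rintro ⟨h, hu⟩
      -- The part of `A'` in components of `A` reached by a query is closed under adjacency in `A'`,
      -- hence again a truss.
      let K : G.Subgraph :=
        { verts := {u | ∃ v, A'.Adj u v ∧ 0 < reachCount Q A u}
          Adj := fun u v => A'.Adj u v ∧ 0 < reachCount Q A u
          adj_sub := fun {a b} hab => ((M.adj a b).2 ⟨(h1 a b hab.1).1, hab.2⟩).adj_sub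
          edge_vert := fun {a b} hab => ⟨b, hab⟩
          symm := ⟨fun a b hab => ⟨hab.1.symm,
            reachCount_pos_of_reachable hab.2 (h1 a b hab.1).1.reachable⟩⟩ }
      have hnot : ∀ a b, A'.Adj a b → a ∉ L := fun a b hab => by
        rw [hfar]; exact (h1 a b hab).2
      have hKle : K ≤ H.deleteVerts L := by
        refine ⟨?_, fun a b hab => ?_⟩
        · rintro a ⟨b, hab, ha⟩
          exact ⟨(M.verts a).2 ha, hnot a b hab⟩
        · have hH := (M.adj a b).2 ⟨(h1 a b hab.1).1, hab.2⟩
          exact SimpleGraph.Subgraph.deleteVerts_adj.2 ⟨hH.fst_mem, hnot a b hab.1, hH.snd_mem,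
            hnot b a hab.1.symm, hH⟩
      have hKt : IsTruss K k := by
        intro a b hab
        refine (ht a b hab.1).trans (Nat.add_le_add_right (Set.ncard_le_ncard ?_
          (Set.toFinite _)) 2)
        rintro c ⟨hac, hbc⟩
        exact ⟨⟨hac, hab.2⟩, hbc, reachCount_pos_of_reachable hab.2 (h1 a b hab.1).1.reachable⟩
      exact SimpleGraph.Subgraph.sSup_adj.2 ⟨K, ⟨hKle, hKt, fun a ha => ha⟩, h, hu⟩
  have hTverts : ∀ v, v ∈ T.verts ↔ ∃ w, T.Adj v w := by
    intro v
    constructor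
    · intro hv
      rw [hT, trussPart, SimpleGraph.Subgraph.verts_sSup, Set.mem_iUnion₂] at hv
      obtain ⟨K, hK, hv⟩ := hv
      obtain ⟨w, hw⟩ := hK.2.2 v hv
      exact ⟨w, SimpleGraph.Subgraph.sSup_adj.2 ⟨K, hK, hw⟩⟩
    · rintro ⟨w, hw⟩
      exact T.edge_vert hw
  have hTle : T.spanningCoe ≤ A' := fun u v h => ((hTadj u v).1 h).1
  have hwalk : ∀ {u v : Fin n} (_ : A'.Walk u v), 0 < reachCount Q A u →
      T.spanningCoe.Reachable u v := by
    intro u v p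
    induction p with
    | nil => exact fun _ => SimpleGraph.Reachable.refl _
    | @cons a b c h p ih =>
        intro hu
        have hab : T.spanningCoe.Adj a b := (hTadj a b).2 ⟨h, hu⟩
        exact hab.reachable.trans (ih (reachCount_pos_of_reachable hu (h1 a b h).1.reachable))
  have hverts : ∀ v, (v ∈ T.verts ∧ ∃ q ∈ nodes Q, T.spanningCoe.Reachable q v) ↔
      0 < reachCount Q A' v := by
    intro v
    constructor
    · rintro ⟨hv, q, hq, hr⟩
      obtain ⟨w, hw⟩ := (hTverts v).1 hv
      refine reachCount_pos.2 ⟨q, hq, hr.mono hTle, ?_⟩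
      obtain ⟨p⟩ := hr
      cases p with
      | nil => exact ⟨w, hTle hw⟩
      | cons h _ => exact ⟨_, hTle h⟩
    · intro h
      obtain ⟨w, hw⟩ := exists_adj_of_reachCount_pos h
      obtain ⟨q, hq, ⟨p⟩, b, hb⟩ := reachCount_pos.1 h
      have hqA : 0 < reachCount Q A q :=
        reachCount_pos.2 ⟨q, hq, SimpleGraph.Reachable.refl _, b, (h1 q b hb).1⟩
      have hvA : 0 < reachCount Q A v := reachCount_pos_of_reachable hqA
        (SimpleGraph.Reachable.mono (fun a b hab => (h1 a b hab).1) ⟨p⟩)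
      exact ⟨(hTverts v).2 ⟨w, (hTadj v w).2 ⟨hw, hvA⟩⟩, q, hq, hwalk p hqA⟩
  refine ⟨hverts, fun u v => ?_⟩
  constructor
  · rintro ⟨hu, -, h⟩
    exact ⟨hTle h, (hverts u).1 hu⟩
  · rintro ⟨h, hu⟩
    have hu' := (hverts u).2 hu
    obtain ⟨w, hw⟩ := (hTverts u).1 hu'.1
    exact ⟨hu', (hverts v).2 (reachCount_pos_of_reachable hu h.reachable),
      (hTadj u v).2 ⟨h, ((hTadj u w).1 hw).2⟩⟩

/-- A round deletes at least `k` vertices. -/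
theorem ncard_nextState (hne : Q ≠ []) {k : ℕ} {dd : ℕ∞} (ht : GTruss A k) :
    (nextState k (nodes Q) ⟨H, dd⟩).graph.verts.ncard + k ≤ H.verts.ncard := by
  set L : Set (Fin n) := {u | u ∈ H.verts ∧
    min dd (graphDist H (nodes Q)) ≤ queryDist H (nodes Q) u + 1} with hL
  have hsub : (nextState k (nodes Q) ⟨H, dd⟩).graph.verts ⊆ H.verts \ L := by
    rintro v ⟨hv, -⟩
    have hle : trussPart k (H.deleteVerts L) ≤ H.deleteVerts L := sSup_le fun K hK => hK.1
    exact hle.1 hv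
  obtain ⟨u, hu, h1, -⟩ := M.exists_farthest hc hX hne
  have hmin : min dd (graphDist H (nodes Q)) ≤ (eccentricity Q A X : ℕ∞) :=
    (min_le_right _ _).trans (M.graphDist_eq hc hX hne).le
  have hin : ∀ v ∈ H.verts, eccentricity Q A X ≤ farthest Q A v → v ∈ L := fun v hv h =>
    ⟨hv, hmin.trans (by rw [M.queryDist_add_one hc hne hv, Nat.cast_le]; exact h)⟩
  have huL : u ∈ L := hin u hu (by omega)
  -- A neighbour of a farthest vertex is at most one step closer to the queries, and distance at
  -- least `d - 1` is enough for deletion.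
  have hnb : ∀ v, A.Adj u v → v ∈ L := by
    intro v huv
    have hv := (M.verts v).2 (reachCount_pos_of_reachable ((M.verts u).1 hu) huv.reachable)
    refine hin v hv ?_
    have hle : (Q.toFinset.sup fun q => A.dist q u) ≤ (Q.toFinset.sup fun q => A.dist q v) + 1 := by
      refine Finset.sup_le fun q hq => ?_
      have h2 := Finset.le_sup (f := fun q => A.dist q v) hq
      obtain ⟨p, hp⟩ := (M.reachable hc hv (List.mem_toFinset.1 hq)).exists_walk_length_eq_dist
      have h3 := SimpleGraph.dist_le (p.concat huv.symm)
      rw [SimpleGraph.Walk.length_concat] at h3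
      omega
    rw [M.farthest_eq hc hne hu] at h1
    rw [M.farthest_eq hc hne hv]
    omega
  obtain ⟨w, hw⟩ := exists_adj_of_reachCount_pos ((M.verts u).1 hu)
  -- Counted are `u`, one neighbour `w` and their common neighbours, of which there are at least `k
  -- - 2`.
  have hcard : k ≤ L.ncard := by
    refine (ht u w hw).trans ?_
    have e1 : w ∉ {c | A.Adj u c ∧ A.Adj w c} := fun h => h.2.ne rfl
    have e2 : u ∉ insert w {c | A.Adj u c ∧ A.Adj w c} := by
      rintro (h | h)
      · exact hw.ne h
      · exact h.1.ne rfl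
    have e3 := Set.ncard_insert_of_notMem e1 (Set.toFinite _)
    have e4 := Set.ncard_insert_of_notMem e2 (Set.toFinite _)
    have e5 : insert u (insert w {c | A.Adj u c ∧ A.Adj w c}) ⊆ L := by
      rintro c (rfl | rfl | h)
      · exact huL
      · exact hnb _ hw
      · exact hnb _ h.1
    have e6 := Set.ncard_le_ncard e5 (Set.toFinite _)
    omega
  have hLsub : L ⊆ H.verts := fun v hv => hv.1
  have h2 := Set.ncard_le_ncard hsub (Set.toFinite _)
  have h3 := Set.ncard_sdiff_add_ncard_of_subset hLsub (Set.toFinite _)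
  omega

end Models

end TrussSearch

namespace TrussSearch

/-! ### The initial graph -/

section Initial

variable {n : ℕ} {G : SimpleGraph (Fin n)} {I : TrussIndex G} {Q : List (Fin n)}
  {k : ℕ} {hk : 1 ≤ k} {q₀ : Fin n} {X : Finset (Fin n)}

theorem closed_of_mem_iff_reachable (hX : ∀ v, v ∈ X ↔ (levelGraph G k hk).Reachable q₀ v) :
    ∀ u ∈ X, ∀ v, k ≤ edgeTrussness G u v → v ∈ X := fun u hu v h =>
  (hX v).2 (((hX u).1 hu).trans (levelGraph_adj.2 h).reachable)

theorem spanningCoe_levelComponent (hX : ∀ v, v ∈ X ↔ (levelGraph G k hk).Reachable q₀ v) :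
    (levelComponent G k hk q₀).spanningCoe = baseGraph G k hk X := by
  ext u v
  exact ⟨fun h => ⟨(hX u).2 h.1, closed_of_mem_iff_reachable hX u ((hX u).2 h.1) v h.2, h.2⟩,
    fun h => ⟨(hX u).1 h.1, h.2.2⟩⟩

theorem numEdges_levelComponent (hX : ∀ v, v ∈ X ↔ (levelGraph G k hk).Reachable q₀ v) :
    numEdges (levelComponent G k hk q₀) = (baseGraph G k hk X).edgeSet.ncard := by
  rw [numEdges, ← SimpleGraph.Subgraph.edgeSet_spanningCoe, spanningCoe_levelComponent hX]

theorem numVerts_levelComponent (hX : ∀ v, v ∈ X ↔ (levelGraph G k hk).Reachable q₀ v) :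
    numVerts (levelComponent G k hk q₀) = X.card := by
  rw [numVerts, ← Set.ncard_coe_finset]
  congr 1
  ext v
  exact (hX v).symm

theorem gTruss_baseGraph (hX : ∀ v, v ∈ X ↔ (levelGraph G k hk).Reachable q₀ v) :
    GTruss (baseGraph G k hk X) k := by
  rw [← spanningCoe_levelComponent hX]
  exact isTruss_levelComponent

theorem models_levelComponent (hX : ∀ v, v ∈ X ↔ (levelGraph G k hk).Reachable q₀ v)
    (hq : q₀ ∈ Q) (hQ : ∀ q ∈ Q, q ∈ X) (hw : ∃ w, (levelComponent G k hk q₀).Adj q₀ w) :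
    Models Q (baseGraph G k hk X) (levelComponent G k hk q₀) := by
  have hv : ∀ v, v ∈ (levelComponent G k hk q₀).verts ↔
      0 < reachCount Q (baseGraph G k hk X) v := by
    intro v
    rw [← spanningCoe_levelComponent hX, reachCount_pos]
    constructor
    · intro h
      exact ⟨q₀, hq, reachable_of_connected connected_levelComponent
        (SimpleGraph.Reachable.refl q₀) h, hw⟩
    · rintro ⟨q, hq, hr, -⟩
      refine ((hX q).1 (hQ q hq)).trans (hr.mono fun a b h => ?_)
      exact levelGraph_adj.2 h.2
  refine ⟨hv, fun u v => ?_⟩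
  rw [← hv, ← spanningCoe_levelComponent hX]
  exact ⟨fun h => ⟨h, h.1⟩, fun h => h.1⟩

theorem ncard_neighborSet_baseGraph (I : TrussIndex G)
    (hX : ∀ u ∈ X, ∀ v, k ≤ edgeTrussness G u v → v ∈ X) {v : Fin n} (hv : v ∈ X) :
    ((baseGraph G k hk X).neighborSet v).ncard = (I.nb k v).length := by
  rw [← List.toFinset_card_of_nodup (I.nb_nodup k v), ← Set.ncard_coe_finset]
  congr 1
  ext u
  rw [List.coe_toFinset, Set.mem_ofPred_eq, I.mem_nb hk]
  exact ⟨fun h => h.2.2, fun h => ⟨hv, hX v hv u h, h⟩⟩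

/-- The inequality of Chiba and Nishizeki with degrees as weights, whose sum is `2m`; the summands
`1` of `edgeWork` add another `2m`. -/
theorem edgeWork_le {c : ℕ} (hX : ∀ u ∈ X, ∀ v, k ≤ edgeTrussness G u v → v ∈ X)
    (hc : CoveredByForests c (baseGraph G k hk X)) :
    edgeWork I k (baseGraph G k hk X) ≤ 2 * (baseGraph G k hk X).edgeSet.ncard +
      4 * (c * (baseGraph G k hk X).edgeSet.ncard) := by
  classical
  have h := hc.sum_min_le fun v => ((baseGraph G k hk X).neighborSet v).ncard
  rw [sum_ncard_neighborSet] at h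
  have h1 : ∑ a, ∑ b, (if (baseGraph G k hk X).Adj a b then 1 else 0) =
      2 * (baseGraph G k hk X).edgeSet.ncard := by
    rw [← sum_ncard_neighborSet]
    refine Finset.sum_congr rfl fun a _ => ?_
    rw [← Finset.sum_filter, Finset.sum_const, smul_eq_mul, mul_one, ← Set.ncard_coe_finset]
    congr 1
    ext b
    simp
  have h2 : edgeWork I k (baseGraph G k hk X) = ∑ a, ∑ b,
      ((if (baseGraph G k hk X).Adj a b then 1 else 0) + if (baseGraph G k hk X).Adj a b then
        min ((baseGraph G k hk X).neighborSet a).ncard ((baseGraph G k hk X).neighborSet b).ncard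
        else 0) := by
    rw [edgeWork, Finset.sum_filter, ← Finset.univ_product_univ, Finset.sum_product]
    refine Finset.sum_congr rfl fun a _ => Finset.sum_congr rfl fun b _ => ?_
    by_cases hab : (baseGraph G k hk X).Adj a b
    · simp only [if_pos hab]
      rw [ncard_neighborSet_baseGraph I hX hab.1, ncard_neighborSet_baseGraph I hX hab.2.1]
    · simp only [if_neg hab, add_zero]
  rw [h2]
  simp only [Finset.sum_add_distrib, h1]
  linarith

/-- The trussness of a vertex is bounded in terms of the arboricity. -/
theorem vertexTruss_le {c K : ℕ} (hX : ∀ u ∈ X, ∀ v, k ≤ edgeTrussness G u v → v ∈ X)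
    (hc : CoveredByForests c (baseGraph G k hk X)) (hq : q₀ ∈ X)
    (hK : K = Finset.univ.sup fun u => edgeTrussness G q₀ u) (hkK : k ≤ K) : K ≤ 2 * c + 1 := by
  classical
  have hK1 : 1 ≤ K := hk.trans hkK
  set B := baseGraph G K hK1 X with hB
  have hle : B ≤ baseGraph G k hk X := fun u v h => ⟨h.1, h.2.1, hkK.trans h.2.2⟩
  -- In a `K`-truss, an edge `vw` gives `v` the neighbour `w` and at least `K - 2` common
  -- neighbours.
  have hdeg : ∀ v ∈ B.support, K - 1 ≤ (B.neighborSet v).ncard := by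
    rintro v ⟨w, hv, hw, hτ⟩
    obtain ⟨H, hH, ht⟩ := exists_isTruss hK1 hτ
    have hnot : w ∉ H.neighborSet v ∩ H.neighborSet w := fun h => (h.2 : H.Adj w w).ne rfl
    have h1 := Set.ncard_insert_of_notMem hnot (Set.toFinite _)
    have h2 : insert w (H.neighborSet v ∩ H.neighborSet w) ⊆ B.neighborSet v := by
      rintro x (rfl | hx)
      · exact ⟨hv, hw, hτ⟩
      · have := ht.le_edgeTrussness hx.1
        exact ⟨hv, hX v hv x (hkK.trans this), this⟩
    have h3 := Set.ncard_le_ncard h2 (Set.toFinite _)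
    have h4 := ht v w hH
    rw [support] at h4
    omega
  have h1 := ncard_mul_le hdeg
  have h2 := hc.sum_min_le fun v => if v ∈ B.support then 1 else 0
  have h3 : ∑ v, (if v ∈ B.support then 1 else 0) = B.support.ncard := by
    rw [← Finset.sum_filter, Finset.sum_const, smul_eq_mul, mul_one, ← Set.ncard_coe_finset]
    congr 1
    ext v
    simp
  -- With the indicator function of the support of `B` as weight, each edge of `B` contributes one
  -- for each orientation.
  have h4 : 2 * B.edgeSet.ncard ≤ ∑ a, ∑ b, (if (baseGraph G k hk X).Adj a b then
      min (if a ∈ B.support then 1 else 0) (if b ∈ B.support then 1 else 0) else 0) := by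
    rw [← sum_ncard_neighborSet]
    refine Finset.sum_le_sum fun a _ => ?_
    have : (B.neighborSet a).ncard = ∑ b, if B.Adj a b then 1 else 0 := by
      rw [← Finset.sum_filter, Finset.sum_const, smul_eq_mul, mul_one, ← Set.ncard_coe_finset]
      congr 1
      ext b
      simp
    rw [this]
    refine Finset.sum_le_sum fun b _ => ?_
    split
    case isFalse => exact Nat.zero_le _
    case isTrue h =>
      rw [if_pos (hle h), if_pos ⟨b, h⟩, if_pos ⟨a, h.symm⟩]
      simp
  have hpos : 0 < B.support.ncard := by
    refine (Set.ncard_pos (Set.toFinite _)).2 ⟨q₀, ?_⟩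
    obtain ⟨w, -, hw⟩ := Finset.exists_mem_eq_sup Finset.univ ⟨q₀, Finset.mem_univ _⟩
      fun u => edgeTrussness G q₀ u
    rw [← hK] at hw
    exact ⟨w, hq, hX q₀ hq w (hkK.trans hw.le), hw.le⟩
  rw [h3] at h2
  have h5 : B.support.ncard * (K - 1) ≤ B.support.ncard * (2 * c) := by
    calc B.support.ncard * (K - 1) ≤ 2 * (c * B.support.ncard) := h1.trans (h4.trans h2)
      _ = B.support.ncard * (2 * c) := by ring
  have := Nat.le_of_mul_le_mul_left h5 hpos
  omega

/-- The cells used by the program. -/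
noncomputable def cells (X : Finset (Fin n)) (B : SimpleGraph (Fin n)) : Finset (ℕ × ℕ) := by
  classical
  exact ([0, 4, 5, 6, 8].toFinset ×ˢ X.image (fun v : Fin n => (v : ℕ))) ∪
    ([2, 3, 7].toFinset ×ˢ Finset.range X.card) ∪
    ([1, 9, 10].toFinset ×ˢ (Finset.univ.filter fun p : Fin n × Fin n => B.Adj p.1 p.2).image
      (fun p => (p.1 * n + p.2 : ℕ))) ∪
    ([11, 12].toFinset ×ˢ Finset.range B.edgeSet.ncard)

theorem card_cells_le (X : Finset (Fin n)) (B : SimpleGraph (Fin n)) :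
    (cells X B).card ≤ 8 * X.card + 8 * B.edgeSet.ncard := by
  classical
  have h : (Finset.univ.filter fun p : Fin n × Fin n => B.Adj p.1 p.2).card =
      2 * B.edgeSet.ncard := by
    rw [← sum_ncard_neighborSet, Finset.card_filter, ← Finset.univ_product_univ,
      Finset.sum_product]
    refine Finset.sum_congr rfl fun a _ => ?_
    rw [← Finset.sum_filter, Finset.sum_const, smul_eq_mul, mul_one, ← Set.ncard_coe_finset]
    congr 1
    ext b
    simp
  refine (Finset.card_union_le _ _).trans ((Nat.add_le_add_right ((Finset.card_union_le _ _).trans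
    (Nat.add_le_add_right (Finset.card_union_le _ _) _)) _).trans ?_)
  simp only [Finset.card_product, Finset.card_range]
  have h1 : (X.image (fun v : Fin n => (v : ℕ))).card ≤ X.card := Finset.card_image_le
  have h2 := (Finset.card_image_le (s := Finset.univ.filter fun p : Fin n × Fin n => B.Adj p.1 p.2)
    (f := fun p => (p.1 * n + p.2 : ℕ))).trans h.le
  have e1 : ([0, 4, 5, 6, 8] : List ℕ).toFinset.card = 5 := by decide
  have e2 : ([2, 3, 7] : List ℕ).toFinset.card = 3 := by decide
  have e3 : ([1, 9, 10] : List ℕ).toFinset.card = 3 := by decide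
  have e4 : ([11, 12] : List ℕ).toFinset.card = 2 := by decide
  rw [e1, e2, e3, e4]
  omega

theorem env_cells (hX : ∀ u ∈ X, ∀ v, k ≤ edgeTrussness G u v → v ∈ X) (hnd : Q.Nodup)
    (hne : Q ≠ []) (hQ : ∀ q ∈ Q, q ∈ X) : Env I Q (cells X (baseGraph G k hk X)) k X where
  pos := hk
  closed := hX
  nodup := hnd
  nonempty := hne
  query := hQ
  vcell A hA v hv := by
    simp only [cells, Finset.coe_union, Set.mem_union, Finset.mem_coe, Finset.mem_product]
    exact Or.inl (Or.inl (Or.inl ⟨List.mem_toFinset.2 hA, Finset.mem_image_of_mem _ hv⟩))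
  icell A hA i hi := by
    simp only [cells, Finset.coe_union, Set.mem_union, Finset.mem_coe, Finset.mem_product]
    exact Or.inl (Or.inl (Or.inr ⟨List.mem_toFinset.2 hA, Finset.mem_range.2 hi⟩))
  ecell A hA u hu v huv := by
    simp only [cells, Finset.coe_union, Set.mem_union, Finset.mem_coe, Finset.mem_product]
    refine Or.inl (Or.inr ⟨List.mem_toFinset.2 hA, Finset.mem_image.2 ⟨(u, v), ?_, rfl⟩⟩)
    classical
    exact Finset.mem_filter.2 ⟨Finset.mem_univ _, hu, hX u hu v huv, huv⟩
  qcell A hA i hi := by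
    rw [sum_nb_eq hk X hX] at hi
    simp only [cells, Finset.coe_union, Set.mem_union, Finset.mem_coe, Finset.mem_product]
    exact Or.inr ⟨List.mem_toFinset.2 hA, Finset.mem_range.2 (by omega)⟩

end Initial

/-! ### Runs of the main loop -/

/-- Dependent choice along finitely many rounds; beyond round `t` the sequence is irrelevant. -/
theorem exists_sequence {α : Type*} {Inv : ℕ → α → Prop} {R : ℕ → α → α → Prop} {t : ℕ} {a₀ : α}
    (h0 : Inv 0 a₀) (hs : ∀ l < t, ∀ a, Inv l a → ∃ b, R l a b ∧ Inv (l + 1) b) :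
    ∃ s : ℕ → α, s 0 = a₀ ∧ (∀ l ≤ t, Inv l (s l)) ∧ ∀ l < t, R l (s l) (s (l + 1)) := by
  classical
  set s : ℕ → α := fun l => Nat.rec a₀ (fun l a =>
    if h : ∃ b, R l a b ∧ Inv (l + 1) b then h.choose else a) l with hsdef
  have hsucc : ∀ l, (h : ∃ b, R l (s l) b ∧ Inv (l + 1) b) → s (l + 1) = h.choose :=
    fun l h => dif_pos h
  have hInv : ∀ l ≤ t, Inv l (s l) := by
    intro l
    induction l with
    | zero => exact fun _ => h0
    | succ l ih =>
        intro hl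
        have hex := hs l hl _ (ih (by omega))
        rw [hsucc l hex]
        exact hex.choose_spec.2
  refine ⟨s, rfl, hInv, fun l hl => ?_⟩
  have hex := hs l hl _ (hInv l hl.le)
  rw [hsucc l hex]
  exact hex.choose_spec.1

/-- The second component of `s` is the time elapsed. The loop unfolds at its front, hence the
induction on the number of rounds left. -/
theorem exec_loop_of_sequence {inp : Query → ℕ → ℕ → ℕ} {B : ℕ} {a : Expr} {p : Prog} {t : ℕ}
    {s : ℕ → Config × ℕ}
    (hs : ∀ l < t, a.eval (s l).1.reg ≠ 0 ∧ a.peak (s l).1.reg ≤ B ∧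
      ∃ T, Exec inp B p (s l).1 T (s (l + 1)).1 ∧ (s (l + 1)).2 = (s l).2 + (a.cost + 1 + T))
    (he : a.eval (s t).1.reg = 0) (hp : a.peak (s t).1.reg ≤ B) {l : ℕ} (hl : l ≤ t) :
    ∃ T, Exec inp B (.loop a p) (s l).1 T (s t).1 ∧ (s l).2 + T = (s t).2 + (a.cost + 1) := by
  induction hd : t - l generalizing l with
  | zero =>
      obtain rfl : l = t := by omega
      exact ⟨_, .loop_false hp he, rfl⟩
  | succ d ih =>
      have hlt : l < t := by omega
      obtain ⟨h1, h2, T, h3, h4⟩ := hs l hlt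
      obtain ⟨T', h5, h6⟩ := ih (l := l + 1) hlt (by omega)
      exact ⟨_, .loop_true h2 h1 h3 h5, by omega⟩

end TrussSearch

namespace TrussSearch

/-! ### The algorithm -/

section Algorithm

variable {n : ℕ} {G : SimpleGraph (Fin n)} {I : TrussIndex G} {Q : List (Fin n)}
  {U : Set (ℕ × ℕ)} {k : ℕ} {hk : 1 ≤ k} {X : Finset (Fin n)}

theorem length_le_of_nodup {L : List (Fin n)} (h : L.Nodup) : L.length ≤ n := by
  have := h.length_le_card
  rwa [Fintype.card_fin] at this

theorem TrussIndex.ask_le (I : TrussIndex G) (hQ : Q.Nodup) (q : Query) (x y : ℕ) :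
    I.ask Q q x y ≤ n + 2 := by
  cases q with
  | numVertices => exact Nat.le_add_right _ _
  | numQueryNodes => exact (length_le_of_nodup hQ).trans (Nat.le_add_right _ _)
  | queryNode =>
      simp only [TrussIndex.ask]
      split <;> omega
  | degree =>
      simp only [TrussIndex.ask]
      split
      · exact (length_le_of_nodup (I.nodup _)).trans (Nat.le_add_right _ _)
      · omega
  | neighbour =>
      simp only [TrussIndex.ask]
      split
      · split <;> omega
      · omega
  | mark =>
      simp only [TrussIndex.ask]
      split
      · exact List.findIdx_le_length.trans
          ((length_le_of_nodup (I.nodup _)).trans (Nat.le_add_right _ _))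
      · omega
  | vertexTruss =>
      simp only [TrussIndex.ask]
      split
      · exact Finset.sup_le fun u _ => edgeTrussness_le _ _
      · omega
  | edgeTruss =>
      simp only [TrussIndex.ask]
      split
      · exact edgeTrussness_le _ _
      · omega

open Classical in
theorem ncard_le_succ (P : ℕ → Prop) (l : ℕ) :
    {i | i ≤ l + 1 ∧ P i}.ncard = {i | i ≤ l ∧ P i}.ncard + if P (l + 1) then 1 else 0 := by
  have hfin : {i | i ≤ l ∧ P i}.Finite := (Set.finite_Iic l).subset fun i hi => hi.1
  split
  case isTrue h =>
    rw [← Set.ncard_insert_of_notMem (a := l + 1) (fun h => by have := h.1; omega) hfin]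
    congr 1
    ext i
    simp only [Set.mem_ofPred_eq, Set.mem_insert_iff]
    constructor
    · rintro ⟨h1, h2⟩
      by_cases hi : i = l + 1
      · exact Or.inl hi
      · exact Or.inr ⟨by omega, h2⟩
    · rintro (rfl | ⟨h1, h2⟩)
      · exact ⟨le_rfl, h⟩
      · exact ⟨by omega, h2⟩
  case isFalse h =>
    rw [add_zero]
    congr 1
    ext i
    simp only [Set.mem_ofPred_eq]
    constructor
    · rintro ⟨h1, h2⟩
      by_cases hi : i = l + 1
      · exact absurd (hi ▸ h2) h
      · exact ⟨by omega, h2⟩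
    · rintro ⟨h1, h2⟩
      exact ⟨by omega, h2⟩

open Classical in
theorem ncard_le_zero (P : ℕ → Prop) : {i | i ≤ 0 ∧ P i}.ncard = if P 0 then 1 else 0 := by
  split
  case isTrue h =>
    rw [Set.ncard_eq_one]
    refine ⟨0, ?_⟩
    ext i
    simp only [Set.mem_ofPred_eq, Set.mem_singleton_iff, Nat.le_zero]
    exact ⟨fun h => h.1, fun hi => ⟨hi, hi ▸ h⟩⟩
  case isFalse h =>
    rw [Set.ncard_eq_zero ((Set.finite_Iic 0).subset fun i hi => hi.1)]
    ext i
    simp only [Set.mem_ofPred_eq, Set.mem_empty_iff_false, iff_false, Nat.le_zero]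
    rintro ⟨rfl, h0⟩
    exact h h0

/-- The configuration before round `l`, reached in time `T`, where `D` is a bound for the time and
the potential before the first round. -/
structure Progress (I : TrussIndex G) (Q : List (Fin n)) (U : Set (ℕ × ℕ)) (k : ℕ) (hk : 1 ≤ k)
    (X : Finset (Fin n)) (D l : ℕ) (c : Config) (T : ℕ) : Prop where
  ready : ∃ A ≤ baseGraph G k hk X, Ready I Q k hk X A c ∧ Models Q A (graphAt G (nodes Q) l) ∧
    T + 300 * edgeWork I k A ≤ D + l * (1000 * (Q.length * weight I k X) + 2)
  represents : Represents G Q l c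
  -- Register `6` represents `d` only up to comparison with numbers below `n`: before the first
  -- round it is `n` in place of `+∞`.
  distance : ∀ x < n, min (stateAt G (nodes Q) l).d x = ((min (c.reg 6) x : ℕ) : ℕ∞)
  start : l = 0 → c.reg 6 = n
  index : 0 < l → c.reg 2 < l
  value : 0 < l → c.mem 2 (c.reg 2) = c.reg 6
  best : ∀ i < l, c.reg 6 ≤ c.mem 2 i
  card : (graphAt G (nodes Q) l).verts.ncard + l * k ≤ X.card
  used : (c.used : Set (ℕ × ℕ)) ⊆ U
  bounded : c.Bounded (n + 2 + T)

variable {D l T : ℕ} {c : Config}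

theorem Progress.lt_card (P : Progress I Q U k hk X D l c T) (hne : Q ≠ [])
    (hc : Connects (graphAt G (nodes Q) l) (nodes Q)) : l < X.card := by
  obtain ⟨q, hq⟩ := List.exists_mem_of_ne_nil Q hne
  have h1 : 0 < (graphAt G (nodes Q) l).verts.ncard :=
    (Set.ncard_pos (Set.toFinite _)).2 ⟨q, hc.1 hq⟩
  have h2 := P.card
  have h3 := Nat.le_mul_of_pos_right l hk
  omega

theorem Progress.flag (P : Progress I Q U k hk X D l c T) (hQ : Q.Nodup) :
    c.reg 5 ≠ 0 ↔ Connects (graphAt G (nodes Q) l) (nodes Q) := by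
  obtain ⟨A, -, hR, hM, -⟩ := P.ready
  rw [hR.flag, hM.connects_iff hQ]
  simp

theorem mem_of_models {A : SimpleGraph (Fin n)} {H : G.Subgraph} (hA : A ≤ baseGraph G k hk X)
    (M : Models Q A H) : ∀ v ∈ H.verts, v ∈ X := fun v hv => by
  obtain ⟨w, hw⟩ := exists_adj_of_reachCount_pos ((M.verts v).1 hv)
  exact (hA hw).1

/-- The `2` steps besides the body are the loop test. The execution is provided for all sufficiently
large word bounds, since the final bound depends on the total time. -/
theorem Progress.step (P : Progress I Q U k hk X D l c T) (E : Env I Q U k X)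
    (hn : 2 ≤ n) (hmax : k = maxTrussness G (nodes Q))
    (hc : Connects (graphAt G (nodes Q) l) (nodes Q)) :
    ∃ c' T', Progress I Q U k hk X D (l + 1) c' (T + (2 + T')) ∧
      ∀ B, (n + 2 + (T + (2 + T')) + 2) ^ 12 ≤ B → Exec (I.ask Q) B roundProg c T' c' := by
  classical
  have hlt := P.lt_card E.nonempty hc
  obtain ⟨A, hA, hR, hM, hT⟩ := P.ready
  have hl := P.represents.round
  have hX := mem_of_models hA hM
  have hecc := hM.graphDist_eq hc hX E.nonempty
  have hecc_lt := hM.eccentricity_lt hc hX E.nonempty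
  obtain ⟨B₀, T', c', hexec, hused, A', hR', h1, h2, r1, r6, r2, m2, m0, m1, hT'⟩ :=
    roundProg_spec E hR (hl ▸ hlt)
  rw [hl] at r1 r2 m2
  have hd : min (stateAt G (nodes Q) l).d (graphDist (graphAt G (nodes Q) l) (nodes Q)) =
      ((min (c.reg 6) (eccentricity Q A X) : ℕ) : ℕ∞) := by
    rw [hecc]; exact P.distance _ hecc_lt
  have hM' : Models Q A' (graphAt G (nodes Q) (l + 1)) := by
    have := hM.adj_nextState hc E.nonempty hd hR'.truss h1 h2
    rw [hmax] at this
    exact this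
  have hA' : A' ≤ baseGraph G k hk X := fun u v h => hA (h1 u v h).1
  have hcard : (graphAt G (nodes Q) (l + 1)).verts.ncard + k ≤
      (graphAt G (nodes Q) l).verts.ncard := by
    have := hM.ncard_nextState hc hX E.nonempty (dd := (stateAt G (nodes Q) l).d) hR.truss
    rw [hmax] at this ⊢
    exact this
  obtain ⟨hb, hex⟩ := hexec.bounded (K := 12) (by decide) (by omega) (I.ask_le E.nodup)
    (by omega) (n + 2 + T) (by omega) P.bounded
  refine ⟨c', T', ⟨⟨A', hA', hR', hM', ?_⟩, ⟨?_, r1, fun v => ?_, fun u v => ?_, fun i hi => ?_⟩,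
    fun x hx => ?_, by omega, fun _ => ?_, fun _ => ?_, fun i hi => ?_, ?_, ?_,
    hb.mono (by omega)⟩, fun B hB => hex B (le_trans (Nat.pow_le_pow_left (by omega) 12) hB)⟩
  · rw [add_one_mul]
    omega
  · obtain ⟨L, S⟩ := hR'.setup
    rw [S.level, hmax]
  · rw [ncard_le_succ, ← P.represents.verts v, m0 v]
    congr 1
    refine if_congr ?_ rfl rfl
    rw [hM'.verts]
    exact ⟨fun h => h.2, fun h => ⟨mem_of_models hA' hM' v ((hM'.verts v).2 h), h⟩⟩
  · rw [ncard_le_succ (fun i => (graphAt G (nodes Q) i).Adj u v), ← P.represents.edges u v, m1 u v]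
    congr 1
    exact if_congr (hM'.adj u v).symm rfl rfl
  · rw [m2]
    split
    case isTrue h => rw [h, hecc]
    case isFalse h => exact P.represents.dists i (by omega)
  · have hdd : (stateAt G (nodes Q) (l + 1)).d =
        ((min (c.reg 6) (eccentricity Q A X) : ℕ) : ℕ∞) := hd
    rw [hdd, r6]
    exact ((Nat.mono_cast (α := ℕ∞)).map_min (a := min _ _) (b := x)).symm
  · rw [r2]
    split
    case isTrue h => omega
    case isFalse h =>
      -- In round `0` register `6` is `n`, so the measured distance is always an improvement and
      -- this case cannot occur.
      rcases Nat.eq_zero_or_pos l with h0 | h0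
      · have := P.start h0; omega
      · have := P.index h0; omega
  · rw [r2, r6, m2]
    split
    case isTrue h => rw [if_pos rfl]; omega
    case isFalse h =>
      rcases Nat.eq_zero_or_pos l with h0 | h0
      · have := P.start h0; omega
      · have h3 := P.index h0
        have h4 := P.value h0
        rw [if_neg (by omega)]
        omega
  · rw [r6, m2]
    split
    case isTrue h => omega
    case isFalse h =>
      have := P.best i (by omega)
      omega
  · have := P.card
    rw [add_one_mul]
    omega
  · exact hused.trans (Set.union_subset P.used subset_rfl)

theorem Progress.exists_round (E : Env I Q U k X) (hn : 2 ≤ n)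
    (hmax : k = maxTrussness G (nodes Q)) (h0 : Progress I Q U k hk X D 0 c T) (l : ℕ)
    (h : ∀ i < l, Connects (graphAt G (nodes Q) i) (nodes Q)) :
    ∃ c' T', Progress I Q U k hk X D l c' T' := by
  induction l with
  | zero => exact ⟨c, T, h0⟩
  | succ l ih =>
      obtain ⟨c', T', P⟩ := ih fun i hi => h i (by omega)
      obtain ⟨c'', T'', P', -⟩ := P.step E hn hmax (h l (by omega))
      exact ⟨c'', _, P'⟩

/-- The number of rounds. -/
theorem Progress.exists_numRounds (E : Env I Q U k X) (hn : 2 ≤ n)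
    (hmax : k = maxTrussness G (nodes Q)) (h0 : Progress I Q U k hk X D 0 c T) :
    ∃ t, (∀ l < t, Connects (graphAt G (nodes Q) l) (nodes Q)) ∧
      ¬ Connects (graphAt G (nodes Q) t) (nodes Q) ∧ t * k ≤ X.card := by
  classical
  have hex : ∃ t, ¬ Connects (graphAt G (nodes Q) t) (nodes Q) := by
    by_contra hno
    push Not at hno
    -- Each round deletes a vertex, so the loop condition cannot hold before round `|X|`.
    obtain ⟨c', T', P⟩ := Progress.exists_round E hn hmax h0 X.card fun i _ => hno i
    have := P.lt_card E.nonempty (hno _)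
    omega
  have hlt : ∀ l < Nat.find hex, Connects (graphAt G (nodes Q) l) (nodes Q) := fun l hl => by
    have := Nat.find_min hex hl
    push Not at this
    exact this
  refine ⟨Nat.find hex, hlt, Nat.find_spec hex, ?_⟩
  obtain ⟨c', T', P⟩ := Progress.exists_round E hn hmax h0 _ hlt
  have := P.card
  omega

theorem Config.start_bounded (M : ℕ) : Config.start.Bounded M :=
  ⟨fun _ => Nat.zero_le _, fun _ _ => Nat.zero_le _⟩

/-- The whole run, given the result of the initial part. -/
theorem implements_of_progress {T₀ t : ℕ} {c₀ : Config} (E : Env I Q U k X) (hn : 2 ≤ n)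
    (hmax : k = maxTrussness G (nodes Q)) (P₀ : Progress I Q U k hk X D 0 c₀ T₀)
    (hinit : ∀ B, (n + 2 + T₀ + 2) ^ 12 ≤ B → Exec (I.ask Q) B initProg Config.start T₀ c₀)
    (ht : ∀ l < t, Connects (graphAt G (nodes Q) l) (nodes Q))
    (hs : ¬ Connects (graphAt G (nodes Q) t) (nodes Q)) (htpos : 0 < t) :
    ∃ T S, T ≤ D + t * (1000 * (Q.length * weight I k X) + 2) + 4 ∧
      (∃ F : Finset (ℕ × ℕ), (F : Set (ℕ × ℕ)) ⊆ U ∧ S = F.card) ∧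
      ∀ B, (n + 2 + T + 2) ^ 12 ≤ B → bulkDelete.Implements I Q t B T S := by
  obtain ⟨s, hs0, hInv, hstep⟩ := exists_sequence (α := Config × ℕ) (a₀ := (c₀, T₀)) (t := t)
    (Inv := fun l s => Progress I Q U k hk X D l s.1 s.2)
    (R := fun l a b => ∃ T', b.2 = a.2 + (2 + T') ∧
      ∀ B, (n + 2 + b.2 + 2) ^ 12 ≤ B → Exec (I.ask Q) B roundProg a.1 T' b.1)
    P₀ (fun l hl a ha => by
      obtain ⟨c', T', P', hex⟩ := ha.step E hn hmax (ht l hl)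
      exact ⟨(c', _), ⟨T', rfl, hex⟩, P'⟩)
  have hmono : ∀ l ≤ t, (s l).2 ≤ (s t).2 := by
    intro l hl
    induction hd : t - l generalizing l with
    | zero => rw [show l = t by omega]
    | succ d ih =>
        obtain ⟨T', h, -⟩ := hstep l (by omega)
        have := ih (l + 1) (by omega) (by omega)
        omega
  have hT0 : T₀ ≤ (s t).2 := by
    have := hmono 0 (Nat.zero_le _)
    rwa [hs0] at this
  have Pt := hInv t le_rfl
  -- The last loop test and the final assignment take two steps each.
  refine ⟨(s t).2 + 4, (s t).1.used.card, ?_, ⟨(s t).1.used, Pt.used, rfl⟩, fun B hB => ?_⟩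
  · obtain ⟨A, -, -, -, h⟩ := Pt.ready
    omega
  have hword : ∀ x ≤ (s t).2, (n + 2 + x + 2) ^ 12 ≤ B := fun x hx =>
    (Nat.pow_le_pow_left (by omega) 12).trans hB
  have hval : ∀ l ≤ t, ∀ r, (s l).1.reg r ≤ B := fun l hl r => by
    have h1 := (hInv l hl).bounded.1 r
    have h2 := hmono l hl
    have h3 := Nat.le_self_pow (n := 12) (by omega) (n + 2 + ((s t).2 + 4) + 2)
    omega
  have hround : ∀ l < t, (s l).1.reg 5 ≠ 0 ∧ ∃ T', Exec (I.ask Q) B roundProg (s l).1 T'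
      (s (l + 1)).1 ∧ (s (l + 1)).2 = (s l).2 + (2 + T') := fun l hl => by
    obtain ⟨T', h1, h2⟩ := hstep l hl
    exact ⟨((hInv l hl.le).flag E.nodup).2 (ht l hl), T',
      h2 B (hword _ (hmono (l + 1) hl)), h1⟩
  have hzero : (s t).1.reg 5 = 0 := by
    by_contra h
    exact hs ((Pt.flag E.nodup).1 h)
  have hinit' : Exec (I.ask Q) B initProg Config.start T₀ (s 0).1 := by
    rw [hs0]; exact hinit B (hword _ hT0)
  obtain ⟨T₁, hloop, hT₁⟩ := exec_loop_of_sequence (inp := I.ask Q) (B := B) (a := .reg 5)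
    (p := roundProg) (t := t) (s := s)
    (fun l hl => ⟨(hround l hl).1, hval l hl.le 5, (hround l hl).2⟩) hzero (hval t le_rfl 5)
    (Nat.zero_le t)
  have hfinal : Exec (I.ask Q) B (.assign 2 (.reg 2)) (s t).1 2
      ((s t).1.setReg 2 ((s t).1.reg 2)) := Exec.assign (a := .reg 2) (hval t le_rfl 2)
  -- The best index is maintained during the rounds, so the final program part has no effect.
  have hout : (s t).1.setReg 2 ((s t).1.reg 2) = (s t).1 := by
    simp [Config.setReg]
  rw [hout] at hfinal
  refine ⟨fun l => (s l).1, (s t).1, ?_, rfl, ⟨_, hinit'⟩, fun l hl => ⟨(hround l hl).1, ?_⟩, hzero,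
    ⟨_, hfinal⟩, fun l hl => (hInv l hl).represents, Pt.represents, Pt.index htpos,
    fun l hl => ?_⟩
  · have h := Exec.seq hinit' (Exec.seq hloop hfinal)
    have e : T₀ + (T₁ + 2) = (s t).2 + 4 := by
      rw [hs0] at hT₁
      simp only [Expr.cost] at hT₁
      omega
    rw [e] at h
    exact h
  · obtain ⟨T', h, -⟩ := (hround l hl).2
    exact ⟨T', h⟩
  · rw [← Pt.represents.dists _ (Pt.index htpos), ← Pt.represents.dists l hl, Nat.cast_le,
      Pt.value htpos]
    exact Pt.best l hl

end Algorithm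

end TrussSearch

/-! ### The state before the first round, and the numerical bounds -/

namespace TrussSearch

section Start

variable {n : ℕ} {G : SimpleGraph (Fin n)} {I : TrussIndex G} {Q : List (Fin n)}
  {U : Set (ℕ × ℕ)} {k : ℕ} {hk : 1 ≤ k} {X : Finset (Fin n)} {q₀ : Fin n}

/-- The constant `D` is the time of the initial part plus the potential of the full graph `G₀`; this
explains `1300 = 1000 + 300`. -/
theorem exists_progress {K : ℕ} (E : Env I Q U k X) (hn : 2 ≤ n)
    (hmax : k = maxTrussness G (nodes Q)) (hq : Q.head? = some q₀)
    (hX : ∀ v, v ∈ X ↔ (levelGraph G k hk).Reachable q₀ v)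
    (hK : K = Finset.univ.sup fun u => edgeTrussness G q₀ u) (hkK : k ≤ K)
    (hs : startGraph G (nodes Q) = levelComponent G k hk q₀)
    (hw : ∃ w, (levelComponent G k hk q₀).Adj q₀ w) :
    ∃ D T c, Progress I Q U k hk X D 0 c T ∧
      (∀ B, (n + 2 + T + 2) ^ 12 ≤ B → Exec (I.ask Q) B initProg Config.start T c) ∧
      D ≤ 1000 * ((K + 1) * weight I k X + Q.length * weight I k X) +
        1300 * edgeWork I k (baseGraph G k hk X) := by
  classical
  have hq0 : q₀ ∈ Q := List.mem_of_mem_head? hq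
  obtain ⟨B₀, T, c, hexec, hused, hR, r1, r6, m0, m1, hT⟩ := initProg_spec E hq hX hK hkK
    (fun κ hκ hκK hr => hmax ▸ le_maxTrussness hκ (hK ▸ hκK) hr) (gTruss_baseGraph hX)
  have hM := models_levelComponent hX hq0 E.query hw
  have h0 : graphAt G (nodes Q) 0 = levelComponent G k hk q₀ := hs
  rw [← h0] at hM
  obtain ⟨hb, hex⟩ := hexec.bounded (K := 12) (by decide) (by omega) (I.ask_le E.nodup)
    (by omega) (n + 2) le_rfl (Config.start_bounded _)
  refine ⟨T + 300 * edgeWork I k (baseGraph G k hk X), T, c, ⟨⟨_, le_rfl, hR, hM, by omega⟩,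
    ⟨?_, r1, fun v => ?_, fun u v => ?_, fun i hi => absurd hi (Nat.not_lt_zero i)⟩,
    fun x hx => ?_, fun _ => r6, fun h => absurd h (lt_irrefl 0), fun h => absurd h (lt_irrefl 0),
    fun i hi => absurd hi (Nat.not_lt_zero i), ?_, ?_, hb⟩, hex, by omega⟩
  · obtain ⟨L, S⟩ := hR.setup
    rw [S.level, hmax]
  · rw [ncard_le_zero, m0 v]
    refine if_congr ?_ rfl rfl
    rw [hM.verts]
    exact ⟨fun h => h.2, fun h => ⟨mem_of_models le_rfl hM v ((hM.verts v).2 h), h⟩⟩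
  · rw [ncard_le_zero (fun i => (graphAt G (nodes Q) i).Adj u v), m1 u v]
    exact if_congr (hM.adj u v).symm rfl rfl
  · rw [r6, min_eq_right hx.le]
    exact min_eq_right le_top
  · have := numVerts_levelComponent (G := G) (hk := hk) hX
    rw [← h0, numVerts] at this
    omega
  · refine hused.trans (Set.union_subset ?_ subset_rfl)
    intro x hx
    simp [Config.start] at hx

theorem numEdges_le (H : G.Subgraph) : 2 * numEdges H ≤ n * n := by
  rw [numEdges, ← SimpleGraph.Subgraph.edgeSet_spanningCoe, ← sum_ncard_neighborSet]
  refine (Finset.sum_le_card_nsmul _ _ n fun v _ => ?_).trans ?_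
  · have := Set.ncard_le_card (H.spanningCoe.neighborSet v)
    rwa [Nat.card_fin] at this
  · simp

theorem arboricity_le_card (H : G.Subgraph) : arboricity H ≤ n := by
  refine arboricity_le (coveredByForests_of_degree_le fun v => ?_)
  have := Set.ncard_le_card (H.spanningCoe.neighborSet v)
  rwa [Nat.card_fin] at this

/-- The search for the level costs `(K + 1)W ≤ 4ρ · 4m`, the supports and all peeling cost `O(ρm)`,
and the rounds cost `t · O(qm)`. A power of two as constant suits `word_bound`. -/
theorem time_bound {q t ρ m w K W e D T : ℕ} (hq : 1 ≤ q) (hρ : 1 ≤ ρ) (ht : 1 ≤ t) (hw : w ≤ 2 * m)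
    (hm : 1 ≤ m) (hW : W = 2 * m + w) (hK : K ≤ 2 * ρ + 1) (he : e ≤ 2 * m + 4 * (ρ * m))
    (hD : D ≤ 1000 * ((K + 1) * W + q * W) + 1300 * e)
    (hT : T ≤ D + t * (1000 * (q * W) + 2) + 4) : T ≤ 32768 * ((q * t + ρ) * m) := by
  have h1 : (K + 1) * W ≤ (4 * ρ) * (4 * m) := Nat.mul_le_mul (by omega) (by omega)
  have h2 : q * W ≤ 4 * (q * m) := by
    calc q * W ≤ q * (4 * m) := Nat.mul_le_mul_left q (by omega)
      _ = 4 * (q * m) := by ring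
  have h3 : t * (q * W) ≤ 4 * (q * t * m) := by
    calc t * (q * W) ≤ t * (4 * (q * m)) := Nat.mul_le_mul_left t h2
      _ = 4 * (q * t * m) := by ring
  have h4 : q * m ≤ q * t * m := Nat.mul_le_mul_right m (Nat.le_mul_of_pos_right q ht)
  have h5 : t ≤ q * t * m := by
    calc t = 1 * t * 1 := by ring
      _ ≤ q * t * m := Nat.mul_le_mul (Nat.mul_le_mul_right t hq) hm
  have h6 : m ≤ ρ * m := Nat.le_mul_of_pos_left m hρ
  have h7 : (4 * ρ) * (4 * m) = 16 * (ρ * m) := by ring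
  have h8 : t * (1000 * (q * W) + 2) = 1000 * (t * (q * W)) + 2 * t := by ring
  have h9 : (q * t + ρ) * m = q * t * m + ρ * m := by ring
  rw [h9]
  omega

/-- The base is at most `2 ^ 17 * n ^ 4 ≤ n ^ 21`, as `n ≥ 2`, and `12 · 21 = 252`. -/
theorem word_bound {q t ρ m T : ℕ} (hn : 2 ≤ n) (hq : q ≤ n) (ht : t ≤ n) (hρ : ρ ≤ n)
    (hm : 2 * m ≤ n * n) (hT : T ≤ 32768 * ((q * t + ρ) * m)) :
    (n + 2 + T + 2) ^ 12 ≤ n ^ 252 := by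
  have h1 : (q * t + ρ) * m ≤ n ^ 2 * n ^ 2 := by
    have h2 : q * t ≤ n * n := Nat.mul_le_mul hq ht
    have h3 : n ≤ n * n := Nat.le_mul_self n
    have h4 : (q * t + ρ) * (2 * m) ≤ (2 * (n * n)) * (n * n) :=
      Nat.mul_le_mul (by omega) hm
    nlinarith
  have h5 : 2 ^ 17 ≤ n ^ 17 := Nat.pow_le_pow_left hn 17
  have h6 : n + 2 + T + 2 ≤ 2 ^ 17 * n ^ 4 := by
    have h7 : n ≤ n ^ 4 := Nat.le_self_pow (by omega) n
    have h8 : n ^ 2 * n ^ 2 = n ^ 4 := by ring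
    omega
  calc (n + 2 + T + 2) ^ 12 ≤ (n ^ 17 * n ^ 4) ^ 12 :=
        Nat.pow_le_pow_left (h6.trans (Nat.mul_le_mul_right _ h5)) 12
    _ = n ^ 252 := by rw [← pow_add, ← pow_mul]

end Start

end TrussSearch

/-! ### The theorem -/

theorem theorem5 :
    ∃ (P : LoopProgram) (C e : ℕ),
      ∀ (n : ℕ) (G : SimpleGraph (Fin n)) (I : TrussIndex G) (Q : List (Fin n)),
        2 ≤ n → G.Connected → Q ≠ [] → Q.Nodup →
        ∃ t T S : ℕ,
          -- the loop condition holds before rounds `0, …, t - 1` and fails then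
          (∀ l < t, Connects (graphAt G (nodes Q) l) (nodes Q)) ∧
          ¬ Connects (graphAt G (nodes Q) t) (nodes Q) ∧
          -- the number of rounds
          (t : ℝ) ≤ C * ((numVerts (startGraph G (nodes Q)) : ℝ) / maxTrussness G (nodes Q)) ∧
          -- time and space on words of `O(log n)` bits
          P.Implements I Q t (n ^ e) T S ∧
          T ≤ C * ((Q.length * t + arboricity (startGraph G (nodes Q))) *
            numEdges (startGraph G (nodes Q))) ∧
          S ≤ C * numEdges (startGraph G (nodes Q)) ∧
          -- the bounds on the arboricity
          arboricity (startGraph G (nodes Q)) ≤ maxDegree (startGraph G (nodes Q)) ∧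
          (¬ (numVerts (startGraph G (nodes Q)) = 3 ∧ numEdges (startGraph G (nodes Q)) = 3) →
            (arboricity (startGraph G (nodes Q)) : ℝ) ≤
              √(numEdges (startGraph G (nodes Q)) : ℝ)) := by
  classical
  refine ⟨bulkDelete, 32768, 252, fun n G I Q hn hG hne hnd => ?_⟩
  obtain ⟨q₀, hq⟩ : ∃ q₀, Q.head? = some q₀ := Option.isSome_iff_exists.1 (by
    rw [List.isSome_head?]; exact hne)
  have hq0 : q₀ ∈ nodes Q := List.mem_of_mem_head? hq
  have hk : 1 ≤ maxTrussness G (nodes Q) :=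
    le_trans (by omega) (exists_isTruss_maxTrussness hn hG (nodes Q)).1
  obtain ⟨hs, hkK, hr, hw⟩ := startGraph_eq hn hG hq0 hk
  obtain ⟨k, hmax⟩ : ∃ k, k = maxTrussness G (nodes Q) := ⟨_, rfl⟩
  rw [← hmax] at hkK ⊢
  replace hk : 1 ≤ k := hmax ▸ hk
  replace hs : startGraph G (nodes Q) = levelComponent G k hk q₀ := by
    subst hmax; exact hs
  replace hr : ∀ q ∈ Q, (levelGraph G k hk).Reachable q₀ q := by
    subst hmax; exact hr
  replace hw : ∃ w, (levelComponent G k hk q₀).Adj q₀ w := by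
    subst hmax; exact hw
  set X : Finset (Fin n) := Finset.univ.filter fun v => (levelGraph G k hk).Reachable q₀ v with hXdef
  have hX : ∀ v, v ∈ X ↔ (levelGraph G k hk).Reachable q₀ v := fun v => by simp [hXdef]
  have hcl := closed_of_mem_iff_reachable hX
  have hQX : ∀ q ∈ Q, q ∈ X := fun q hq => (hX q).2 (hr q hq)
  have E := env_cells (I := I) (hk := hk) hcl hnd hne hQX
  obtain ⟨D, T₀, c₀, P₀, hinit, hD⟩ := exists_progress E hn hmax hq hX rfl hkK hs hw
  obtain ⟨t, ht, hfail, htk⟩ := P₀.exists_numRounds E hn hmax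
  have hadj : ∀ v ∈ (levelComponent G k hk q₀).verts, ∃ w, (levelComponent G k hk q₀).Adj v w :=
    fun v hv => exists_adj_of_connected connected_levelComponent
      ⟨s(q₀, hw.choose), hw.choose_spec⟩ hv
  have hv := numVerts_levelComponent (G := G) hX
  have hm := numEdges_levelComponent (G := G) hX
  have hcov := coveredByForests_arboricity (levelComponent G k hk q₀)
  rw [spanningCoe_levelComponent hX] at hcov
  have hρ := one_le_arboricity hw.choose_spec
  -- No vertex of `G₀` is isolated, so `n' ≤ 2m'`; this turns linear bounds in `n' + m'` into linear
  -- bounds in `m'`.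
  have hw2 : X.card ≤ 2 * (baseGraph G k hk X).edgeSet.ncard := by
    have := ncard_mul_le (H := baseGraph G k hk X) (S := (X : Set (Fin n))) (d := 1) fun v hv => by
      obtain ⟨w, h⟩ := hadj v ((hX v).1 hv)
      rw [Nat.one_le_iff_ne_zero, ← Nat.pos_iff_ne_zero, Set.ncard_pos (Set.toFinite _)]
      refine ⟨w, ?_⟩
      rw [SimpleGraph.mem_neighborSet, ← spanningCoe_levelComponent hX]
      exact h
    rwa [Set.ncard_coe_finset, mul_one] at this
  have hXpos : 0 < X.card := Finset.card_pos.2 ⟨q₀, hQX q₀ hq0⟩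
  -- `G₀` connects `Q`, so there is at least one round and hence a result.
  have htpos : 0 < t := by
    rcases Nat.eq_zero_or_pos t with h0 | h0
    · refine absurd ⟨fun q hq => ?_, fun p hp q hq => ?_⟩ (h0 ▸ hfail)
      · change q ∈ (startGraph G (nodes Q)).verts
        rw [hs]; exact hr q hq
      · change (startGraph G (nodes Q)).spanningCoe.Reachable p q
        rw [hs]; exact reachable_of_connected connected_levelComponent (hr p hp) (hr q hq)
    · exact h0
  obtain ⟨T, S, hT, ⟨F, hF, rfl⟩, himp⟩ :=
    implements_of_progress E hn hmax P₀ hinit ht hfail htpos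
  have hlen : 1 ≤ Q.length := List.length_pos_iff.2 hne
  have hW : weight I k X = 2 * (baseGraph G k hk X).edgeSet.ncard + X.card := by
    rw [weight, Finset.sum_add_distrib, sum_nb_eq hk X hcl, ← Finset.card_eq_sum_ones]
  have hTle := time_bound hlen hρ htpos hw2 (by omega) hW
    (vertexTruss_le hcl hcov (hQX q₀ hq0) rfl hkK) (edgeWork_le (I := I) hcl hcov) hD hT
  have htn : t ≤ n := by
    have h1 := Finset.card_le_univ X
    rw [Fintype.card_fin] at h1
    have h2 := Nat.le_mul_of_pos_right t hk
    omega
  rw [← hm] at hTle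
  have hword := word_bound hn (length_le_of_nodup hnd) htn (arboricity_le_card _)
    (numEdges_le _) hTle
  rw [hs]
  refine ⟨t, T, F.card, ht, hfail, ?_, himp _ hword, hTle, ?_, arboricity_le_maxDegree _,
    arboricity_le_sqrt hadj ⟨_, hw⟩⟩
  · rw [hv]
    have h1 : (t : ℝ) ≤ (X.card : ℝ) / k := by
      rw [le_div_iff₀ (by exact_mod_cast hk)]
      exact_mod_cast htk
    have h2 : (0 : ℝ) ≤ (X.card : ℝ) / k := by positivity
    push_cast
    linarith
  · have h1 := Finset.card_le_card (Finset.coe_subset.1 hF)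
    have h2 := card_cells_le X (baseGraph G k hk X)
    rw [hm]
    omega
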